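/- **Notation.** Let $N\ge 1$ be an integer and $k\in\frac12\mathbb Z$ with $k\neq 1$. Powers are taken with $-\pi<\arg\le\pi$ unless a branch is specified. Write $z=x+iy\in\mathbb H$ and $\gamma=\begin{pmatrix}a&b\\c&d\end{pmatrix}$. Let $\theta(z)=1+2\sum_{n\ge1}e^{2\pi i n^2z}$ and, for $\gamma\in\Gamma_0(4)$, $\chi_\theta(\gamma)=\theta(\gamma z)/((cz+d)^{1/2}\theta(z))$. A harmonic weak Maass form of weight $w\in\frac12\mathbb Z$ on $\Gamma_0(4N)$ is a smooth $f:\mathbb H\to\mathbb C$ such that $\overline{\chi_\theta(\gamma)}^{\,2w}(cz+d)^{-w}f(\gamma z)=f(z)$ for all $\gamma\in\Gamma_0(4N)$; $-y^2(\partial_x^2+\partial_y^2)f+iwy(\partial_x+i\partial_y)f=0$; and, for some $\delta>0$, $(cz+d)^{-w}f(\gamma z)=O(e^{\delta y})$ as $y\to\infty$, uniformly in $x$, for every $\gamma\in\mathrm{SL}_2(\mathbb Z)$. Put $\xi_wf=2iy^w\,\overline{\partial f/\partial\bar z}$. **Branches.** Fix $\varepsilon\in\{1,-1\}$. For real $x<0$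 let $x^s_{(\varepsilon)}=|x|^se^{\varepsilon\pi is}$, and let $\Gamma_{(\varepsilon)}(s,x)$ be the analytic continuation of $\Gamma(s,x)=\int_x^\infty e^{-t}t^{s-1}dt$ from $x>0$ to $x<0$ through the upper ($\varepsilon=1$) or lower ($\varepsilon=-1$) half-plane. For $x>0$ both have their usual values. ($\varepsilon=1$ is the principal branch.) **Holomorphic part.** The form $f$ of weight $w\ne1$ decomposes uniquely as $f=f^++f^-$ with $f^+=\sum_{n\gg-\infty}a^+(n)e^{2\pi inz}$ and $f^-=\sum_{n\ne0}a^-(n)B_w(2\pi ny)e^{2\pi inx}+a^-(0)y^{1-w}$, where $B_w(x)=e^{-x}\Gamma_{(\varepsilon)}(1-w,-2x)$. **$L$-function.** Let $h$ be a weakly holomorphic modular form of weight $k$ and multiplier $\chi_\theta^{2k}$ on $\Gamma_0(4N)$, $h=\sum b(n)e^{2\pi inz}$, and let $r\in\mathbb Q$. Choose $\sigma=\begin{pmatrix}a'&b'\\c'&d'\end{pmatrix}\in\mathrm{SL}_2(\mathbb Z)$ with $\sigma(i\infty)=r$, and write $(c'z+d')^{-k}h(\sigma z)=\sum_{n\gg-\infty}b_\sigma(n)e^{2\pi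 i(n+\kappa)z/\lambda}$ with $\kappa\in[0,1)$ and $\lambda\in\mathbb Z_{>0}$. Define $L_r^{\mathrm{reg}}(h,s)=\Lambda_r(h,s)/\Gamma(s)$, where $$\Lambda_r(h,s)=\sum_{n\ne0}\frac{b(n)e^{2\pi inr}}{n^s}\Gamma(s,2\pi n)+\frac{i^k}{c'^k}(2\pi)^{2s-k}(c'^2)^{k-s}\sum_{n+\kappa\ne0}\frac{b_\sigma(n)e^{2\pi i\frac{n+\kappa}{\lambda}\left(-\frac{d'}{c'}\right)}}{\left(\frac{n+\kappa}{\lambda}\right)^{k-s}}\Gamma\Big(k-s,\frac{2\pi(n+\kappa)}{c'^2\lambda}\Big)-\frac{(2\pi)^sb(0)}{s}-\delta_{\kappa,0}\frac{i^k(2\pi)^sb_\sigma(0)}{c'^k(k-s)}.$$ Here the powers $n^s$, $((n+\kappa)/\lambda)^{k-s}$ and the incomplete gamma functions are taken in the **opposite** branch $-\varepsilon$. (If $h$ has no negative Fourier exponents at $i\infty$ and at $r$, the branch is irrelevant.) **Theorem.** Let $g$ be a harmonic weak Maass form of weight $2-k$ on $\Gamma_0(4N)$ such that $g^+$ has neither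 principal part nor constant term at $i\infty$, i.e. $a^+(n)=0$ for all $n\le0$. Let $h=\xi_{2-k}(g)$, and let $b(0)$ be its constant term at $i\infty$. Let $\gamma=\begin{pmatrix}a&b\\c&d\end{pmatrix}\in\Gamma_0(4N)$ with $c>0$ and $r=\gamma(i\infty)=a/c$. Then, for every choice of $\sigma,\kappa,\lambda$ as above, the two series in $\Lambda_r(h,k-1)$ converge absolutely, and for every $x\in\mathbb R$ $$\lim_{t\to0^+}\left[g^+\Big(\gamma\big(x+\tfrac{i}{c^2t}\big)\Big)-\frac{\chi_\theta^{-2k}(\gamma)\overline{b(0)}}{2^{k-1}(k-1)}\Big(c\big(x+\tfrac{i}{c^2t}\big)+d\Big)^{2-k}\Big(\big(\tfrac1{c^2t}+\tfrac1c\big)-i\big(x+\tfrac dc\big)\Big)^{k-1}\right]=\frac{\Gamma(k-1)}{(4\pi)^{k-1}}\overline{L_r^{\mathrm{reg}}(\xi_{2-k}(g),k-1)}+\frac{(-i)^k\chi_\theta^{-2k}(\gamma)}{(2c)^{k-1}}\overline{b(0)}.$$ In particular ($x=-d/c$), $$\lim_{t\to0^+}\left[g^+(r+it)-\frac{\chi_\theta^{-2k}(\gamma)\overline{b(0)}}{2^{k-1}(k-1)}\Big(\frac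 i{ct}\Big)^{2-k}\Big(\frac1{c^2t}+\frac1c\Big)^{k-1}\right]$$ exists and has the same value. If $k\in\{0,-1,-2,\dots\}$, where $\Gamma(k-1)$ is infinite, $\Gamma(k-1)L_r^{\mathrm{reg}}(h,k-1)$ is read as $\Lambda_r(h,k-1)$. -/

import Mathlib

open Complex UpperHalfPlane Filter Topology MeasureTheory
open scoped MatrixGroups ContDiff ComplexConjugate

noncomputable section

namespace RadialLimit

/-! ### The theta multiplier system -/

/-- The theta function `θ(z) = 1 + 2 ∑_{n ≥ 1} e^{2 π i n² z}`. -/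
def theta (z : ℍ) : ℂ := jacobiTheta (2 * (z : ℂ))

/-- The automorphy factor `c z + d`. -/
def autFactor (γ : SL(2, ℤ)) (z : ℍ) : ℂ := (γ 1 0 : ℂ) * (z : ℂ) + (γ 1 1 : ℂ)

/-- The theta multiplier `χ_θ(γ) = θ(γ z) / ((c z + d)^{1/2} θ(z))` (principal branch). For
`γ ∈ Γ₀(4)` the quotient does not depend on `z`; it is evaluated at `z = i`. -/
def thetaMult (γ : SL(2, ℤ)) : ℂ :=
  theta (γ • UpperHalfPlane.I) /
    (autFactor γ UpperHalfPlane.I ^ (1 / 2 : ℂ) * theta UpperHalfPlane.I)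

/-! ### Differential operators on functions on the upper half plane -/

/-- `∂/∂x` of a function of `x + i y`. -/
def dX (F : ℂ → ℂ) (z : ℂ) : ℂ := fderiv ℝ F z 1

/-- `∂/∂y` of a function of `x + i y`. -/
def dY (F : ℂ → ℂ) (z : ℂ) : ℂ := fderiv ℝ F z Complex.I

/-- A function on `ℍ` seen as a function on `ℂ`; only its values on the upper half plane,
which is open, matter. -/
def ext (f : ℍ → ℂ) : ℂ → ℂ := fun z => f (ofComplex z)

/-- The weight `w` hyperbolic Laplacian
`-y² (∂²/∂x² + ∂²/∂y²) + i w y (∂/∂x + i ∂/∂y)`. -/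
def hypLaplacian (w : ℂ) (f : ℍ → ℂ) (z : ℍ) : ℂ :=
  -(z.im : ℂ) ^ 2 * (dX (dX (ext f)) z + dY (dY (ext f)) z)
    + Complex.I * w * (z.im : ℂ) * (dX (ext f) z + Complex.I * dY (ext f) z)

/-- `∂/∂z̄ = (∂/∂x + i ∂/∂y) / 2`. -/
def dBar (f : ℍ → ℂ) (z : ℍ) : ℂ := (dX (ext f) z + Complex.I * dY (ext f) z) / 2

/-- `ξ_w f = 2 i y^w` times the complex conjugate of `∂f/∂z̄`. -/
def xi (w : ℂ) (f : ℍ → ℂ) (z : ℍ) : ℂ :=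
  2 * Complex.I * (z.im : ℂ) ^ w * conj (dBar f z)

/-- `f` is a harmonic weak Maass form of weight `ν / 2` (`ν` an integer) on `Γ₀(4N)`, with the
multiplier system `χ_θ^ν`. -/
structure IsHarmonicMaassForm (N : ℕ) (ν : ℤ) (f : ℍ → ℂ) : Prop where
  smooth : ContDiffOn ℝ ∞ (ext f) {z : ℂ | 0 < z.im}
  modular : ∀ γ ∈ CongruenceSubgroup.Gamma0 (4 * N), ∀ z : ℍ,
    conj (thetaMult γ) ^ ν * autFactor γ z ^ (-((ν : ℂ) / 2)) * f (γ • z) = f z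
  harmonic : ∀ z : ℍ, hypLaplacian ((ν : ℂ) / 2) f z = 0
  growth : ∃ δ : ℝ, 0 < δ ∧ ∀ γ : SL(2, ℤ), ∃ C Y : ℝ, ∀ z : ℍ, Y ≤ z.im →
    ‖autFactor γ z ^ (-((ν : ℂ) / 2)) * f (γ • z)‖ ≤ C * Real.exp (δ * z.im)

/-! ### Complex powers and the incomplete gamma function on the real line

On the negative axis both are two-valued. The sign `ε` selects the value: `ε = 1` is the limit
from the upper half plane (negative numbers have argument `π`, the principal branch), and
`ε = -1` is the limit from the lower half plane (argument `-π`). On the positive axis `ε` plays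
no role. -/

/-- `x ^ s` for real `x ≠ 0`, where `x < 0` has argument `ε π`. -/
def brPow (ε : ℤˣ) (x : ℝ) (s : ℂ) : ℂ :=
  if 0 < x then (x : ℂ) ^ s
  else ((|x| : ℝ) : ℂ) ^ s * cexp (((ε : ℤ) : ℂ) * Real.pi * Complex.I * s)

/-- The incomplete gamma function `Γ(s, x) = ∫_x^∞ e^{-t} t^{s-1} dt` for real `x ≠ 0`. For
`x < 0` it is the analytic continuation from `|x|` to `x = |x| e^{ε π i}` along the
semicircle `t = |x| e^{ε i φ}`, `0 ≤ φ ≤ π`, that is,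
`Γ(s, |x|)` minus the integral of `e^{-t} t^{s-1} dt` along that semicircle. -/
def incGamma (ε : ℤˣ) (s : ℂ) (x : ℝ) : ℂ :=
  if 0 < x then ∫ t in Set.Ioi x, cexp (-(t : ℂ)) * (t : ℂ) ^ (s - 1)
  else (∫ t in Set.Ioi |x|, cexp (-(t : ℂ)) * (t : ℂ) ^ (s - 1))
    - ∫ φ in (0 : ℝ)..Real.pi,
        cexp (-(((|x| : ℝ) : ℂ) * cexp (((ε : ℤ) : ℂ) * Complex.I * φ)))
          * (((|x| : ℝ) : ℂ) ^ s * cexp (((ε : ℤ) : ℂ) * Complex.I * φ * s))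
          * (((ε : ℤ) : ℂ) * Complex.I)

/-! ### The decomposition into holomorphic and nonholomorphic part -/

/-- `B_w(x) = e^{-x} ∫_{-2x}^∞ e^{-t} t^{-w} dt = e^{-x} Γ(1 - w, -2x)`, for `x ≠ 0`. -/
def Bfun (ε : ℤˣ) (w : ℂ) (x : ℝ) : ℂ := cexp (-(x : ℂ)) * incGamma ε (1 - w) (-2 * x)

/-- `fp` and `fm` are the holomorphic part and the nonholomorphic part of the function `f`
of weight `w` (for the branch `ε`), with Fourier coefficients `ap` and `am`:
`fp = ∑_{n ≫ -∞} ap(n) e^{2πinz}` and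
`fm = ∑_{n ≠ 0} am(n) B_w(2πny) e^{2πinx} + am(0) y^{1-w}`
(with `log y` in place of `y^{1-w}` if `w = 1`). -/
structure IsMaassDecomposition (ε : ℤˣ) (w : ℂ) (f fp fm : ℍ → ℂ) (ap am : ℤ → ℂ) : Prop where
  add_eq : ∀ z, f z = fp z + fm z
  finite_principal : ∃ n₀ : ℤ, ∀ n < n₀, ap n = 0
  hasSum_hol : ∀ z : ℍ,
    HasSum (fun n : ℤ => ap n * cexp (2 * Real.pi * Complex.I * n * (z : ℂ))) (fp z)
  hasSum_nonhol : ∀ z : ℍ,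
    HasSum (fun n : ℤ =>
      if n = 0 then am 0 * (if w = 1 then (Real.log z.im : ℂ) else (z.im : ℂ) ^ (1 - w))
      else am n * Bfun ε w (2 * Real.pi * n * z.im) * cexp (2 * Real.pi * Complex.I * n * z.re))
      (fm z)

/-! ### The regularized twisted `L`-function -/

/-- The coefficient `b(n)` in a Fourier expansion `∑ b(n) e^{2πi(n+κ)z/l}` of a holomorphic
function `h` on `ℍ` (computed on the line `y = 1`). -/
def fourierCoeff (h : ℍ → ℂ) (κ : ℝ) (l : ℕ) (n : ℤ) : ℂ :=
  (1 / (l : ℂ)) * ∫ x in (0 : ℝ)..l, h (ofComplex ((x : ℂ) + Complex.I)) *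
    cexp (-(2 * Real.pi * Complex.I * ((n : ℂ) + κ) * ((x : ℂ) + Complex.I) / l))

/-- The coefficient `b(n)` of `e^{2πinz}` in the Fourier expansion of `h` at `i∞`. -/
def coeffInfty (h : ℍ → ℂ) (n : ℤ) : ℂ := fourierCoeff h 0 1 n

/-- The function `(c z + d)^{-k} h(σ z)`. -/
def atCusp (k : ℂ) (h : ℍ → ℂ) (σ : SL(2, ℤ)) (z : ℍ) : ℂ := autFactor σ z ^ (-k) * h (σ • z)

/-- The auxiliary choices for the expansion of `h` at the cusp `r`: a matrix `σ ∈ SL₂(ℤ)` with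
`σ(i∞) = r`, a positive integer `width` and `κ ∈ [0, 1)` such that `(c z + d)^{-k} h(σ z)`
has an expansion in the functions `e^{2πi(n+κ)z/width}`, `n ∈ ℤ`. -/
structure CuspExpansion (k : ℂ) (h : ℍ → ℂ) (r : ℚ) where
  σ : SL(2, ℤ)
  width : ℕ
  κ : ℝ
  c_ne_zero : σ 1 0 ≠ 0
  cusp_eq : r = (σ 0 0 : ℚ) / (σ 1 0 : ℚ)
  width_pos : 0 < width
  κ_nonneg : 0 ≤ κ
  κ_lt_one : κ < 1
  quasiperiodic : ∀ z : ℍ, atCusp k h σ ((width : ℝ) +ᵥ z) =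
    cexp (2 * Real.pi * Complex.I * κ) * atCusp k h σ z

/-- The coefficient `b_σ(n)` of `e^{2πi(n+κ)z/width}` in `(c z + d)^{-k} h(σ z)`. -/
def CuspExpansion.coeff {k : ℂ} {h : ℍ → ℂ} {r : ℚ} (D : CuspExpansion k h r) (n : ℤ) : ℂ :=
  fourierCoeff (atCusp k h D.σ) D.κ D.width n

/-- The term `b(n) e^{2πinr} n^{-s} Γ(s, 2πn)`, for `n ≠ 0`. -/
def termInfty (ε : ℤˣ) (h : ℍ → ℂ) (r : ℚ) (s : ℂ) (n : ℤ) : ℂ :=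
  if n = 0 then 0
  else coeffInfty h n * cexp (2 * Real.pi * Complex.I * n * (r : ℂ)) / brPow ε n s *
    incGamma ε s (2 * Real.pi * n)

/-- The term `b_σ(n) e^{2πi μ (-d/c)} μ^{-(k-s)} Γ(k - s, 2π μ / c²)` with
`μ = (n + κ) / width ≠ 0`. -/
def termCusp (ε : ℤˣ) {k : ℂ} {h : ℍ → ℂ} {r : ℚ} (D : CuspExpansion k h r) (s : ℂ) (n : ℤ) : ℂ :=
  if (n : ℝ) + D.κ = 0 then 0
  else D.coeff n *
    cexp (2 * Real.pi * Complex.I * ((n : ℂ) + D.κ) *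
      (-((D.σ 1 1 : ℂ) / (D.σ 1 0 : ℂ))) / D.width) /
    brPow ε (((n : ℝ) + D.κ) / D.width) (k - s) *
    incGamma ε (k - s)
      (2 * Real.pi * ((n : ℝ) + D.κ) / ((D.σ 1 0 : ℝ) ^ 2 * D.width))

/-- The function `Γ(s) L_r^reg(h, s)`, with the gamma factor cancelled. -/
def completedRegL (ε : ℤˣ) {k : ℂ} {h : ℍ → ℂ} {r : ℚ} (D : CuspExpansion k h r) (s : ℂ) : ℂ :=
  (∑' n : ℤ, termInfty ε h r s n)
  + Complex.I ^ k / (D.σ 1 0 : ℂ) ^ k * (2 * Real.pi : ℂ) ^ (2 * s - k) *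
      ((D.σ 1 0 : ℂ) ^ 2) ^ (k - s) * (∑' n : ℤ, termCusp ε D s n)
  - (2 * Real.pi : ℂ) ^ s * coeffInfty h 0 / s
  - (if D.κ = 0 then
      Complex.I ^ k * (2 * Real.pi : ℂ) ^ s * D.coeff 0 / ((D.σ 1 0 : ℂ) ^ k * (k - s)) else 0)

/-- The regularized twisted `L`-function `L_r^reg(h, s)` of a weakly holomorphic modular form `h`
of weight `k`. -/
def regL (ε : ℤˣ) {k : ℂ} {h : ℍ → ℂ} {r : ℚ} (D : CuspExpansion k h r) (s : ℂ) : ℂ :=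
  1 / Complex.Gamma s * completedRegL ε D s

end RadialLimit

end

noncomputable section

namespace RadialLimit

/-! ### The automorphy factor -/

/-! Write `s = k - 1`, so that `g` has weight `1 - s` and `h = ξ g` has weight `s + 1`. Let `b(n)`
be the coefficients of `h`, `j(z) = cz + d` and `u = χ_θ(γ)^{-m}`, so that `g(γz) = u j(z)^{1-s}
g(z)`.

The series `g⁻` is a nonholomorphic Eichler integral of `h` in which the end point `w` is tied to
`z`. The proof unties it. With `p = -i(z - w̄)` (`kvar`), the series `eichler z p` is holomorphic in
`p` for `Re p > Im z`. Its derivative in `p` is `2^{-s} p^{s-1}` times the conjugate of `h(w)`, and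
for `w = z`, that is `p = 2y`, it equals `g⁻(z)`. The modularity of `h` (`xi_smul`) makes `u
j(z)^{1-s} eichler z (kvar z w) - eichler (γz) (kvar (γz) (γw))` independent of `w` (`period_eq`).
Hence `g⁺(γz)` is `u j(z)^{1-s} g⁺(z)` plus this difference, for any convenient `w`
(`holomorphicPart_smul`).

Take `w = -d/c + i/c²`, so that `γw = r + i`, and let `z = x + iY` with `Y → ∞`. Then `g⁺(z)` decays
exponentially. The integral at `γz` tends to `eichler r 1`, whose terms contain `Γ(s, 2πn)`: this is
the conjugate of the first series of `Λ_r` together with its term `b(0)/s`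
(`tendsto_eichler_at_real`). The integral at `z`, multiplied by `p^{1-s}`, converges in its terms
with `n ≠ 0` (`tendsto_eichler_at_infty`) and gives the second series, in which `Γ(k - s, ·) = Γ(1,
·)` is an exponential. Its term `n = 0` is a multiple of `p^s`, where `p = q + 1/c²` and `q = Y -
i(x + d/c)`. The subtracted term has `q + 1/c` instead, and the difference converges to the
remaining multiples of the conjugate of `b(0)`.

Interchanging limits and sums rests on `shadowCoeff_bound`: as `h` is bounded on horizontal lines,
`|b(n)| ≤ M e^{ny}` for each `y > 0`. So `b(n)` grows subexponentially for `n → ∞` and decays faster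
than any exponential for `n → -∞`, and crude estimates of `Γ(s, x)` at negative `x` are enough.
Complex conjugation exchanges the two branches, which is why `Λ_r` is taken in the branch `-ε`. At
the cusp `r`, `σ` is `±γ T^j`, so the expansion there is the one at `i∞` up to a constant
(`CuspExpansion.tsum_termCusp`). -/

lemma autFactor_ne_zero (γ : SL(2, ℤ)) (z : ℍ) : autFactor γ z ≠ 0 := by
  have := UpperHalfPlane.denom_ne_zero (γ : GL (Fin 2) ℝ) z
  rw [ModularGroup.denom_apply] at this
  exact this

lemma coe_smul_eq (γ : SL(2, ℤ)) (z : ℍ) :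
    ((γ • z : ℍ) : ℂ) = ((γ 0 0 : ℂ) * z + γ 0 1) / autFactor γ z := by
  rw [UpperHalfPlane.specialLinearGroup_apply]
  simp [autFactor]

lemma det_eq_one (γ : SL(2, ℤ)) : γ 0 0 * γ 1 1 - γ 0 1 * γ 1 0 = 1 := by
  have := γ.det_coe
  rwa [Matrix.det_fin_two] at this

lemma det_eq_one' (γ : SL(2, ℤ)) : (γ 0 0 : ℂ) * γ 1 1 - γ 0 1 * γ 1 0 = 1 := by
  exact_mod_cast det_eq_one γ

lemma autFactor_mul (γ₁ γ₂ : SL(2, ℤ)) (z : ℍ) :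
    autFactor (γ₁ * γ₂) z = autFactor γ₁ (γ₂ • z) * autFactor γ₂ z := by
  have h := autFactor_ne_zero γ₂ z
  conv_rhs => rw [autFactor, coe_smul_eq]
  field_simp
  simp only [autFactor, Matrix.SpecialLinearGroup.coe_mul, Matrix.mul_apply, Fin.sum_univ_two]
  push_cast
  ring

lemma autFactor_one (z : ℍ) : autFactor 1 z = 1 := by simp [autFactor]

lemma autFactor_neg (γ : SL(2, ℤ)) (z : ℍ) : autFactor (-γ) z = -autFactor γ z := by
  simp [autFactor]; ring

/-! ### The fourth power of the theta multiplier -/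

/-- The subgroup of all `γ` under which `jacobiTheta ^ 4` is modular of weight two. -/
def thetaFourSubgroup : Subgroup SL(2, ℤ) where
  carrier := {γ | ∀ z : ℍ, jacobiTheta (γ • z : ℍ) ^ 4 = autFactor γ z ^ 2 * jacobiTheta z ^ 4}
  mul_mem' {γ₁ γ₂} h₁ h₂ z := by
    rw [mul_smul, h₁, h₂, autFactor_mul]
    ring
  one_mem' z := by simp [autFactor_one]
  inv_mem' {γ} h z := by
    have h1 := h (γ⁻¹ • z)
    rw [smul_inv_smul] at h1
    have h2 := autFactor_mul γ γ⁻¹ z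
    rw [mul_inv_cancel, autFactor_one] at h2
    have : autFactor γ⁻¹ z ^ 2 * autFactor γ (γ⁻¹ • z) ^ 2 = 1 := by
      rw [← mul_pow, mul_comm, ← h2, one_pow]
    rw [h1, ← mul_assoc, this, one_mul]

lemma neg_mem_thetaFourSubgroup {γ : SL(2, ℤ)} (h : γ ∈ thetaFourSubgroup) :
    -γ ∈ thetaFourSubgroup := by
  intro z
  rw [ModularGroup.SL_neg_smul, autFactor_neg, h]
  ring

/-- The matrix `-(1 0; 2 1)`. -/
def lowerTwo : SL(2, ℤ) := ModularGroup.S * (ModularGroup.T ^ 2)⁻¹ * ModularGroup.S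

lemma coe_T_sq : ((ModularGroup.T ^ 2 : SL(2, ℤ)) : Matrix (Fin 2) (Fin 2) ℤ) = !![1, 2; 0, 1] := by
  decide

lemma coe_T_sq_inv :
    (((ModularGroup.T ^ 2)⁻¹ : SL(2, ℤ)) : Matrix (Fin 2) (Fin 2) ℤ) = !![1, -2; 0, 1] := by
  decide

lemma coe_lowerTwo : (lowerTwo : Matrix (Fin 2) (Fin 2) ℤ) = !![-1, 0; -2, -1] := by
  decide

lemma coe_lowerTwo_inv :
    ((lowerTwo⁻¹ : SL(2, ℤ)) : Matrix (Fin 2) (Fin 2) ℤ) = !![-1, 0; 2, -1] := by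
  decide

lemma T_sq_mem : ModularGroup.T ^ 2 ∈ thetaFourSubgroup := by
  intro z
  rw [jacobiTheta_T_sq_smul, autFactor, coe_T_sq]
  simp

lemma jacobiTheta_S_smul_pow_four (z : ℍ) :
    jacobiTheta (ModularGroup.S • z : ℍ) ^ 4 = -(z : ℂ) ^ 2 * jacobiTheta z ^ 4 := by
  rw [jacobiTheta_S_smul, mul_pow, ← Complex.cpow_nat_mul]
  norm_num
  rw [mul_pow, Complex.I_sq]
  ring_nf

lemma autFactor_S (z : ℍ) : autFactor ModularGroup.S z = z := by
  simp [autFactor, ModularGroup.S]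

/-- The factor `-z²` of `S` has the wrong sign compared with `autFactor ^ 2`. In `S T⁻² S` the
transformation `S` occurs twice and the signs cancel. -/
lemma lowerTwo_mem : lowerTwo ∈ thetaFourSubgroup := by
  intro z
  have h := inv_mem T_sq_mem (ModularGroup.S • z)
  rw [lowerTwo, mul_smul, mul_smul, jacobiTheta_S_smul_pow_four, h, jacobiTheta_S_smul_pow_four,
    autFactor_mul, autFactor_mul, autFactor_S, autFactor_S]
  ring

/-- Euclidean algorithm on the first column `(a, c)`: left multiplication by `T^{±2}` and
`lowerTwo^{±1}` replaces `a` by `a ± 2c` or, up to sign, `c` by `c ± 2a`. Since `a` is odd and `c`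
is even, `|a| ≠ |c|`, so for `c ≠ 0` one of these moves strictly lowers `|a| + |c|`. For `c = 0` the
matrix is `±T^{2b}`. -/
lemma mem_thetaFourSubgroup_of_even (γ : SL(2, ℤ)) (hb : Even (γ 0 1)) (hc : Even (γ 1 0)) :
    γ ∈ thetaFourSubgroup := by
  induction hn : (γ 0 0).natAbs + (γ 1 0).natAbs using Nat.strong_induction_on generalizing γ with
  | _ n ih =>
  have hdet := det_eq_one γ
  obtain ⟨b, hb'⟩ := hb
  obtain ⟨c, hc'⟩ := hc
  have step : ∀ δ : SL(2, ℤ), δ ∈ thetaFourSubgroup → Even ((δ * γ) 0 1) → Even ((δ * γ) 1 0) →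
      ((δ * γ) 0 0).natAbs + ((δ * γ) 1 0).natAbs < n → γ ∈ thetaFourSubgroup := by
    intro δ hδ h1 h2 h3
    exact (Subgroup.mul_mem_cancel_left _ hδ).mp (ih _ h3 (δ * γ) h1 h2 rfl)
  -- If `a` were even, both products in the determinant would be even.
  have hodd : ∃ a, γ 0 0 = 2 * a + 1 := by
    rcases Int.even_or_odd' (γ 0 0) with ⟨a, ha | ha⟩
    · exfalso
      rw [ha, hc'] at hdet
      have : 2 * (a * γ 1 1 - γ 0 1 * c) = 1 := by linarith
      omega
    · exact ⟨a, ha⟩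
  obtain ⟨a, ha⟩ := hodd
  by_cases hc0 : γ 1 0 = 0
  · rw [hc0, mul_zero, sub_zero] at hdet
    have hT : ∀ b : ℤ, ModularGroup.T ^ (2 * b) ∈ thetaFourSubgroup := fun b => by
      rw [zpow_mul]
      exact zpow_mem T_sq_mem b
    rcases Int.mul_eq_one_iff_eq_one_or_neg_one.mp hdet with ⟨h1, h2⟩ | ⟨h1, h2⟩
    · have : γ = ModularGroup.T ^ (2 * b) := by
        ext i j
        rw [ModularGroup.coe_T_zpow]
        fin_cases i <;> fin_cases j <;> simp [h1, h2, hb', hc0] <;> omega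
      rw [this]; exact hT b
    · have : γ = -(ModularGroup.T ^ (2 * (-b))) := by
        ext i j
        rw [Matrix.SpecialLinearGroup.coe_neg, ModularGroup.coe_T_zpow]
        fin_cases i <;> fin_cases j <;> simp [h1, h2, hb', hc0] <;> omega
      rw [this]; exact neg_mem_thetaFourSubgroup (hT _)
  · have e1 : ∀ i j, (ModularGroup.T ^ 2 * γ) i j = ((!![1, 2; 0, 1] : Matrix (Fin 2) (Fin 2) ℤ) * γ.1) i j := fun i j => by
      rw [Matrix.SpecialLinearGroup.coe_mul, coe_T_sq]
    have e2 : ∀ i j, ((ModularGroup.T ^ 2)⁻¹ * γ) i j = ((!![1, -2; 0, 1] : Matrix (Fin 2) (Fin 2) ℤ) * γ.1) i j := fun i j => by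
      rw [Matrix.SpecialLinearGroup.coe_mul, coe_T_sq_inv]
    have e3 : ∀ i j, (lowerTwo * γ) i j = ((!![-1, 0; -2, -1] : Matrix (Fin 2) (Fin 2) ℤ) * γ.1) i j := fun i j => by
      rw [Matrix.SpecialLinearGroup.coe_mul, coe_lowerTwo]
    have e4 : ∀ i j, (lowerTwo⁻¹ * γ) i j = ((!![-1, 0; 2, -1] : Matrix (Fin 2) (Fin 2) ℤ) * γ.1) i j := fun i j => by
      rw [Matrix.SpecialLinearGroup.coe_mul, coe_lowerTwo_inv]
    simp only [Matrix.mul_apply, Fin.sum_univ_two] at e1 e2 e3 e4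
    have hev : ∀ x : ℤ, Even (2 * x + (b + b)) := fun x => ⟨x + b, by ring⟩
    have key : (ModularGroup.T ^ 2 * γ) 0 0 = γ 0 0 + 2 * γ 1 0 ∧
        (ModularGroup.T ^ 2 * γ) 0 1 = γ 0 1 + 2 * γ 1 1 ∧
        (ModularGroup.T ^ 2 * γ) 1 0 = γ 1 0 ∧
        ((ModularGroup.T ^ 2)⁻¹ * γ) 0 0 = γ 0 0 - 2 * γ 1 0 ∧
        ((ModularGroup.T ^ 2)⁻¹ * γ) 0 1 = γ 0 1 - 2 * γ 1 1 ∧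
        ((ModularGroup.T ^ 2)⁻¹ * γ) 1 0 = γ 1 0 ∧
        (lowerTwo * γ) 0 0 = -γ 0 0 ∧ (lowerTwo * γ) 0 1 = -γ 0 1 ∧
        (lowerTwo * γ) 1 0 = -2 * γ 0 0 - γ 1 0 ∧
        (lowerTwo⁻¹ * γ) 0 0 = -γ 0 0 ∧ (lowerTwo⁻¹ * γ) 0 1 = -γ 0 1 ∧
        (lowerTwo⁻¹ * γ) 1 0 = 2 * γ 0 0 - γ 1 0 := by
      refine ⟨?_, ?_, ?_, ?_, ?_, ?_, ?_, ?_, ?_, ?_, ?_, ?_⟩ <;> simp [e1, e2, e3, e4] <;> ring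
    obtain ⟨k1, k2, k3, k4, k5, k6, k7, k8, k9, k10, k11, k12⟩ := key
    have hT := T_sq_mem
    have hTi := inv_mem T_sq_mem
    have hL := lowerTwo_mem
    have hLi := inv_mem lowerTwo_mem
    rcases lt_or_ge ((γ 1 0).natAbs) ((γ 0 0).natAbs) with h | h
    · by_cases hs : 0 ≤ γ 0 0 * γ 1 0
      · refine step _ hTi ⟨b - γ 1 1, by rw [k5]; linarith⟩ ⟨c, by rw [k6]; exact hc'⟩ ?_
        rw [k4, k6]
        rcases le_total 0 (γ 0 0) with h0 | h0 <;> rcases le_total 0 (γ 1 0) with h1 | h1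
        · omega
        · nlinarith [lt_of_le_of_ne h1 hc0, show 0 < γ 0 0 by omega]
        · nlinarith [lt_of_le_of_ne h1 (Ne.symm hc0), show γ 0 0 < 0 by omega]
        · omega
      · refine step _ hT ⟨b + γ 1 1, by rw [k2]; linarith⟩ ⟨c, by rw [k3]; exact hc'⟩ ?_
        rw [k1, k3]
        rcases le_total 0 (γ 0 0) with h0 | h0 <;> rcases le_total 0 (γ 1 0) with h1 | h1
        · exact absurd (mul_nonneg h0 h1) hs
        · omega
        · omega
        · exact absurd (mul_nonneg_of_nonpos_of_nonpos h0 h1) hs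
    · by_cases hs : 0 ≤ γ 0 0 * γ 1 0
      · refine step _ hLi ⟨-b, by rw [k11]; linarith⟩ ⟨γ 0 0 - c, by rw [k12]; linarith⟩ ?_
        rw [k10, k12]
        rcases le_total 0 (γ 0 0) with h0 | h0 <;> rcases le_total 0 (γ 1 0) with h1 | h1
        · omega
        · nlinarith [lt_of_le_of_ne h1 hc0, show 0 < γ 0 0 by omega]
        · nlinarith [lt_of_le_of_ne h1 (Ne.symm hc0), show γ 0 0 < 0 by omega]
        · omega
      · refine step _ hL ⟨-b, by rw [k8]; linarith⟩ ⟨-γ 0 0 - c, by rw [k9]; linarith⟩ ?_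
        rw [k7, k9]
        rcases le_total 0 (γ 0 0) with h0 | h0 <;> rcases le_total 0 (γ 1 0) with h1 | h1
        · exact absurd (mul_nonneg h0 h1) hs
        · omega
        · omega
        · exact absurd (mul_nonneg_of_nonpos_of_nonpos h0 h1) hs

lemma theta_I_ne_zero : theta UpperHalfPlane.I ≠ 0 := by
  have him : (2 * ((UpperHalfPlane.I : ℍ) : ℂ)).im = 2 := by simp
  have h := norm_jacobiTheta_sub_one_le (τ := 2 * ((UpperHalfPlane.I : ℍ) : ℂ)) (by rw [him]; norm_num)
  rw [him] at h
  intro h0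
  rw [theta] at h0
  rw [h0, zero_sub, norm_neg, norm_one] at h
  -- The bound `2q/(1 - q)` for `|θ - 1|` is below `1` exactly when `q < 1/3`.
  have hx : Real.exp (-Real.pi * 2) < 1 / 3 := by
    have h1 : Real.exp (-Real.pi * 2) ≤ Real.exp (-2) := by
      apply Real.exp_le_exp.mpr
      nlinarith [Real.pi_gt_three]
    have h2 : Real.exp (-2) < 1 / 3 := by
      rw [Real.exp_neg, inv_eq_one_div]
      apply one_div_lt_one_div_of_lt (by norm_num)
      have := Real.add_one_lt_exp (x := 2) (by norm_num)
      linarith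
    linarith
  have hpos := Real.exp_pos (-Real.pi * 2)
  have : 2 / (1 - Real.exp (-Real.pi * 2)) * Real.exp (-Real.pi * 2) < 1 := by
    rw [div_mul_eq_mul_div, div_lt_one (by linarith)]
    linarith
  linarith

/-- As `θ(z) = jacobiTheta (2z)`, conjugation by `diag(2, 1)` turns `γ ∈ Γ₀(4)` into a matrix `δ`
with even off-diagonal entries and `δ(2z) = 2γz`. Taking fourth powers avoids the choice of a square
root. -/
lemma theta_smul_pow_four {γ : SL(2, ℤ)} (hγ : γ ∈ CongruenceSubgroup.Gamma0 4) (z : ℍ) :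
    theta (γ • z) ^ 4 = autFactor γ z ^ 2 * theta z ^ 4 := by
  rw [CongruenceSubgroup.Gamma0_mem] at hγ
  obtain ⟨c, hc⟩ := (ZMod.intCast_zmod_eq_zero_iff_dvd _ 4).mp hγ
  push_cast at hc
  have hdet := det_eq_one γ
  let δ : SL(2, ℤ) := ⟨!![γ 0 0, 2 * γ 0 1; 2 * c, γ 1 1], by
    rw [Matrix.det_fin_two_of]
    rw [hc] at hdet
    linarith⟩
  have hδ : δ ∈ thetaFourSubgroup :=
    mem_thetaFourSubgroup_of_even δ ⟨γ 0 1, by simp [δ]; ring⟩ ⟨c, by simp [δ]; ring⟩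
  have him : 0 < (2 * (z : ℂ)).im := by simpa using z.im_pos
  let τ : ℍ := ⟨2 * (z : ℂ), him⟩
  have haut : autFactor δ τ = autFactor γ z := by
    simp only [autFactor, hc]
    simp [δ, τ]
    ring
  have hcoe : ((δ • τ : ℍ) : ℂ) = 2 * ((γ • z : ℍ) : ℂ) := by
    rw [coe_smul_eq, coe_smul_eq, haut]
    simp [δ, τ]
    ring
  have := hδ τ
  rw [hcoe, haut] at this
  exact this

/-- The theta multiplier is a fourth root of unity on `Γ₀(4)`. -/
lemma thetaMult_pow_four {γ : SL(2, ℤ)} (hγ : γ ∈ CongruenceSubgroup.Gamma0 4) :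
    thetaMult γ ^ 4 = 1 := by
  rw [thetaMult, div_pow, mul_pow, theta_smul_pow_four hγ, ← Complex.cpow_nat_mul]
  norm_num
  have h1 := autFactor_ne_zero γ UpperHalfPlane.I
  have h2 := theta_I_ne_zero
  exact ⟨h1, h2⟩

lemma norm_thetaMult {γ : SL(2, ℤ)} (hγ : γ ∈ CongruenceSubgroup.Gamma0 4) :
    ‖thetaMult γ‖ = 1 :=
  Complex.norm_eq_one_of_pow_eq_one (thetaMult_pow_four hγ) (by norm_num)

lemma thetaMult_ne_zero {γ : SL(2, ℤ)} (hγ : γ ∈ CongruenceSubgroup.Gamma0 4) :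
    thetaMult γ ≠ 0 := by
  rw [← norm_ne_zero_iff, norm_thetaMult hγ]
  exact one_ne_zero

lemma conj_thetaMult {γ : SL(2, ℤ)} (hγ : γ ∈ CongruenceSubgroup.Gamma0 4) :
    conj (thetaMult γ) = (thetaMult γ)⁻¹ :=
  (Complex.inv_eq_conj (norm_thetaMult hγ)).symm

/-- This reconciles the multiplier of weight `(4 - m)/2` in the definition of the form with the
power `χ_θ^{-m}` in the limit. Only `χ_θ⁴ = 1` is needed. -/
lemma conj_thetaMult_zpow {γ : SL(2, ℤ)} (hγ : γ ∈ CongruenceSubgroup.Gamma0 4) (m : ℤ) :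
    conj (thetaMult γ) ^ (4 - m) = thetaMult γ ^ m := by
  rw [conj_thetaMult hγ, inv_zpow', neg_sub, zpow_sub₀ (thetaMult_ne_zero hγ)]
  norm_cast
  rw [thetaMult_pow_four hγ, div_one]

lemma mem_Gamma0_four {N : ℕ} {γ : SL(2, ℤ)} (hγ : γ ∈ CongruenceSubgroup.Gamma0 (4 * N)) :
    γ ∈ CongruenceSubgroup.Gamma0 4 := by
  rw [CongruenceSubgroup.Gamma0_mem, ZMod.intCast_zmod_eq_zero_iff_dvd] at hγ ⊢
  exact dvd_trans ⟨N, by push_cast; ring⟩ hγ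

/-! ### Branches of powers -/

lemma brPow_of_pos (ε : ℤˣ) {x : ℝ} (hx : 0 < x) (s : ℂ) : brPow ε x s = (x : ℂ) ^ s := if_pos hx

lemma brPow_of_neg (ε : ℤˣ) {x : ℝ} (hx : x < 0) (s : ℂ) :
    brPow ε x s = ((|x| : ℝ) : ℂ) ^ s * cexp (((ε : ℤ) : ℂ) * Real.pi * Complex.I * s) :=
  if_neg hx.not_gt

lemma brPow_ne_zero (ε : ℤˣ) {x : ℝ} (hx : x ≠ 0) (s : ℂ) : brPow ε x s ≠ 0 := by
  have h : ∀ y : ℝ, y ≠ 0 → (y : ℂ) ^ s ≠ 0 := fun y hy h => by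
    rw [Complex.cpow_eq_zero_iff] at h
    exact hy (by exact_mod_cast h.1)
  rcases lt_or_gt_of_ne hx with h0 | h0
  · rw [brPow_of_neg ε h0]
    exact mul_ne_zero (h _ (abs_ne_zero.mpr hx)) (Complex.exp_ne_zero _)
  · rw [brPow_of_pos ε h0]
    exact h _ hx

lemma brPow_add (ε : ℤˣ) {x : ℝ} (hx : x ≠ 0) (s t : ℂ) :
    brPow ε x (s + t) = brPow ε x s * brPow ε x t := by
  rcases lt_or_gt_of_ne hx with h0 | h0
  · rw [brPow_of_neg ε h0, brPow_of_neg ε h0, brPow_of_neg ε h0,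
      Complex.cpow_add _ _ (by exact_mod_cast abs_ne_zero.mpr hx), mul_add, Complex.exp_add]
    ring
  · rw [brPow_of_pos ε h0, brPow_of_pos ε h0, brPow_of_pos ε h0,
      Complex.cpow_add _ _ (by exact_mod_cast hx)]

lemma brPow_zero (ε : ℤˣ) (x : ℝ) : brPow ε x 0 = 1 := by
  simp [brPow]

lemma brPow_neg_mul (ε : ℤˣ) {x : ℝ} (hx : x ≠ 0) (s : ℂ) :
    brPow ε x (-s) * brPow ε x s = 1 := by
  rw [← brPow_add ε hx, neg_add_cancel, brPow_zero]

lemma brPow_mul_left (ε : ℤˣ) {a x : ℝ} (ha : 0 < a) (hx : x ≠ 0) (s : ℂ) :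
    brPow ε (a * x) s = (a : ℂ) ^ s * brPow ε x s := by
  rcases lt_or_gt_of_ne hx with h0 | h0
  · rw [brPow_of_neg ε h0, brPow_of_neg ε (mul_neg_of_pos_of_neg ha h0), abs_mul, abs_of_pos ha,
      Complex.ofReal_mul, Complex.mul_cpow_ofReal_nonneg ha.le (abs_nonneg _)]
    ring
  · rw [brPow_of_pos ε h0, brPow_of_pos ε (mul_pos ha h0), Complex.ofReal_mul,
      Complex.mul_cpow_ofReal_nonneg ha.le h0.le]

lemma conj_ofReal_cpow {x : ℝ} (hx : 0 < x) (s : ℂ) :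
    conj ((x : ℂ) ^ s) = (x : ℂ) ^ (conj s) := by
  rw [Complex.cpow_conj _ _ (by rw [Complex.arg_ofReal_of_nonneg hx.le]; exact Real.pi_pos.ne),
    Complex.conj_ofReal]

/-- Conjugation reflects the path from the positive to the negative axis, so it exchanges the
branches. Together with `conj_incGamma` this is the source of `-ε` in the `L`-function. -/
lemma conj_brPow (ε : ℤˣ) {x : ℝ} (hx : x ≠ 0) (s : ℂ) :
    conj (brPow ε x s) = brPow (-ε) x (conj s) := by
  rcases lt_or_gt_of_ne hx with h0 | h0
  · rw [brPow_of_neg _ h0, brPow_of_neg _ h0, map_mul, conj_ofReal_cpow (abs_pos.mpr hx),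
      ← Complex.exp_conj]
    simp
  · rw [brPow_of_pos _ h0, brPow_of_pos _ h0, conj_ofReal_cpow h0]

lemma norm_brPow (ε : ℤˣ) {x : ℝ} (hx : x ≠ 0) (s : ℝ) : ‖brPow ε x s‖ = |x| ^ s := by
  rcases lt_or_gt_of_ne hx with h0 | h0
  · rw [brPow_of_neg _ h0, norm_mul, Complex.norm_cpow_eq_rpow_re_of_pos (abs_pos.mpr hx)]
    have : ((ε : ℤ) : ℂ) * Real.pi * Complex.I * s
        = (((ε : ℤ) : ℝ) * Real.pi * s : ℝ) * Complex.I := by push_cast; ring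
    rw [this, Complex.norm_exp_ofReal_mul_I, mul_one, Complex.ofReal_re]
  · rw [brPow_of_pos _ h0, Complex.norm_cpow_eq_rpow_re_of_pos h0, abs_of_pos h0,
      Complex.ofReal_re]

lemma exp_sign_pi_I (ε : ℤˣ) : cexp (((ε : ℤ) : ℂ) * Real.pi * Complex.I) = -1 := by
  rcases Int.units_eq_one_or ε with rfl | rfl
  · simp
  · simp [Complex.exp_neg]

lemma brPow_one (ε : ℤˣ) (x : ℝ) : brPow ε x 1 = x := by
  rw [brPow]
  split_ifs with h
  · simp
  · rw [mul_one, exp_sign_pi_I, Complex.cpow_one, abs_of_nonpos (not_lt.mp h)]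
    push_cast; ring

/-! ### The incomplete gamma function -/

/-- The integrand of the incomplete gamma function. -/
def gammaIntegrand (s : ℂ) (t : ℝ) : ℂ := cexp (-(t : ℂ)) * (t : ℂ) ^ (s - 1)

lemma continuousOn_gammaIntegrand (s : ℂ) : ContinuousOn (gammaIntegrand s) (Set.Ioi 0) := by
  intro t ht
  apply ContinuousAt.continuousWithinAt
  refine (by fun_prop : ContinuousAt (fun t : ℝ => cexp (-(t : ℂ))) t).mul ?_
  exact ContinuousAt.cpow Complex.continuous_ofReal.continuousAt continuousAt_const
    (Complex.ofReal_mem_slitPlane.mpr ht)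

lemma norm_gammaIntegrand (s : ℂ) {t : ℝ} (ht : 0 < t) :
    ‖gammaIntegrand s t‖ = Real.exp (-t) * t ^ (s.re - 1) := by
  rw [gammaIntegrand, norm_mul, Complex.norm_cpow_eq_rpow_re_of_pos ht, Complex.norm_exp]
  simp

lemma integrableOn_gammaIntegrand (s : ℂ) {a : ℝ} (ha : 0 < a) :
    IntegrableOn (gammaIntegrand s) (Set.Ioi a) := by
  have h1 : IntegrableOn (fun t : ℝ => Real.exp (-t) * t ^ (s.re - 1)) (Set.Ioi a) := by
    refine integrable_of_isBigO_exp_neg one_half_pos ?_ (Real.Gamma_integrand_isLittleO _).isBigO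
    intro t ht
    have : t ≠ 0 := (ha.trans_le ht).ne'
    exact ((by fun_prop : ContinuousAt (fun t : ℝ => Real.exp (-t)) t).mul
      (Real.continuousAt_rpow_const _ _ (Or.inl this))).continuousWithinAt
  refine h1.mono' ?_ ?_
  · exact ((continuousOn_gammaIntegrand s).mono (Set.Ioi_subset_Ioi ha.le)).aestronglyMeasurable
      measurableSet_Ioi
  · refine (ae_restrict_iff' measurableSet_Ioi).mpr (ae_of_all _ fun t ht => ?_)
    rw [norm_gammaIntegrand s (ha.trans ht)]

lemma incGamma_of_pos (ε : ℤˣ) (s : ℂ) {x : ℝ} (hx : 0 < x) :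
    incGamma ε s x = ∫ t in Set.Ioi x, gammaIntegrand s t := if_pos hx

/-- The integral over the semicircle of radius `X` in the definition of `incGamma`. -/
def semicircleIntegral (ε : ℤˣ) (s : ℂ) (X : ℝ) : ℂ :=
  ∫ φ in (0 : ℝ)..Real.pi,
        cexp (-((X : ℂ) * cexp (((ε : ℤ) : ℂ) * Complex.I * φ)))
          * ((X : ℂ) ^ s * cexp (((ε : ℤ) : ℂ) * Complex.I * φ * s))
          * (((ε : ℤ) : ℂ) * Complex.I)

lemma incGamma_neg (ε : ℤˣ) (s : ℂ) {X : ℝ} (hX : 0 < X) :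
    incGamma ε s (-X) = (∫ t in Set.Ioi X, gammaIntegrand s t) - semicircleIntegral ε s X := by
  rw [incGamma, if_neg (by linarith), abs_neg, abs_of_pos hX]
  rfl

lemma intervalIntegrable_gammaIntegrand (s : ℂ) {a b : ℝ} (ha : 0 < a) (hb : 0 < b) :
    IntervalIntegrable (gammaIntegrand s) volume a b := by
  apply ContinuousOn.intervalIntegrable
  apply (continuousOn_gammaIntegrand s).mono
  intro t ht
  exact lt_of_lt_of_le (lt_min ha hb) ht.1

lemma integral_Ioi_gammaIntegrand (s : ℂ) {a x : ℝ} (ha : 0 < a) (hx : 0 < x) :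
    ∫ t in Set.Ioi x, gammaIntegrand s t =
      (∫ t in Set.Ioi a, gammaIntegrand s t) - ∫ t in a..x, gammaIntegrand s t := by
  rw [← intervalIntegral.integral_interval_add_Ioi' (intervalIntegrable_gammaIntegrand s ha hx)
    (integrableOn_gammaIntegrand s hx)]
  ring

lemma hasDerivAt_integral_Ioi_gammaIntegrand (s : ℂ) {x : ℝ} (hx : 0 < x) :
    HasDerivAt (fun y => ∫ t in Set.Ioi y, gammaIntegrand s t) (-gammaIntegrand s x) x := by
  have h1 : HasDerivAt (fun y => (∫ t in Set.Ioi x, gammaIntegrand s t)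
      - ∫ t in x..y, gammaIntegrand s t) (-gammaIntegrand s x) x := by
    refine HasDerivAt.const_sub _ (intervalIntegral.integral_hasDerivAt_right
      (intervalIntegrable_gammaIntegrand s hx hx) ?_ ?_)
    · exact (continuousOn_gammaIntegrand s).stronglyMeasurableAtFilter isOpen_Ioi x hx
    · exact (continuousOn_gammaIntegrand s).continuousAt (Ioi_mem_nhds hx)
  refine h1.congr_of_eventuallyEq ?_
  filter_upwards [Ioi_mem_nhds hx] with y hy
  exact integral_Ioi_gammaIntegrand s hx hy

/-- The substitution `t = e^w` turns `e^{-t} t^{s-1} dt` into the entire differential `e^{-e^w}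
e^{sw} dw`. With a primitive `E` of it, the integral is `E(log X + επi) - E(log X)`, which can be
differentiated in `X` without any branch cut. -/
lemma hasDerivAt_semicircleIntegral (ε : ℤˣ) (s : ℂ) {X : ℝ} (hX : 0 < X) :
    HasDerivAt (semicircleIntegral ε s)
      (cexp X * (X : ℂ) ^ (s - 1) * cexp (((ε : ℤ) : ℂ) * Real.pi * Complex.I * s)
        - gammaIntegrand s X) X := by
  obtain ⟨E, hE⟩ := Differentiable.isExactOn_univ
    (f := fun w : ℂ => cexp (-cexp w) * cexp (s * w)) (by fun_prop)
  replace hE := fun w => hE w (Set.mem_univ w)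
  have hpow : ∀ Y : ℝ, 0 < Y → (Y : ℂ) ^ s = cexp (s * Real.log Y) := fun Y hY => by
    rw [Complex.cpow_def_of_ne_zero (by exact_mod_cast hY.ne'), Complex.ofReal_log hY.le, mul_comm]
  have hexp : ∀ Y : ℝ, 0 < Y → cexp (Real.log Y) = Y := fun Y hY => by
    rw [← Complex.ofReal_exp, Real.exp_log hY]
  have h1 : ∀ Y : ℝ, 0 < Y → semicircleIntegral ε s Y =
      E (Real.log Y + ((ε : ℤ) : ℂ) * Complex.I * Real.pi) - E (Real.log Y) := by
    intro Y hY
    rw [semicircleIntegral]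
    rw [intervalIntegral.integral_eq_sub_of_hasDerivAt
      (f := fun φ : ℝ => E (Real.log Y + ((ε : ℤ) : ℂ) * Complex.I * φ))]
    · simp
    · intro φ _
      have h2 : HasDerivAt (fun φ : ℂ => (Real.log Y : ℂ) + ((ε : ℤ) : ℂ) * Complex.I * φ)
          (((ε : ℤ) : ℂ) * Complex.I) (φ : ℂ) := by
        simpa using ((hasDerivAt_id (φ : ℂ)).const_mul (((ε : ℤ) : ℂ) * Complex.I)).const_add
          (Real.log Y : ℂ)
      have h3 := ((hE _).comp (φ : ℂ) h2).comp_ofReal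
      refine h3.congr_deriv ?_
      beta_reduce
      rw [hpow Y hY, mul_add, Complex.exp_add, Complex.exp_add, hexp Y hY]
      ring_nf
    · apply Continuous.intervalIntegrable
      fun_prop
  have hl : HasDerivAt (fun Y : ℝ => (Real.log Y : ℂ)) ((X⁻¹ : ℝ) : ℂ) X :=
    (Real.hasDerivAt_log hX.ne').ofReal_comp
  have h4 : HasDerivAt (fun Y : ℝ => E (Real.log Y + ((ε : ℤ) : ℂ) * Complex.I * Real.pi)
      - E (Real.log Y)) _ X :=
    (HasDerivAt.comp X (hE _) (hl.add_const _)).sub (HasDerivAt.comp X (hE _) hl)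
  have h5 := h4.congr_of_eventuallyEq (f₁ := semicircleIntegral ε s) (by
    filter_upwards [Ioi_mem_nhds hX] with Y hY using h1 Y hY)
  refine h5.congr_deriv ?_
  have e1 : cexp (((ε : ℤ) : ℂ) * Complex.I * Real.pi) = -1 := by
    rw [← exp_sign_pi_I ε]; ring_nf
  have hX0 : (X : ℂ) ≠ 0 := by exact_mod_cast hX.ne'
  have e2 : (X : ℂ) ^ (s - 1) = (X : ℂ) ^ s * (X : ℂ)⁻¹ := by
    rw [Complex.cpow_sub _ _ hX0, Complex.cpow_one, div_eq_mul_inv]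
  beta_reduce
  rw [gammaIntegrand, e2, hpow X hX, mul_add, Complex.exp_add, Complex.exp_add, hexp X hX, e1]
  push_cast
  ring_nf

/-- For `a < 0` the ray and the semicircle contribute opposite terms at `|a| X`, and only the end
point on the negative axis remains. The formula is therefore the same for both signs of `a`, with
`a^s` in the branch `ε`. -/
lemma hasDerivAt_incGamma (ε : ℤˣ) (s : ℂ) {a X : ℝ} (ha : a ≠ 0) (hX : 0 < X) :
    HasDerivAt (fun X : ℝ => incGamma ε s (a * X))
      (-(brPow ε a s * cexp (-(a * X)) * (X : ℂ) ^ (s - 1))) X := by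
  have hX0 : (X : ℂ) ≠ 0 := by exact_mod_cast hX.ne'
  have ha0 : (a : ℂ) ≠ 0 := by exact_mod_cast ha
  have hlin : ∀ b : ℝ, HasDerivAt (fun Y : ℝ => b * Y) b X := fun b => by
    simpa using (hasDerivAt_id X).const_mul b
  have hpow : ∀ b : ℝ, 0 < b →
      (b : ℂ) * ((b * X : ℝ) : ℂ) ^ (s - 1) = (b : ℂ) ^ s * (X : ℂ) ^ (s - 1) := by
    intro b hb
    have hb0 : (b : ℂ) ≠ 0 := by exact_mod_cast hb.ne'
    rw [Complex.ofReal_mul, Complex.mul_cpow_ofReal_nonneg hb.le hX.le, Complex.cpow_sub _ _ hb0,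
      Complex.cpow_one]
    field_simp
  rcases lt_or_gt_of_ne ha with h0 | h0
  · have hb : 0 < |a| := abs_pos.mpr ha
    have hab : a = -|a| := by rw [abs_of_neg h0]; ring
    have h1 : HasDerivAt (fun Y : ℝ => (∫ t in Set.Ioi (|a| * Y), gammaIntegrand s t)
        - semicircleIntegral ε s (|a| * Y)) _ X :=
      ((hasDerivAt_integral_Ioi_gammaIntegrand s (mul_pos hb hX)).scomp X (hlin |a|)).sub
      ((hasDerivAt_semicircleIntegral ε s (mul_pos hb hX)).scomp X (hlin |a|))
    have h2 := h1.congr_of_eventuallyEq (f₁ := fun X : ℝ => incGamma ε s (a * X)) (by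
      filter_upwards [Ioi_mem_nhds hX] with Y hY
      have : a * Y = -(|a| * Y) := by rw [abs_of_neg h0]; ring
      rw [this, incGamma_neg ε s (mul_pos hb hY)])
    refine h2.congr_deriv ?_
    rw [brPow_of_neg ε h0, Complex.real_smul, Complex.real_smul]
    have e := hpow |a| hb
    have e3 : cexp ((|a| * X : ℝ) : ℂ) = cexp (-(a * X)) := by
      rw [abs_of_neg h0]; push_cast; ring_nf
    rw [e3]
    linear_combination (-cexp (-(a * X)) * cexp (((ε : ℤ) : ℂ) * Real.pi * Complex.I * s)) * e
  · have h1 : HasDerivAt (fun Y : ℝ => ∫ t in Set.Ioi (a * Y), gammaIntegrand s t) _ X :=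
      (hasDerivAt_integral_Ioi_gammaIntegrand s (mul_pos h0 hX)).scomp X (hlin a)
    have h2 := h1.congr_of_eventuallyEq (f₁ := fun X : ℝ => incGamma ε s (a * X)) (by
      filter_upwards [Ioi_mem_nhds hX] with Y hY
      rw [incGamma_of_pos ε s (mul_pos h0 hY)])
    refine h2.congr_deriv ?_
    rw [brPow_of_pos ε h0, Complex.real_smul, gammaIntegrand]
    have e := hpow a h0
    push_cast at e ⊢
    linear_combination (-cexp (-(a * X))) * e

lemma tendsto_incGamma_atTop (ε : ℤˣ) (s : ℂ) : Tendsto (incGamma ε s) atTop (𝓝 0) := by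
  have h := intervalIntegral_tendsto_integral_Ioi 1 (integrableOn_gammaIntegrand s one_pos)
    tendsto_id
  have h2 := (tendsto_const_nhds (x := ∫ t in Set.Ioi (1 : ℝ), gammaIntegrand s t)).sub h
  rw [sub_self] at h2
  refine h2.congr' ?_
  filter_upwards [Ioi_mem_atTop (0 : ℝ)] with x hx
  rw [incGamma_of_pos ε s hx, integral_Ioi_gammaIntegrand s one_pos hx, id]

lemma conj_gammaIntegrand (s : ℂ) {t : ℝ} (ht : 0 < t) :
    conj (gammaIntegrand s t) = gammaIntegrand (conj s) t := by
  rw [gammaIntegrand, map_mul, conj_ofReal_cpow ht, ← Complex.exp_conj]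
  simp [gammaIntegrand]

lemma conj_integral_Ioi_gammaIntegrand (s : ℂ) {x : ℝ} (hx : 0 < x) :
    conj (∫ t in Set.Ioi x, gammaIntegrand s t) = ∫ t in Set.Ioi x, gammaIntegrand (conj s) t := by
  rw [← integral_conj]
  exact setIntegral_congr_fun measurableSet_Ioi fun t ht => conj_gammaIntegrand s (hx.trans ht)

lemma conj_semicircleIntegral (ε : ℤˣ) (s : ℂ) {X : ℝ} (hX : 0 < X) :
    conj (semicircleIntegral ε s X) = semicircleIntegral (-ε) (conj s) X := by
  rw [semicircleIntegral, semicircleIntegral, ← intervalIntegral.intervalIntegral_conj]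
  congr 1
  ext φ
  rw [map_mul, map_mul, map_mul, conj_ofReal_cpow hX, ← Complex.exp_conj, ← Complex.exp_conj]
  simp [← Complex.exp_conj]

lemma conj_incGamma (ε : ℤˣ) (s : ℂ) {x : ℝ} (hx : x ≠ 0) :
    conj (incGamma ε s x) = incGamma (-ε) (conj s) x := by
  rcases lt_or_gt_of_ne hx with h0 | h0
  · obtain ⟨X, rfl⟩ : ∃ X, x = -X := ⟨-x, by ring⟩
    have hX : 0 < X := by linarith
    rw [incGamma_neg _ _ hX, incGamma_neg _ _ hX, map_sub, conj_integral_Ioi_gammaIntegrand _ hX,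
      conj_semicircleIntegral _ _ hX]
  · rw [incGamma_of_pos _ _ h0, incGamma_of_pos _ _ h0, conj_integral_Ioi_gammaIntegrand _ h0]

/-- For `s = 1` the integrand `e^{-t}` has an entire primitive, so the branch disappears. This
evaluates the second series of `Λ_r(h, k - 1)`, where `k - s = 1`. -/
lemma incGamma_one (ε : ℤˣ) {x : ℝ} (hx : x ≠ 0) : incGamma ε 1 x = cexp (-x) := by
  have hI : ∀ y : ℝ, ∫ t in Set.Ioi y, gammaIntegrand 1 t = cexp (-y) := fun y => by
    have : ∀ t : ℝ, gammaIntegrand 1 t = ((Real.exp (-t) : ℝ) : ℂ) := fun t => by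
      simp [gammaIntegrand]
    simp_rw [this]
    rw [integral_complex_ofReal, integral_exp_neg_Ioi]
    simp
  rcases lt_or_gt_of_ne hx with h0 | h0
  · obtain ⟨X, rfl⟩ : ∃ X, x = -X := ⟨-x, by ring⟩
    have hX : 0 < X := by linarith
    rw [incGamma_neg _ _ hX, hI, semicircleIntegral]
    rw [intervalIntegral.integral_eq_sub_of_hasDerivAt
      (f := fun φ : ℝ => -cexp (-((X : ℂ) * cexp (((ε : ℤ) : ℂ) * Complex.I * φ))))]
    · have e1 : cexp (((ε : ℤ) : ℂ) * Complex.I * Real.pi) = -1 := by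
        rw [← exp_sign_pi_I ε]; ring_nf
      rw [e1]
      simp
    · intro φ _
      have h2 : HasDerivAt (fun φ : ℂ => ((ε : ℤ) : ℂ) * Complex.I * φ)
          (((ε : ℤ) : ℂ) * Complex.I) (φ : ℂ) := by
        simpa using ((hasDerivAt_id (φ : ℂ)).const_mul (((ε : ℤ) : ℂ) * Complex.I))
      have h3 := ((h2.cexp.const_mul (X : ℂ)).fun_neg.cexp.fun_neg).comp_ofReal
      refine h3.congr_deriv ?_
      simp
      ring
    · apply Continuous.intervalIntegrable
      fun_prop
  · rw [incGamma_of_pos _ _ h0, hI]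

lemma exists_rpow_le_exp (s : ℝ) : ∃ C : ℝ, 0 < C ∧ ∀ x : ℝ, 1 ≤ x → x ^ s ≤ C * Real.exp x := by
  obtain ⟨n, hn⟩ := exists_nat_ge s
  refine ⟨n.factorial, by positivity, fun x hx => ?_⟩
  calc x ^ s ≤ x ^ (n : ℝ) := Real.rpow_le_rpow_of_exponent_le hx hn
    _ = x ^ n := Real.rpow_natCast x n
    _ ≤ n.factorial * Real.exp x := by
      have := Real.pow_div_factorial_le_exp x (by linarith) n
      rwa [div_le_iff₀' (by positivity)] at this

/-- On the semicircle `|e^{-t}| ≤ e^X`, and the second factor `e^X` absorbs the power `X^s`. A fixed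
exponential rate suffices, since it will be multiplied by coefficients that decay faster than any
exponential. -/
lemma exists_norm_incGamma_neg_le (ε : ℤˣ) (s : ℝ) :
    ∃ C : ℝ, 0 < C ∧ ∀ X : ℝ, 1 ≤ X → ‖incGamma ε s (-X)‖ ≤ C * Real.exp (2 * X) := by
  obtain ⟨C, hC, hCle⟩ := exists_rpow_le_exp s
  set J := ∫ t in Set.Ioi (1 : ℝ), ‖gammaIntegrand s t‖
  have hJ : 0 ≤ J := integral_nonneg fun t => norm_nonneg _
  refine ⟨J + C * Real.pi, by positivity, fun X hX => ?_⟩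
  have hX0 : 0 < X := by linarith
  rw [incGamma_neg _ _ hX0]
  have h1 : ‖∫ t in Set.Ioi X, gammaIntegrand s t‖ ≤ J :=
    (norm_integral_le_integral_norm _).trans (setIntegral_mono_set
      (integrableOn_gammaIntegrand s one_pos).norm (ae_of_all _ fun t => norm_nonneg _)
      (Set.Ioi_subset_Ioi hX).eventuallyLE)
  have h2 : ‖semicircleIntegral ε s X‖ ≤ Real.exp X * X ^ s * |Real.pi - 0| := by
    apply intervalIntegral.norm_integral_le_of_norm_le_const
    intro φ _
    have hε : ‖((ε : ℤ) : ℂ) * Complex.I‖ = 1 := by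
      rcases Int.units_eq_one_or ε with rfl | rfl <;> simp
    have e1 : ((ε : ℤ) : ℂ) * Complex.I * φ * s = (((ε : ℤ) : ℝ) * φ * s : ℝ) * Complex.I := by
      push_cast; ring
    have e2 : ((ε : ℤ) : ℂ) * Complex.I * φ = (((ε : ℤ) : ℝ) * φ : ℝ) * Complex.I := by
      push_cast; ring
    rw [norm_mul, norm_mul, norm_mul, hε, e1, Complex.norm_exp_ofReal_mul_I,
      Complex.norm_cpow_eq_rpow_re_of_pos hX0, mul_one, mul_one, Complex.ofReal_re]
    apply mul_le_mul_of_nonneg_right _ (by positivity)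
    rw [Complex.norm_exp]
    apply Real.exp_le_exp.mpr
    refine (Complex.re_le_norm _).trans ?_
    rw [norm_neg, norm_mul, e2, Complex.norm_exp_ofReal_mul_I, Complex.norm_real, mul_one,
      Real.norm_of_nonneg hX0.le]
  rw [sub_zero, abs_of_pos Real.pi_pos] at h2
  have h3 : Real.exp (2 * X) = Real.exp X * Real.exp X := by rw [← Real.exp_add]; ring_nf
  have h4 : 1 ≤ Real.exp (2 * X) := Real.one_le_exp (by linarith)
  have h5 : Real.exp X * X ^ s ≤ C * Real.exp (2 * X) := by
    rw [h3]
    have := mul_le_mul_of_nonneg_left (hCle X hX) (Real.exp_pos X).le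
    linarith
  calc _ ≤ J + Real.exp X * X ^ s * Real.pi := (norm_sub_le _ _).trans (add_le_add h1 h2)
    _ ≤ J * Real.exp (2 * X) + C * Real.exp (2 * X) * Real.pi :=
      add_le_add (le_mul_of_one_le_right hJ h4)
        (mul_le_mul_of_nonneg_right h5 Real.pi_pos.le)
    _ = _ := by ring

/-! ### Fourier series on the line -/

/-- The exponential `e^{2πinx}`. -/
def fexp (n : ℤ) (x : ℝ) : ℂ := cexp (2 * Real.pi * Complex.I * n * x)

lemma fexp_eq (n : ℤ) (x : ℝ) : fexp n x = cexp ((2 * Real.pi * n * x : ℝ) * Complex.I) := by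
  rw [fexp]; congr 1; push_cast; ring

lemma norm_fexp (n : ℤ) (x : ℝ) : ‖fexp n x‖ = 1 := by
  rw [fexp_eq, Complex.norm_exp_ofReal_mul_I]

lemma conj_fexp (n : ℤ) (x : ℝ) : conj (fexp n x) = fexp (-n) x := by
  rw [fexp, fexp, ← Complex.exp_conj]
  congr 1
  simp only [map_mul, Complex.conj_I, Complex.conj_ofReal, map_ofNat, map_intCast, Int.cast_neg]
  ring

lemma fexp_mul_neg (m n : ℤ) (x : ℝ) : fexp m x * fexp (-n) x = fexp (m - n) x := by
  rw [fexp, fexp, fexp, ← Complex.exp_add]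
  congr 1; push_cast; ring

@[fun_prop]
lemma continuous_fexp (n : ℤ) : Continuous (fexp n) := by
  unfold fexp; fun_prop

lemma hasDerivAt_fexp (n : ℤ) (x : ℝ) :
    HasDerivAt (fexp n) (2 * Real.pi * Complex.I * n * fexp n x) x := by
  have h : HasDerivAt (fun z : ℂ => 2 * Real.pi * Complex.I * n * z)
      (2 * Real.pi * Complex.I * n) (x : ℂ) := by
    simpa using (hasDerivAt_id (x : ℂ)).const_mul (2 * Real.pi * Complex.I * n)
  have := h.cexp.comp_ofReal
  refine this.congr_deriv ?_
  rw [fexp]; ring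

lemma fexp_int (n : ℤ) (j : ℤ) : fexp n j = 1 := by
  rw [fexp, Complex.exp_eq_one_iff]
  exact ⟨n * j, by push_cast; ring⟩

lemma fexp_one (n : ℤ) : fexp n 1 = 1 := by
  have := fexp_int n 1
  rwa [Int.cast_one] at this

lemma fexp_zero_right (n : ℤ) : fexp n 0 = 1 := by simp [fexp]

lemma fexp_zero_left (x : ℝ) : fexp 0 x = 1 := by simp [fexp]

lemma fexp_add (n : ℤ) (x y : ℝ) : fexp n (x + y) = fexp n x * fexp n y := by
  rw [fexp, fexp, fexp, ← Complex.exp_add]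
  congr 1; push_cast; ring

lemma integral_fexp (n : ℤ) : ∫ x in (0 : ℝ)..1, fexp n x = if n = 0 then 1 else 0 := by
  split_ifs with h
  · subst h
    simp [fexp]
  · have hn : (2 * Real.pi * Complex.I * n : ℂ) ≠ 0 := by
      simp [Real.pi_ne_zero, h]
    rw [intervalIntegral.integral_eq_sub_of_hasDerivAt
      (f := fun x => (2 * Real.pi * Complex.I * n)⁻¹ * fexp n x)]
    · rw [fexp_one, fexp_zero_right, sub_self]
    · intro x _
      refine ((hasDerivAt_fexp n x).const_mul _).congr_deriv ?_
      field_simp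
    · exact (continuous_fexp n).intervalIntegrable _ _

/-- The coefficients of an everywhere convergent Fourier series of period `l`. -/
lemma integral_of_hasSum_fexp {l : ℝ} (hl : 0 < l) {c : ℤ → ℂ} {F : ℝ → ℂ}
    (h : ∀ x, HasSum (fun n => c n * fexp n (x / l)) (F x)) (n : ℤ) :
    (1 / (l : ℂ)) * ∫ x in (0 : ℝ)..l, F x * fexp (-n) (x / l) = c n := by
  -- Every exponential has modulus one, so convergence at the single point `0` already gives
  -- absolute summability.
  have hc : Summable fun n => ‖c n‖ := by
    have := (h 0).summable.norm
    simpa [norm_fexp] using this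
  have h1 : ∫ x in (0 : ℝ)..l, F x * fexp (-n) (x / l)
      = l * ∫ x in (0 : ℝ)..1, F (l * x) * fexp (-n) x := by
    have h1 := intervalIntegral.smul_integral_comp_mul_left
      (fun x => F x * fexp (-n) (x / l)) (a := 0) (b := 1) l
    rw [mul_zero, mul_one] at h1
    rw [← h1, Complex.real_smul]
    congr 1
    refine intervalIntegral.integral_congr fun x _ => ?_
    rw [mul_div_cancel_left₀ _ hl.ne']
  have h2 : HasSum (fun m => ∫ x in (0 : ℝ)..1, c m * fexp (m - n) x)
      (∫ x in (0 : ℝ)..1, F (l * x) * fexp (-n) x) := by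
    refine intervalIntegral.hasSum_integral_of_dominated_convergence (fun m _ => ‖c m‖)
      (fun m => ?_) (fun m => ae_of_all _ fun x _ => ?_) (ae_of_all _ fun x _ => hc) ?_
      (ae_of_all _ fun x _ => ?_)
    · exact (by fun_prop : Continuous fun x => c m * fexp (m - n) x).aestronglyMeasurable
    · rw [norm_mul, norm_fexp, mul_one]
    · exact continuous_const.intervalIntegrable _ _
    · have := (h (l * x)).mul_right (fexp (-n) x)
      rw [mul_div_cancel_left₀ _ hl.ne'] at this
      simpa only [mul_assoc, fexp_mul_neg] using this
  have h3 : ∀ m, ∫ x in (0 : ℝ)..1, c m * fexp (m - n) x = if m = n then c n else 0 := by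
    intro m
    rw [intervalIntegral.integral_const_mul, integral_fexp]
    by_cases hmn : m = n
    · simp [hmn]
    · simp [hmn, sub_eq_zero]
  simp_rw [h3] at h2
  rw [h1, h2.unique (hasSum_ite_eq n (c n))]
  have : (l : ℂ) ≠ 0 := by exact_mod_cast hl.ne'
  field_simp

lemma integral_of_hasSum_fexp_one {c : ℤ → ℂ} {F : ℝ → ℂ}
    (h : ∀ x, HasSum (fun n => c n * fexp n x) (F x)) (n : ℤ) :
    ∫ x in (0 : ℝ)..1, F x * fexp (-n) x = c n := by
  have := integral_of_hasSum_fexp one_pos (c := c) (F := F) (by simpa using h) n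
  simpa using this

/-- A continuous periodic function is the sum of its Fourier series if the coefficients are
summable. -/
lemma hasSum_fexp_of_summable {F : ℝ → ℂ} (hF : Continuous F) (hper : ∀ x, F (x + 1) = F x)
    {c : ℤ → ℂ} (hc : ∀ n, ∫ x in (0 : ℝ)..1, F x * fexp (-n) x = c n) (hs : Summable c) (x : ℝ) :
    HasSum (fun n => c n * fexp n x) (F x) := by
  have : Fact ((0 : ℝ) < 1) := ⟨one_pos⟩
  have hp : Function.Periodic F 1 := hper
  let f : C(AddCircle (1 : ℝ), ℂ) := ⟨hp.lift, by
    exact continuous_coinduced_dom.mpr hF⟩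
  have hf : ∀ x : ℝ, f (x : AddCircle (1 : ℝ)) = F x := fun x => hp.lift_coe x
  have he : ∀ (n : ℤ) (x : ℝ), fourier n (x : AddCircle (1 : ℝ)) = fexp n x := fun n x => by
    rw [fourier_coe_apply, fexp]
    simp
  have hcoef : ∀ n : ℤ, _root_.fourierCoeff f n = c n := fun n => by
    rw [fourierCoeff_eq_intervalIntegral f n 0, ← hc n]
    simp only [one_div, inv_one, zero_add, one_smul]
    refine intervalIntegral.integral_congr fun x _ => ?_
    rw [he, hf, smul_eq_mul, mul_comm]
  have := has_pointwise_sum_fourier_series_of_summable (f := f)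
    (by rw [funext hcoef]; exact hs) (x : AddCircle (1 : ℝ))
  simpa only [hcoef, he, hf, smul_eq_mul] using this

/-- Coefficients of subexponential growth in both directions. -/
lemma summable_norm_mul_exp {b : ℤ → ℂ}
    (hb : ∀ y : ℝ, 0 < y → ∃ M : ℝ, ∀ n : ℤ, ‖b n‖ ≤ M * Real.exp (n * y)) {y : ℝ} (hy : 0 < y) :
    Summable fun n : ℤ => ‖b n‖ * Real.exp (-(n * y)) := by
  -- The bound with `y / 2` serves `n ≥ 0`, the bound with `2y` serves `n ≤ 0`; each leaves a
  -- convergent geometric series.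
  obtain ⟨M₁, h₁⟩ := hb (y / 2) (by positivity)
  obtain ⟨M₂, h₂⟩ := hb (2 * y) (by positivity)
  have key : ∀ a M : ℝ, 0 < a → Summable fun n : ℕ => M * Real.exp (-(n * a)) := fun a M ha => by
    refine Summable.mul_left _ ?_
    have := Real.summable_exp_nat_mul_iff.mpr (neg_lt_zero.mpr ha)
    simpa using this
  refine Summable.of_nat_of_neg ?_ ?_
  · refine Summable.of_nonneg_of_le (fun n => by positivity) (fun n => ?_)
      (key (y / 2) M₁ (by positivity))
    have := mul_le_mul_of_nonneg_right (h₁ n) (Real.exp_pos (-((n : ℤ) * y))).le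
    refine this.trans (le_of_eq ?_)
    rw [mul_assoc, ← Real.exp_add]
    congr 2
    push_cast; ring
  · refine Summable.of_nonneg_of_le (fun n => by positivity) (fun n => ?_) (key y M₂ hy)
    have := mul_le_mul_of_nonneg_right (h₂ (-n)) (Real.exp_pos (-((-n : ℤ) * y))).le
    refine this.trans (le_of_eq ?_)
    rw [mul_assoc, ← Real.exp_add]
    congr 2
    push_cast; ring

/-! ### Fourier coefficients of smooth periodic functions on the upper half plane -/

/-- The point `x + i y`. -/
def pt (x y : ℝ) : ℂ := x + y * Complex.I

@[simp] lemma pt_im (x y : ℝ) : (pt x y).im = y := by simp [pt]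

@[simp] lemma pt_re (x y : ℝ) : (pt x y).re = x := by simp [pt]

lemma pt_add_one (x y : ℝ) : pt (x + 1) y = pt x y + 1 := by simp [pt]; ring

lemma coe_eq_pt (z : ℍ) : (z : ℂ) = pt z.re z.im := (Complex.re_add_im (z : ℂ)).symm

lemma ofComplex_pt (z : ℍ) : ofComplex (pt z.re z.im) = z := by
  rw [← coe_eq_pt, ofComplex_apply]

lemma coe_ofComplex {z : ℂ} (hz : 0 < z.im) : ((ofComplex z : ℍ) : ℂ) = z := by
  rw [ofComplex_apply_of_im_pos hz]

lemma continuous_pt : Continuous fun p : ℝ × ℝ => pt p.1 p.2 := by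
  unfold pt; fun_prop

lemma isOpen_im_pos : IsOpen {z : ℂ | 0 < z.im} := isOpen_lt continuous_const Complex.continuous_im

lemma hasDerivAt_pt_left (x y : ℝ) : HasDerivAt (fun x => pt x y) 1 x := by
  simpa [pt] using (Complex.ofRealCLM.hasDerivAt (x := x)).add_const (y * Complex.I)

lemma hasDerivAt_pt_right (x y : ℝ) : HasDerivAt (fun y => pt x y) Complex.I y := by
  simpa [pt] using ((Complex.ofRealCLM.hasDerivAt (x := y)).mul_const Complex.I).const_add (x : ℂ)

section Smooth

variable {G : ℂ → ℂ}

lemma differentiableAt_of_smooth (hG : ContDiffOn ℝ ∞ G {z : ℂ | 0 < z.im}) {z : ℂ}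
    (hz : 0 < z.im) : DifferentiableAt ℝ G z :=
  (hG.contDiffAt (isOpen_im_pos.mem_nhds hz)).differentiableAt (by simp)

lemma continuousOn_fderiv_of_smooth (hG : ContDiffOn ℝ ∞ G {z : ℂ | 0 < z.im}) :
    ContinuousOn (fderiv ℝ G) {z : ℂ | 0 < z.im} :=
  hG.continuousOn_fderiv_of_isOpen isOpen_im_pos (by simp)

lemma continuousOn_dX (hG : ContDiffOn ℝ ∞ G {z : ℂ | 0 < z.im}) :
    ContinuousOn (dX G) {z : ℂ | 0 < z.im} :=
  (continuousOn_fderiv_of_smooth hG).clm_apply continuousOn_const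

lemma continuousOn_dY (hG : ContDiffOn ℝ ∞ G {z : ℂ | 0 < z.im}) :
    ContinuousOn (dY G) {z : ℂ | 0 < z.im} :=
  (continuousOn_fderiv_of_smooth hG).clm_apply continuousOn_const

lemma hasDerivAt_comp_pt_left (hG : ContDiffOn ℝ ∞ G {z : ℂ | 0 < z.im}) (x : ℝ) {y : ℝ}
    (hy : 0 < y) : HasDerivAt (fun x => G (pt x y)) (dX G (pt x y)) x :=
  (differentiableAt_of_smooth hG (by simpa using hy)).hasFDerivAt.comp_hasDerivAt x
    (hasDerivAt_pt_left x y)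

lemma hasDerivAt_comp_pt_right (hG : ContDiffOn ℝ ∞ G {z : ℂ | 0 < z.im}) (x : ℝ) {y : ℝ}
    (hy : 0 < y) : HasDerivAt (fun y => G (pt x y)) (dY G (pt x y)) y :=
  (differentiableAt_of_smooth hG (by simpa using hy)).hasFDerivAt.comp_hasDerivAt y
    (hasDerivAt_pt_right x y)

lemma continuous_comp_pt {H : ℂ → ℂ} (hH : ContinuousOn H {z : ℂ | 0 < z.im}) {y : ℝ}
    (hy : 0 < y) : Continuous fun x => H (pt x y) := by
  refine hH.comp_continuous (continuous_pt.comp (by fun_prop : Continuous fun x : ℝ => (x, y))) ?_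
  intro x
  simpa using hy

/-- The Fourier coefficient along a horizontal line. -/
def lineCoeff (G : ℂ → ℂ) (n : ℤ) (y : ℝ) : ℂ := ∫ x in (0 : ℝ)..1, G (pt x y) * fexp (-n) x

lemma lineCoeff_dX (hG : ContDiffOn ℝ ∞ G {z : ℂ | 0 < z.im}) (hper : ∀ z, G (z + 1) = G z)
    (n : ℤ) {y : ℝ} (hy : 0 < y) :
    lineCoeff (dX G) n y = 2 * Real.pi * Complex.I * n * lineCoeff G n y := by
  have c1 := continuous_comp_pt (continuousOn_dX hG) hy
  have c2 := continuous_comp_pt hG.continuousOn hy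
  have c3 : Continuous fun x => dX G (pt x y) * fexp (-n) x := c1.mul (continuous_fexp _)
  have c4 : Continuous fun x => G (pt x y) * (2 * Real.pi * Complex.I * (-n : ℤ) * fexp (-n) x) :=
    c2.mul (continuous_const.mul (continuous_fexp _))
  have h : ∫ x in (0 : ℝ)..1, (dX G (pt x y) * fexp (-n) x
      + G (pt x y) * (2 * Real.pi * Complex.I * (-n : ℤ) * fexp (-n) x)) = 0 := by
    rw [intervalIntegral.integral_eq_sub_of_hasDerivAt
      (f := fun x => G (pt x y) * fexp (-n) x)]
    · have := pt_add_one 0 y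
      rw [zero_add] at this
      rw [this, hper, fexp_one, fexp_zero_right, sub_self]
    · intro x _
      exact (hasDerivAt_comp_pt_left hG x hy).mul (hasDerivAt_fexp _ x)
    · exact (c3.add c4).intervalIntegrable _ _
  rw [intervalIntegral.integral_add (c3.intervalIntegrable _ _) (c4.intervalIntegrable _ _)] at h
  have h2 : ∫ x in (0 : ℝ)..1, G (pt x y) * (2 * Real.pi * Complex.I * (-n : ℤ) * fexp (-n) x)
      = -(2 * Real.pi * Complex.I * n) * lineCoeff G n y := by
    rw [lineCoeff, ← intervalIntegral.integral_const_mul]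
    congr 1
    ext x
    push_cast; ring
  rw [h2] at h
  rw [lineCoeff]
  linear_combination h

lemma hasDerivAt_lineCoeff (hG : ContDiffOn ℝ ∞ G {z : ℂ | 0 < z.im}) (n : ℤ) {y : ℝ}
    (hy : 0 < y) : HasDerivAt (lineCoeff G n) (lineCoeff (dY G) n y) y := by
  have hK : IsCompact (Set.Icc (0 : ℝ) 1 ×ˢ Set.Icc (y / 2) (2 * y)) :=
    isCompact_Icc.prod isCompact_Icc
  have hcont : ContinuousOn (fun p : ℝ × ℝ => dY G (pt p.1 p.2))
      (Set.Icc (0 : ℝ) 1 ×ˢ Set.Icc (y / 2) (2 * y)) := by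
    refine (continuousOn_dY hG).comp continuous_pt.continuousOn ?_
    rintro ⟨p, q⟩ ⟨_, hq⟩
    simp only [Set.mem_ofPred_eq, pt_im]
    exact lt_of_lt_of_le (by positivity) hq.1
  obtain ⟨C, hC⟩ := hK.exists_bound_of_continuousOn hcont
  have hs : Set.Ioo (y / 2) (2 * y) ∈ 𝓝 y := Ioo_mem_nhds (by linarith) (by linarith)
  refine (intervalIntegral.hasDerivAt_integral_of_dominated_loc_of_deriv_le
    (F := fun y x => G (pt x y) * fexp (-n) x) (F' := fun y x => dY G (pt x y) * fexp (-n) x)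
    (bound := fun _ => C) hs ?_ ?_ ?_ ?_ ?_ ?_).2
  · filter_upwards [Ioi_mem_nhds hy] with v hv
    exact ((continuous_comp_pt hG.continuousOn hv).mul
      (continuous_fexp (-n))).aestronglyMeasurable
  · exact ((continuous_comp_pt hG.continuousOn hy).mul (continuous_fexp (-n))).intervalIntegrable _ _
  · exact ((continuous_comp_pt (continuousOn_dY hG) hy).mul
      (continuous_fexp (-n))).aestronglyMeasurable
  · refine ae_of_all _ fun x hx v hv => ?_
    rw [Set.uIoc_of_le zero_le_one] at hx
    rw [norm_mul, norm_fexp, mul_one]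
    exact hC (x, v) ⟨⟨hx.1.le, hx.2⟩, ⟨hv.1.le, hv.2.le⟩⟩
  · exact continuous_const.intervalIntegrable _ _
  · refine ae_of_all _ fun x _ v hv => ?_
    exact (hasDerivAt_comp_pt_right hG x (lt_trans (by positivity) hv.1)).mul_const _

end Smooth

/-! ### The Fourier coefficients of `ξ g` -/

section Coefficients

variable {ε : ℤˣ} {s : ℝ} {g gp gm : ℍ → ℂ} {ap am : ℤ → ℂ}

lemma ext_pt (f : ℍ → ℂ) (z : ℍ) : ext f (pt z.re z.im) = f z := by
  rw [ext, ofComplex_pt]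

lemma cexp_two_pi_pt (n : ℤ) (x y : ℝ) :
    cexp (2 * Real.pi * Complex.I * n * pt x y) = cexp (-(2 * Real.pi * n * y)) * fexp n x := by
  rw [fexp, ← Complex.exp_add]
  congr 1
  rw [pt]
  linear_combination (2 * Real.pi * n * y : ℂ) * Complex.I_sq

/-- The Fourier coefficients of `g` on the line of height `y`. -/
def maassCoeff (ε : ℤˣ) (s : ℝ) (ap am : ℤ → ℂ) (n : ℤ) (y : ℝ) : ℂ :=
  ap n * cexp (-(2 * Real.pi * n * y)) +
    if n = 0 then am 0 * (y : ℂ) ^ (s : ℂ) else am n * Bfun ε (1 - s) (2 * Real.pi * n * y)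

lemma IsMaassDecomposition.hasSum_line (hdec : IsMaassDecomposition ε (1 - s) g gp gm ap am)
    (hs : s ≠ 0) (x : ℝ) {y : ℝ} (hy : 0 < y) :
    HasSum (fun n => maassCoeff ε s ap am n y * fexp n x) (ext g (pt x y)) := by
  have him : 0 < (pt x y).im := by simpa using hy
  set z : ℍ := ofComplex (pt x y) with hz
  have hzc : (z : ℂ) = pt x y := coe_ofComplex him
  have hre : z.re = x := by rw [← UpperHalfPlane.coe_re, hzc, pt_re]
  have hzim : z.im = y := by rw [← UpperHalfPlane.coe_im, hzc, pt_im]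
  have h := (hdec.hasSum_hol z).add (hdec.hasSum_nonhol z)
  rw [← hdec.add_eq z, hzc, hre, hzim] at h
  rw [ext, ← hz]
  refine h.congr_fun fun n => ?_
  rw [maassCoeff, cexp_two_pi_pt]
  have hw : (1 - s : ℂ) ≠ 1 := by
    intro h
    apply hs
    have : (s : ℂ) = 0 := by linear_combination -h
    exact_mod_cast this
  rw [if_neg hw]
  split_ifs with h0
  · subst h0
    simp [fexp_zero_left]
  · rw [← fexp]
    ring

lemma IsMaassDecomposition.ext_add_one (hdec : IsMaassDecomposition ε (1 - s) g gp gm ap am)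
    (hs : s ≠ 0) (z : ℂ) : ext g (z + 1) = ext g z := by
  rcases lt_or_ge 0 z.im with hz | hz
  · have h1 := hdec.hasSum_line hs z.re hz
    have h2 := hdec.hasSum_line hs (z.re + 1) hz
    simp_rw [fexp_add, fexp_one, mul_one] at h2
    rw [pt_add_one] at h2
    have h3 : pt z.re z.im = z := Complex.re_add_im z
    rw [h3] at h1 h2
    exact h2.unique h1
  -- Outside the upper half plane `ofComplex` takes a default value, so periodicity is trivial
  -- there.
  · rw [ext, ext, ofComplex_apply_eq_of_im_nonpos (by simpa using hz) hz]

lemma IsMaassDecomposition.lineCoeff_eq (hdec : IsMaassDecomposition ε (1 - s) g gp gm ap am)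
    (hs : s ≠ 0) (n : ℤ) {y : ℝ} (hy : 0 < y) :
    lineCoeff (ext g) n y = maassCoeff ε s ap am n y :=
  integral_of_hasSum_fexp_one (fun x => hdec.hasSum_line hs x hy) n

/-- The Fourier coefficients of `ξ g`, in terms of those of the nonholomorphic part of `g`. -/
def shadowCoeff (ε : ℤˣ) (s : ℝ) (am : ℤ → ℂ) (n : ℤ) : ℂ :=
  if n = 0 then s * conj (am 0) else -conj (am (-n) * brPow ε (4 * Real.pi * n) s)

lemma hasDerivAt_ofReal_cpow' {y : ℝ} (hy : 0 < y) (s : ℂ) :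
    HasDerivAt (fun y : ℝ => (y : ℂ) ^ s) (s * (y : ℂ) ^ (s - 1)) y := by
  have := ((hasDerivAt_id (y : ℂ)).cpow_const (c := s)
    (Complex.ofReal_mem_slitPlane.mpr hy)).comp_ofReal
  simpa using this

/-- A coefficient that solves `f' = -2πn f` is that of a holomorphic exponential. The deviation from
this equation comes only from the derivative of `Γ(s, -4πny)`, or of `y^s` if `n = 0`, and carries
the coefficient of the shadow. -/
lemma hasDerivAt_maassCoeff (n : ℤ) {y : ℝ} (hy : 0 < y) :
    HasDerivAt (maassCoeff ε s ap am n)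
      (-(2 * Real.pi * n) * maassCoeff ε s ap am n y - (conj (shadowCoeff ε s am (-n)))
        * cexp (2 * Real.pi * n * y) * (-1) * (y : ℂ) ^ (s - 1 : ℂ)) y := by
  have hexp : HasDerivAt (fun y : ℝ => cexp (-(2 * Real.pi * n * y)))
      (-(2 * Real.pi * n) * cexp (-(2 * Real.pi * n * y))) y := by
    have h : HasDerivAt (fun z : ℂ => -(2 * Real.pi * n * z)) (-(2 * Real.pi * n)) (y : ℂ) := by
      simpa using ((hasDerivAt_id (y : ℂ)).const_mul (2 * Real.pi * n : ℂ)).fun_neg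
    exact (h.cexp.comp_ofReal).congr_deriv (by ring)
  by_cases h0 : n = 0
  · subst h0
    have h1 : maassCoeff ε s ap am 0 = fun y : ℝ => ap 0 + am 0 * (y : ℂ) ^ (s : ℂ) := by
      ext y; simp [maassCoeff]
    rw [h1]
    refine (((hasDerivAt_ofReal_cpow' hy s).const_mul (am 0)).const_add (ap 0)).congr_deriv ?_
    simp [shadowCoeff]
    ring
  · have h1 : maassCoeff ε s ap am n = fun y : ℝ => ap n * cexp (-(2 * Real.pi * n * y)) +
        am n * (cexp (-(2 * Real.pi * n * y)) * incGamma ε s ((-(4 * Real.pi * n)) * y)) := by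
      ext y
      rw [maassCoeff, if_neg h0, Bfun]
      have e1 : (1 - (1 - s) : ℂ) = s := by ring
      have e2 : -2 * (2 * Real.pi * n * y) = (-(4 * Real.pi * n)) * y := by ring
      rw [e1, e2]
      push_cast
      rfl
    have ha : -(4 * Real.pi * n) ≠ 0 := by
      simp [Real.pi_ne_zero, h0]
    have h2 := (hexp.const_mul (ap n)).add
      ((hexp.mul (hasDerivAt_incGamma ε s ha hy)).const_mul (am n))
    rw [h1]
    refine h2.congr_deriv ?_
    have e3 : shadowCoeff ε s am (-n) = -conj (am n * brPow ε (-(4 * Real.pi * n)) s) := by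
      rw [shadowCoeff, if_neg (by simpa using h0), neg_neg]
      push_cast
      ring_nf
    have e4 : cexp (-(((-(4 * Real.pi * n) : ℝ) : ℂ) * y))
        = cexp (2 * Real.pi * n * y) * cexp (2 * Real.pi * n * y) := by
      rw [← Complex.exp_add]; congr 1; push_cast; ring
    have e5 : cexp (-(2 * Real.pi * n * y)) * cexp (2 * Real.pi * n * y) = 1 := by
      rw [← Complex.exp_add]; simp
    rw [e3, map_neg, Complex.conj_conj, e4]
    linear_combination (-(am n * brPow ε (-(4 * Real.pi * n)) s * (y : ℂ) ^ (s - 1 : ℂ)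
      * cexp (2 * Real.pi * n * y))) * e5

lemma dBar_eq (z : ℍ) : dBar g z = (dX (ext g) z + Complex.I * dY (ext g) z) / 2 := rfl

/-- `∂g/∂z̄` as a function on `ℂ`. -/
def dBarExt (g : ℍ → ℂ) (z : ℂ) : ℂ := (dX (ext g) z + Complex.I * dY (ext g) z) / 2

lemma continuousOn_dBarExt (hG : ContDiffOn ℝ ∞ (ext g) {z : ℂ | 0 < z.im}) :
    ContinuousOn (dBarExt g) {z : ℂ | 0 < z.im} :=
  ((continuousOn_dX hG).add (continuousOn_const.mul (continuousOn_dY hG))).div_const 2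

/-- On the `n`-th Fourier coefficient `∂/∂z̄` acts as `(i/2)(2πn + d/dy)`, which annihilates the
holomorphic part and keeps the deviation found in `hasDerivAt_maassCoeff`. -/
lemma lineCoeff_dBarExt (hG : ContDiffOn ℝ ∞ (ext g) {z : ℂ | 0 < z.im})
    (hdec : IsMaassDecomposition ε (1 - s) g gp gm ap am)
    (hs : s ≠ 0) (n : ℤ) {y : ℝ} (hy : 0 < y) :
    lineCoeff (dBarExt g) n y = Complex.I / 2 * conj (shadowCoeff ε s am (-n))
        * cexp (2 * Real.pi * n * y) * (y : ℂ) ^ (s - 1 : ℂ) := by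
  have h1 := lineCoeff_dX hG (hdec.ext_add_one hs) n hy
  have h2 : lineCoeff (dY (ext g)) n y = -(2 * Real.pi * n) * maassCoeff ε s ap am n y
      - (conj (shadowCoeff ε s am (-n))) * cexp (2 * Real.pi * n * y) * (-1)
        * (y : ℂ) ^ (s - 1 : ℂ) := by
    refine (hasDerivAt_lineCoeff hG n hy).unique ((hasDerivAt_maassCoeff n hy).congr_of_eventuallyEq
      ?_)
    filter_upwards [Ioi_mem_nhds hy] with v hv using hdec.lineCoeff_eq hs n hv
  rw [hdec.lineCoeff_eq hs n hy] at h1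
  have c1 : Continuous fun x => dX (ext g) (pt x y) * fexp (-n) x :=
    (continuous_comp_pt (continuousOn_dX hG) hy).mul (continuous_fexp (-n))
  have c2 : Continuous fun x => dY (ext g) (pt x y) * fexp (-n) x :=
    (continuous_comp_pt (continuousOn_dY hG) hy).mul (continuous_fexp (-n))
  have h3 : lineCoeff (dBarExt g) n y = 1 / 2 * lineCoeff (dX (ext g)) n y
      + Complex.I / 2 * lineCoeff (dY (ext g)) n y := by
    rw [lineCoeff, lineCoeff, lineCoeff, ← intervalIntegral.integral_const_mul,
      ← intervalIntegral.integral_const_mul, ← intervalIntegral.integral_add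
      ((c1.intervalIntegrable _ _).const_mul _) ((c2.intervalIntegrable _ _).const_mul _)]
    congr 1
    ext x
    rw [dBarExt]
    ring
  rw [h3, h1, h2]
  ring

lemma xi_ofComplex_pt (w : ℂ) (x : ℝ) {y : ℝ} (hy : 0 < y) :
    xi w g (ofComplex (pt x y)) = 2 * Complex.I * (y : ℂ) ^ w * conj (dBarExt g (pt x y)) := by
  have him : 0 < (pt x y).im := by simpa using hy
  have hzim : (ofComplex (pt x y)).im = y := by
    rw [← UpperHalfPlane.coe_im, coe_ofComplex him, pt_im]
  rw [xi, dBar_eq, hzim, coe_ofComplex him]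
  rfl

lemma continuous_xi_line (hG : ContDiffOn ℝ ∞ (ext g) {z : ℂ | 0 < z.im}) (w : ℂ) {y : ℝ}
    (hy : 0 < y) : Continuous fun x => ext (xi w g) (pt x y) := by
  have : (fun x => ext (xi w g) (pt x y))
      = fun x => 2 * Complex.I * (y : ℂ) ^ w * conj (dBarExt g (pt x y)) :=
    funext fun x => xi_ofComplex_pt w x hy
  rw [this]
  exact continuous_const.mul
    (Complex.continuous_conj.comp (continuous_comp_pt (continuousOn_dBarExt hG) hy))

/-- Conjugation exchanges `n` and `-n`, and the factor `y^{1-s}` of `ξ` cancels `y^{s-1}`. What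
remains depends on `y` as the coefficient of a holomorphic function does. -/
lemma lineCoeff_xi (hG : ContDiffOn ℝ ∞ (ext g) {z : ℂ | 0 < z.im})
    (hdec : IsMaassDecomposition ε (1 - s) g gp gm ap am)
    (hs : s ≠ 0) (n : ℤ) {y : ℝ} (hy : 0 < y) :
    lineCoeff (ext (xi (1 - s) g)) n y
      = shadowCoeff ε s am n * cexp (-(2 * Real.pi * n * y)) := by
  have h1 : lineCoeff (ext (xi (1 - s) g)) n y
      = 2 * Complex.I * (y : ℂ) ^ (1 - s : ℂ) * conj (lineCoeff (dBarExt g) (-n) y) := by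
    rw [lineCoeff, lineCoeff, ← intervalIntegral.intervalIntegral_conj,
      ← intervalIntegral.integral_const_mul]
    congr 1
    ext x
    rw [ext, xi_ofComplex_pt _ _ hy, map_mul, conj_fexp]
    ring_nf
  have hy0 : (y : ℂ) ≠ 0 := by exact_mod_cast hy.ne'
  have hpow : (y : ℂ) ^ (1 - s : ℂ) * (y : ℂ) ^ (s - 1 : ℂ) = 1 := by
    rw [← Complex.cpow_add _ _ hy0]
    ring_nf
    simp
  have hconj : conj ((y : ℂ) ^ (s - 1 : ℂ)) = (y : ℂ) ^ (s - 1 : ℂ) := by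
    rw [conj_ofReal_cpow hy]; simp
  have hconj2 : conj (cexp (2 * Real.pi * (-n : ℤ) * y)) = cexp (-(2 * Real.pi * n * y)) := by
    rw [← Complex.exp_conj]
    congr 1
    simp only [map_mul, Complex.conj_ofReal, map_ofNat, map_intCast, Int.cast_neg, map_neg]
    ring
  rw [h1, lineCoeff_dBarExt hG hdec hs _ hy, neg_neg, map_mul, map_mul, map_mul, Complex.conj_conj,
    hconj, hconj2]
  simp only [map_div₀, Complex.conj_I, map_ofNat]
  linear_combination (-(Complex.I ^ 2) * shadowCoeff ε s am n * cexp (-(2 * Real.pi * n * y))) * hpow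
    - shadowCoeff ε s am n * cexp (-(2 * Real.pi * n * y)) * Complex.I_sq

lemma coeffInfty_xi (hG : ContDiffOn ℝ ∞ (ext g) {z : ℂ | 0 < z.im})
    (hdec : IsMaassDecomposition ε (1 - s) g gp gm ap am) (hs : s ≠ 0) (n : ℤ) :
    coeffInfty (xi (1 - s) g) n = shadowCoeff ε s am n := by
  have h := lineCoeff_xi hG hdec hs n one_pos
  have h2 : coeffInfty (xi (1 - s) g) n
      = cexp (2 * Real.pi * n) * lineCoeff (ext (xi (1 - s) g)) n 1 := by
    rw [coeffInfty, fourierCoeff, lineCoeff]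
    simp only [Nat.cast_one, div_one, one_mul, Complex.ofReal_zero, add_zero]
    rw [← intervalIntegral.integral_const_mul]
    refine intervalIntegral.integral_congr fun x _ => ?_
    have : (x : ℂ) + Complex.I = pt x 1 := by simp [pt]
    rw [this, ext, fexp, mul_comm (cexp _), mul_assoc (xi _ _ _), ← Complex.exp_add]
    congr 2
    rw [pt]
    push_cast
    linear_combination (-(2 * Real.pi * n : ℂ)) * Complex.I_sq
  rw [h2, h, mul_left_comm, ← Complex.exp_add]
  simp

/-- The coefficient `b(n) e^{-2πnv}` is bounded by the supremum of `|ξ g|` on the line of height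
`v`; take `v = y / 2π`. Since `y` is arbitrary, large `y` yields rapid decay for `n → -∞` and small
`y` yields subexponential growth for `n → ∞`. -/
lemma shadowCoeff_bound (hG : ContDiffOn ℝ ∞ (ext g) {z : ℂ | 0 < z.im})
    (hdec : IsMaassDecomposition ε (1 - s) g gp gm ap am) (hs : s ≠ 0) {y : ℝ} (hy : 0 < y) :
    ∃ M : ℝ, ∀ n : ℤ, ‖shadowCoeff ε s am n‖ ≤ M * Real.exp (n * y) := by
  set v := y / (2 * Real.pi) with hv
  have hv0 : 0 < v := by positivity
  obtain ⟨M, hM⟩ := (isCompact_Icc (a := (0 : ℝ)) (b := 1)).exists_bound_of_continuousOn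
    (continuous_xi_line hG (1 - s : ℂ) hv0).continuousOn
  refine ⟨M, fun n => ?_⟩
  have h1 := lineCoeff_xi hG hdec hs n hv0
  have h2 : ‖lineCoeff (ext (xi (1 - s) g)) n v‖ ≤ M * |1 - 0| := by
    apply intervalIntegral.norm_integral_le_of_norm_le_const
    intro x hx
    rw [Set.uIoc_of_le zero_le_one] at hx
    rw [norm_mul, norm_fexp, mul_one]
    exact hM x ⟨hx.1.le, hx.2⟩
  have e : (-(2 * Real.pi * n * v) : ℂ) = ((-(n * y) : ℝ) : ℂ) := by
    rw [hv]
    push_cast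
    field_simp
  rw [h1, norm_mul, e, Complex.norm_exp_ofReal, Real.exp_neg] at h2
  have h3 := Real.exp_pos (n * y)
  rw [← div_eq_mul_inv, div_le_iff₀ h3] at h2
  simpa using h2

lemma summable_shadowCoeff (hG : ContDiffOn ℝ ∞ (ext g) {z : ℂ | 0 < z.im})
    (hdec : IsMaassDecomposition ε (1 - s) g gp gm ap am) (hs : s ≠ 0) {y : ℝ} (hy : 0 < y) :
    Summable fun n : ℤ => ‖shadowCoeff ε s am n‖ * Real.exp (-(n * y)) :=
  summable_norm_mul_exp (fun _ hy => shadowCoeff_bound hG hdec hs hy) hy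

lemma hasSum_xi (hG : ContDiffOn ℝ ∞ (ext g) {z : ℂ | 0 < z.im})
    (hdec : IsMaassDecomposition ε (1 - s) g gp gm ap am) (hs : s ≠ 0) (z : ℍ) :
    HasSum (fun n : ℤ => shadowCoeff ε s am n * cexp (2 * Real.pi * Complex.I * n * z))
      (xi (1 - s) g z) := by
  have hper : ∀ x : ℝ, ext (xi (1 - s) g) (pt (x + 1) z.im) = ext (xi (1 - s) g) (pt x z.im) := by
    intro x
    rw [ext, ext, xi_ofComplex_pt _ _ z.im_pos, xi_ofComplex_pt _ _ z.im_pos, pt_add_one]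
    have : ∀ w, fderiv ℝ (ext g) (w + 1) = fderiv ℝ (ext g) w := fun w => by
      rw [← fderiv_comp_add_right]
      congr 1
      ext u
      exact hdec.ext_add_one hs u
    rw [dBarExt, dBarExt, dX, dX, dY, dY, this]
  have hsum : Summable fun n : ℤ => shadowCoeff ε s am n * cexp (-(2 * Real.pi * n * z.im)) := by
    refine Summable.of_norm ?_
    refine (summable_shadowCoeff hG hdec hs
      (y := 2 * Real.pi * z.im) (by have := z.im_pos; positivity)).congr fun n => ?_
    rw [norm_mul]
    have e : (-(2 * Real.pi * n * z.im) : ℂ) = ((-(n * (2 * Real.pi * z.im)) : ℝ) : ℂ) := by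
      push_cast; ring_nf
    rw [e, Complex.norm_exp_ofReal]
  have h := hasSum_fexp_of_summable (continuous_xi_line hG (1 - s : ℂ) z.im_pos) hper
    (fun n => lineCoeff_xi hG hdec hs n z.im_pos) hsum z.re
  rw [ext_pt] at h
  refine h.congr_fun fun n => ?_
  conv_lhs => rw [coe_eq_pt z, cexp_two_pi_pt]
  ring_nf

end Coefficients

/-! ### Primitives on the right half plane -/

lemma ne_zero_of_re_pos {p : ℂ} (hp : 0 < p.re) : p ≠ 0 := by
  rintro rfl
  simp at hp

lemma mem_slitPlane_of_re_pos {p : ℂ} (hp : 0 < p.re) : p ∈ Complex.slitPlane := Or.inl hp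

lemma isOpen_re_gt (a : ℝ) : IsOpen {p : ℂ | a < p.re} := isOpen_lt continuous_const Complex.continuous_re

/-- The Cayley map `q = (p - 1)/(p + 1)` carries the right half plane to the unit disc, where
primitives exist, and sends the normalisation point `1` to the centre. -/
lemma exists_primitive_of_re_pos {f : ℂ → ℂ} (hf : ∀ p : ℂ, 0 < p.re → DifferentiableAt ℂ f p)
    (v : ℂ) : ∃ F : ℂ → ℂ, F 1 = v ∧ ∀ p : ℂ, 0 < p.re → HasDerivAt F (f p) p := by
  have hne : ∀ q ∈ Metric.ball (0 : ℂ) 1, 1 - q ≠ 0 := by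
    intro q hq h
    rw [mem_ball_zero_iff, ← sub_eq_zero.mp h, norm_one] at hq
    exact lt_irrefl _ hq
  have hre : ∀ q ∈ Metric.ball (0 : ℂ) 1, 0 < ((1 + q) / (1 - q)).re := by
    intro q hq
    have hn : 0 < Complex.normSq (1 - q) := Complex.normSq_pos.mpr (hne q hq)
    rw [mem_ball_zero_iff] at hq
    have h2 : Complex.normSq q < 1 := by
      rw [Complex.normSq_eq_norm_sq]
      have := norm_nonneg q
      nlinarith
    rw [Complex.div_re, ← add_div]
    apply div_pos _ hn
    rw [Complex.normSq_apply] at h2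
    simp
    nlinarith
  have hd : DifferentiableOn ℂ (fun q => f ((1 + q) / (1 - q)) * (2 / (1 - q) ^ 2))
      (Metric.ball 0 1) := by
    intro q hq
    have h1 := hne q hq
    have h2 : DifferentiableAt ℂ (fun q : ℂ => (1 + q) / (1 - q)) q := by
      fun_prop (disch := exact h1)
    have h3 : DifferentiableAt ℂ (fun q : ℂ => 2 / (1 - q) ^ 2) q := by
      fun_prop (disch := exact pow_ne_zero 2 h1)
    exact (((hf _ (hre q hq)).comp q h2).mul h3).differentiableWithinAt
  obtain ⟨G, hG0, hG⟩ := hd.isExactOn_ball.with_val_at 0 v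
  refine ⟨fun p => G ((p - 1) / (p + 1)), by simpa using hG0, fun p hp => ?_⟩
  have hp1 : p + 1 ≠ 0 := ne_zero_of_re_pos (by simp; linarith)
  have hball : (p - 1) / (p + 1) ∈ Metric.ball (0 : ℂ) 1 := by
    rw [mem_ball_zero_iff, norm_div, div_lt_one (norm_pos_iff.mpr hp1)]
    refine lt_of_pow_lt_pow_left₀ 2 (norm_nonneg _) ?_
    rw [← Complex.normSq_eq_norm_sq, ← Complex.normSq_eq_norm_sq, Complex.normSq_apply,
      Complex.normSq_apply]
    simp
    nlinarith
  have h1 : HasDerivAt (fun p : ℂ => (p - 1) / (p + 1)) (2 / (p + 1) ^ 2) p := by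
    refine (((hasDerivAt_id p).sub_const 1).div ((hasDerivAt_id p).add_const 1) hp1).congr_deriv ?_
    simp
    ring
  refine ((hG _ hball).comp p h1).congr_deriv ?_
  have e1 : 1 - (p - 1) / (p + 1) = 2 / (p + 1) := by field_simp; ring
  have e2 : (1 + (p - 1) / (p + 1)) / (1 - (p - 1) / (p + 1)) = p := by
    rw [e1]; field_simp; ring
  rw [e2, e1]
  field_simp

lemma eq_of_hasDerivAt_eq_of_re_pos {F G : ℝ → ℂ} {f : ℝ → ℂ}
    (hF : ∀ x, 0 < x → HasDerivAt F (f x) x) (hG : ∀ x, 0 < x → HasDerivAt G (f x) x)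
    (h1 : F 1 = G 1) {x : ℝ} (hx : 0 < x) : F x = G x := by
  have h : (F - G) x = (F - G) 1 := by
    refine isOpen_Ioi.is_const_of_deriv_eq_zero (s := Set.Ioi (0 : ℝ)) isPreconnected_Ioi
      (fun y hy => ((hF y hy).sub (hG y hy)).differentiableAt.differentiableWithinAt)
      (fun y hy => ?_) hx (Set.mem_Ioi.mpr one_pos)
    rw [((hF y hy).sub (hG y hy)).deriv, sub_self]
    rfl
  simp only [Pi.sub_apply, h1, sub_self] at h
  exact sub_eq_zero.mp h

/-! ### The incomplete gamma function on the right half plane -/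

/-- The integrand `-2^{-s} e^{-2πnp} p^{s-1}`. -/
def periodIntegrand (s : ℝ) (n : ℤ) (p : ℂ) : ℂ :=
  -((2 : ℂ) ^ (-s : ℂ) * cexp (-(2 * Real.pi * n * p)) * p ^ (s - 1 : ℂ))

lemma differentiableAt_periodIntegrand (s : ℝ) (n : ℤ) {p : ℂ} (hp : 0 < p.re) :
    DifferentiableAt ℂ (periodIntegrand s n) p := by
  have h1 : DifferentiableAt ℂ (fun p : ℂ => p ^ (s - 1 : ℂ)) p :=
    (differentiableAt_id).cpow_const (mem_slitPlane_of_re_pos hp)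
  have h2 : DifferentiableAt ℂ (fun p : ℂ => (2 : ℂ) ^ (-s : ℂ) * cexp (-(2 * Real.pi * n * p))) p := by
    fun_prop
  exact (h2.mul h1).neg

/-- The value at `1` of the function `gammaExt`. -/
def gammaExtOne (ε : ℤˣ) (s : ℝ) (n : ℤ) : ℂ :=
  if n = 0 then -((2 : ℂ) ^ (-s : ℂ) / s)
  else brPow ε (4 * Real.pi * n) (-s) * incGamma ε s (2 * Real.pi * n)

/-- The holomorphic function `(4πn)^{-s} Γ(s, 2πnp)` on the right half plane, continued
analytically from the positive real line. -/
def gammaExt (ε : ℤˣ) (s : ℝ) (n : ℤ) : ℂ → ℂ :=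
  (exists_primitive_of_re_pos (fun _ hp => differentiableAt_periodIntegrand s n hp)
    (gammaExtOne ε s n)).choose

lemma gammaExt_one (ε : ℤˣ) (s : ℝ) (n : ℤ) : gammaExt ε s n 1 = gammaExtOne ε s n :=
  (exists_primitive_of_re_pos (fun _ hp => differentiableAt_periodIntegrand s n hp)
    (gammaExtOne ε s n)).choose_spec.1

lemma hasDerivAt_gammaExt (ε : ℤˣ) (s : ℝ) (n : ℤ) {p : ℂ} (hp : 0 < p.re) :
    HasDerivAt (gammaExt ε s n) (periodIntegrand s n p) p :=
  (exists_primitive_of_re_pos (fun _ hp => differentiableAt_periodIntegrand s n hp)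
    (gammaExtOne ε s n)).choose_spec.2 p hp

lemma four_pi_mul_ne_zero {n : ℤ} (hn : n ≠ 0) : 4 * Real.pi * n ≠ 0 := by
  simp [Real.pi_ne_zero, hn]

lemma two_pi_mul_ne_zero {n : ℤ} (hn : n ≠ 0) : 2 * Real.pi * n ≠ 0 := by
  simp [Real.pi_ne_zero, hn]

lemma brPow_four_pi (ε : ℤˣ) (s : ℂ) {n : ℤ} (hn : n ≠ 0) :
    brPow ε (4 * Real.pi * n) s = (2 : ℂ) ^ s * brPow ε (2 * Real.pi * n) s := by
  have : 4 * Real.pi * n = 2 * (2 * Real.pi * n) := by ring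
  rw [this, brPow_mul_left ε two_pos (two_pi_mul_ne_zero hn)]
  simp

/-- Both sides agree at `1` and have the same derivative: `(4πn)^{-s} (2πn)^s = 2^{-s}`, because the
two powers are taken in the same branch. The branch thus enters only through the constant of
integration. -/
lemma gammaExt_ofReal (ε : ℤˣ) (s : ℝ) {n : ℤ} (hn : n ≠ 0) {X : ℝ} (hX : 0 < X) :
    gammaExt ε s n X = brPow ε (4 * Real.pi * n) (-s) * incGamma ε s (2 * Real.pi * n * X) := by
  refine eq_of_hasDerivAt_eq_of_re_pos (F := fun X : ℝ => gammaExt ε s n X)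
    (f := fun X => periodIntegrand s n X)
    (G := fun X : ℝ => brPow ε (4 * Real.pi * n) (-s) * incGamma ε s (2 * Real.pi * n * X))
    (fun x hx => (hasDerivAt_gammaExt ε s n (by simpa using hx)).comp_ofReal) (fun x hx => ?_) ?_ hX
  · refine ((hasDerivAt_incGamma ε s (two_pi_mul_ne_zero hn) hx).const_mul _).congr_deriv ?_
    rw [brPow_four_pi ε _ hn, periodIntegrand]
    have h := brPow_neg_mul ε (two_pi_mul_ne_zero hn) s
    push_cast
    linear_combination (-(2 : ℂ) ^ (-s : ℂ) * cexp (-(2 * Real.pi * n * x)) * (x : ℂ) ^ (s - 1 : ℂ)) * h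
  · simp [gammaExt_one, gammaExtOne, hn]

/-- The value at `1` is chosen so that no additive constant appears. Thus `n = 0` fits the same
pattern as the other terms and reproduces `y^s` at `p = 2y`. -/
lemma gammaExt_zero (ε : ℤˣ) {s : ℝ} (hs : s ≠ 0) {p : ℂ} (hp : 0 < p.re) :
    gammaExt ε s 0 p = -((2 : ℂ) ^ (-s : ℂ) * p ^ (s : ℂ) / s) := by
  have hs' : (s : ℂ) ≠ 0 := by exact_mod_cast hs
  have hG : ∀ p : ℂ, 0 < p.re → HasDerivAt (fun p : ℂ => -((2 : ℂ) ^ (-s : ℂ) * p ^ (s : ℂ) / s))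
      (periodIntegrand s 0 p) p := by
    intro p hp
    refine ((((hasDerivAt_id p).cpow_const (c := (s : ℂ)) (mem_slitPlane_of_re_pos hp)).const_mul
      ((2 : ℂ) ^ (-s : ℂ))).div_const (s : ℂ)).fun_neg.congr_deriv ?_
    rw [periodIntegrand]
    simp
    field_simp
  have h : (gammaExt ε s 0 - fun p : ℂ => -((2 : ℂ) ^ (-s : ℂ) * p ^ (s : ℂ) / s)) p
      = (gammaExt ε s 0 - fun p : ℂ => -((2 : ℂ) ^ (-s : ℂ) * p ^ (s : ℂ) / s)) 1 := by
    refine (isOpen_re_gt 0).is_const_of_deriv_eq_zero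
      (convex_halfSpace_re_gt 0).isPreconnected
      (fun y hy => ((hasDerivAt_gammaExt ε s 0 hy).sub
        (hG y hy)).differentiableAt.differentiableWithinAt) (fun y hy => ?_) hp (by simp)
    rw [((hasDerivAt_gammaExt ε s 0 hy).sub (hG y hy)).deriv, sub_self]
    rfl
  simp only [Pi.sub_apply, gammaExt_one, gammaExtOne, if_true, Complex.one_cpow, mul_one,
    sub_self] at h
  exact sub_eq_zero.mp h

lemma two_cpow_eq (s : ℝ) : (2 : ℂ) ^ (s : ℂ) = ((2 ^ s : ℝ) : ℂ) := by
  rw [Complex.ofReal_cpow two_pos.le]; simp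

lemma norm_cpow_of_re_pos {p : ℂ} (hp : 0 < p.re) (s : ℝ) : ‖p ^ (s : ℂ)‖ = ‖p‖ ^ s := by
  rw [Complex.norm_cpow_of_ne_zero (ne_zero_of_re_pos hp)]
  simp

lemma norm_periodIntegrand (s : ℝ) (n : ℤ) {p : ℂ} (hp : 0 < p.re) :
    ‖periodIntegrand s n p‖ = 2 ^ (-s) * Real.exp (-(2 * Real.pi * n * p.re)) * ‖p‖ ^ (s - 1) := by
  have h1 : ‖(2 : ℂ) ^ (-s : ℂ)‖ = 2 ^ (-s) := by
    have := two_cpow_eq (-s)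
    push_cast at this
    rw [this, Complex.norm_real, Real.norm_of_nonneg (by positivity)]
  have h2 := norm_cpow_of_re_pos hp (s - 1)
  push_cast at h2
  rw [periodIntegrand, norm_neg, norm_mul, norm_mul, h1, h2, Complex.norm_exp]
  congr 3
  have : -(2 * Real.pi * n * p) = ((-(2 * Real.pi * n) : ℝ) : ℂ) * p := by push_cast; ring
  rw [this, Complex.re_ofReal_mul]
  ring

/-- The sum of the end point values dominates whether the power increases or decreases, so the sign
of the exponent never has to be distinguished. The next lemma does the same for the sign of `n`. -/
lemma rpow_le_rpow_add_rpow {a b x : ℝ} (ha : 0 < a) (hax : a ≤ x) (hxb : x ≤ b) (s : ℝ) :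
    x ^ s ≤ a ^ s + b ^ s := by
  have hx : 0 < x := ha.trans_le hax
  rcases le_total 0 s with h | h
  · have := Real.rpow_le_rpow hx.le hxb h
    have := Real.rpow_nonneg ha.le s
    linarith
  · have := Real.rpow_le_rpow_of_nonpos ha hax h
    have := Real.rpow_nonneg (hx.le.trans hxb) s
    linarith

lemma exp_neg_mul_le_add {a b x : ℝ} (hax : a ≤ x) (hxb : x ≤ b) (n : ℝ) :
    Real.exp (-(n * x)) ≤ Real.exp (-(n * a)) + Real.exp (-(n * b)) := by
  rcases le_total 0 n with h | h
  · have : Real.exp (-(n * x)) ≤ Real.exp (-(n * a)) := Real.exp_le_exp.mpr (by nlinarith)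
    have := Real.exp_pos (-(n * b))
    linarith
  · have : Real.exp (-(n * x)) ≤ Real.exp (-(n * b)) := Real.exp_le_exp.mpr (by nlinarith)
    have := Real.exp_pos (-(n * a))
    linarith

/-- A bound for the integrand on a vertical strip, uniform in `n`. -/
lemma norm_periodIntegrand_le (s : ℝ) (n : ℤ) {α β R : ℝ} (hα : 0 < α) {p : ℂ} (h1 : α ≤ p.re)
    (h2 : p.re ≤ β) (h3 : ‖p‖ ≤ R) :
    ‖periodIntegrand s n p‖ ≤ (2 ^ (-s) * (α ^ (s - 1) + R ^ (s - 1))) *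
      (Real.exp (-(n * (2 * Real.pi * α))) + Real.exp (-(n * (2 * Real.pi * β)))) := by
  have hp : 0 < p.re := hα.trans_le h1
  rw [norm_periodIntegrand s n hp]
  have e1 := rpow_le_rpow_add_rpow hα (h1.trans (Complex.re_le_norm p)) h3 (s - 1)
  have e2 := exp_neg_mul_le_add (a := 2 * Real.pi * α) (b := 2 * Real.pi * β)
    (x := 2 * Real.pi * p.re) (by gcongr) (by gcongr) n
  have e3 : 2 * Real.pi * n * p.re = n * (2 * Real.pi * p.re) := by ring
  have e4 : 0 ≤ ‖p‖ ^ (s - 1) := by positivity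
  rw [e3]
  calc _ ≤ 2 ^ (-s) * (Real.exp (-(n * (2 * Real.pi * α))) + Real.exp (-(n * (2 * Real.pi * β))))
        * (α ^ (s - 1) + R ^ (s - 1)) := by gcongr
    _ = _ := by ring

section Eichler

variable {ε : ℤˣ} {s : ℝ} {g gp gm : ℍ → ℂ} {ap am : ℤ → ℂ}

/-! ### The nonholomorphic Eichler integral with a movable end point -/

/-- The terms of `eichler`. -/
def eichlerTerm (ε : ℤˣ) (s : ℝ) (am : ℤ → ℂ) (z p : ℂ) (n : ℤ) : ℂ :=
  -(conj (shadowCoeff ε s am n) * gammaExt ε s n p * cexp (-(2 * Real.pi * Complex.I * n * z)))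

/-- The nonholomorphic part as a function of two variables: for `p = 2y` it is the nonholomorphic
part at `z = x + i y`, and it is holomorphic in `p`. -/
def eichler (ε : ℤˣ) (s : ℝ) (am : ℤ → ℂ) (z p : ℂ) : ℂ := ∑' n, eichlerTerm ε s am z p n

lemma two_cpow_neg_mul_cpow {y : ℝ} (hy : 0 < y) (s : ℝ) :
    (2 : ℂ) ^ (-s : ℂ) * ((2 * y : ℝ) : ℂ) ^ (s : ℂ) = (y : ℂ) ^ (s : ℂ) := by
  rw [Complex.ofReal_mul, Complex.mul_cpow_ofReal_nonneg two_pos.le hy.le, ← mul_assoc]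
  have : (2 : ℂ) ^ (-s : ℂ) * ((2 : ℝ) : ℂ) ^ (s : ℂ) = 1 := by
    rw [Complex.ofReal_ofNat, ← Complex.cpow_add _ _ two_ne_zero]
    simp
  rw [this, one_mul]

/-- After `n ↦ -n` the argument `-4πny` of the gamma function becomes `2πn · 2y`, and the factor
`(4πn)^s` in `shadowCoeff` cancels `(4πn)^{-s}` in `gammaExt`. -/
lemma hasSum_eichlerTerm (hdec : IsMaassDecomposition ε (1 - s) g gp gm ap am) (hs : s ≠ 0)
    (z : ℍ) : HasSum (eichlerTerm ε s am z ((2 * z.im : ℝ) : ℂ)) (gm z) := by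
  have hz := z.im_pos
  have hs' : (s : ℂ) ≠ 0 := by exact_mod_cast hs
  have h := (Equiv.neg ℤ).hasSum_iff.mpr (hdec.hasSum_nonhol z)
  refine h.congr_fun fun n => ?_
  simp only [Function.comp_apply, Equiv.neg_apply, neg_eq_zero]
  have hw : (1 - s : ℂ) ≠ 1 := by
    intro h
    apply hs'
    linear_combination -h
  have e1 : (1 - (1 - s) : ℂ) = s := by ring
  rw [if_neg hw, e1, eichlerTerm]
  split_ifs with h0
  · subst h0
    have := two_cpow_neg_mul_cpow hz s
    rw [gammaExt_zero ε hs (by simpa using hz), this, shadowCoeff, if_pos rfl]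
    simp
    field_simp
  · rw [gammaExt_ofReal ε s h0 (by positivity), shadowCoeff, if_neg h0, Bfun, e1]
    have e2 : -2 * (2 * Real.pi * (-n : ℤ) * z.im) = 2 * Real.pi * n * (2 * z.im) := by
      push_cast; ring
    have e3 := brPow_neg_mul ε (four_pi_mul_ne_zero h0) s
    have e4 : cexp (-(2 * Real.pi * Complex.I * n * z)) = cexp (-((2 * Real.pi * (-n : ℤ) * z.im : ℝ) : ℂ))
        * cexp (2 * Real.pi * Complex.I * (-n : ℤ) * z.re) := by
      rw [← Complex.exp_add, coe_eq_pt z, pt]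
      congr 1
      push_cast
      linear_combination (-(2 * Real.pi * n * z.im : ℂ)) * Complex.I_sq
    rw [e2, e4, map_neg, Complex.conj_conj]
    linear_combination (am (-n) * incGamma ε s (2 * Real.pi * n * (2 * z.im)) *
      (cexp (-((2 * Real.pi * (-n : ℤ) * z.im : ℝ) : ℂ))
        * cexp (2 * Real.pi * Complex.I * (-n : ℤ) * z.re))) * e3

lemma norm_cexp_neg_two_pi (n : ℤ) (z : ℂ) :
    ‖cexp (-(2 * Real.pi * Complex.I * n * z))‖ = Real.exp (n * (2 * Real.pi * z.im)) := by
  rw [Complex.norm_exp]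
  congr 1
  have : -(2 * Real.pi * Complex.I * n * z) = ((-(2 * Real.pi * n) : ℝ) : ℂ) * (Complex.I * z) := by
    push_cast; ring
  rw [this, Complex.re_ofReal_mul]
  simp
  ring

lemma summable_shadowCoeff_two (hG : ContDiffOn ℝ ∞ (ext g) {z : ℂ | 0 < z.im})
    (hdec : IsMaassDecomposition ε (1 - s) g gp gm ap am) (hs : s ≠ 0) {a b : ℝ} (ha : 0 < a)
    (hb : 0 < b) :
    Summable fun n : ℤ => ‖shadowCoeff ε s am n‖ * (Real.exp (-(n * a)) + Real.exp (-(n * b))) := by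
  simp_rw [mul_add]
  exact (summable_shadowCoeff hG hdec hs ha).add (summable_shadowCoeff hG hdec hs hb)

/-- The derivative of a term of `eichler`. -/
def eichlerTermDeriv (ε : ℤˣ) (s : ℝ) (am : ℤ → ℂ) (z p : ℂ) (n : ℤ) : ℂ :=
  -(conj (shadowCoeff ε s am n) * periodIntegrand s n p * cexp (-(2 * Real.pi * Complex.I * n * z)))

lemma hasDerivAt_eichlerTerm (z : ℂ) (n : ℤ) {p : ℂ} (hp : 0 < p.re) :
    HasDerivAt (fun p => eichlerTerm ε s am z p n) (eichlerTermDeriv ε s am z p n) p :=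
  (((hasDerivAt_gammaExt ε s n hp).const_mul _).mul_const _).neg

lemma norm_eichlerTermDeriv_le (z : ℂ) (n : ℤ) {α R : ℝ} (hα : 0 < α) {q : ℂ} (h1 : α ≤ q.re)
    (h2 : ‖q‖ ≤ R) : ‖eichlerTermDeriv ε s am z q n‖ ≤
      2 ^ (-s) * (α ^ (s - 1) + R ^ (s - 1)) * (‖shadowCoeff ε s am n‖ *
      (Real.exp (-(n * (2 * Real.pi * (α - z.im)))) +
        Real.exp (-(n * (2 * Real.pi * (R - z.im)))))) := by
  have h3 := norm_periodIntegrand_le s n hα h1 ((Complex.re_le_norm q).trans h2) h2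
  have h4 : (Real.exp (-(n * (2 * Real.pi * α))) + Real.exp (-(n * (2 * Real.pi * R))))
      * Real.exp (n * (2 * Real.pi * z.im)) = Real.exp (-(n * (2 * Real.pi * (α - z.im)))) +
      Real.exp (-(n * (2 * Real.pi * (R - z.im)))) := by
    rw [add_mul, ← Real.exp_add, ← Real.exp_add]
    ring_nf
  rw [eichlerTermDeriv, norm_neg, norm_mul, norm_mul, norm_cexp_neg_two_pi, RCLike.norm_conj, ← h4]
  calc _ ≤ ‖shadowCoeff ε s am n‖ * (2 ^ (-s) * (α ^ (s - 1) + R ^ (s - 1)) *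
        (Real.exp (-(n * (2 * Real.pi * α))) + Real.exp (-(n * (2 * Real.pi * R)))))
        * Real.exp (n * (2 * Real.pi * z.im)) := by
        gcongr
    _ = _ := by ring

/-- The product `e^{-2πnp} e^{-2πinz}` is the conjugate of `e^{2πinw}` for `w = z̄ + i p̄`, so the
series is the conjugated Fourier expansion of `ξ g` at `w`. The condition `Im z < Re p` says that
`w` lies in the upper half plane. -/
lemma tsum_eichlerTermDeriv (hG : ContDiffOn ℝ ∞ (ext g) {z : ℂ | 0 < z.im})
    (hdec : IsMaassDecomposition ε (1 - s) g gp gm ap am) (hs : s ≠ 0) (z p : ℂ)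
    (hp : z.im < p.re) :
    ∑' n, eichlerTermDeriv ε s am z p n = (2 : ℂ) ^ (-s : ℂ) * p ^ (s - 1 : ℂ) *
      conj (xi (1 - s) g (ofComplex (conj z + Complex.I * conj p))) := by
  have hwim : 0 < (conj z + Complex.I * conj p).im := by simpa using hp
  have hx := hasSum_xi hG hdec hs (ofComplex (conj z + Complex.I * conj p))
  rw [coe_ofComplex hwim] at hx
  have hx2 := ((Complex.hasSum_conj'.mpr hx).mul_left ((2 : ℂ) ^ (-s : ℂ) * p ^ (s - 1 : ℂ)))
  rw [← hx2.tsum_eq]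
  congr 1
  ext n
  have e : conj (cexp (2 * Real.pi * Complex.I * n * (conj z + Complex.I * conj p)))
      = cexp (-(2 * Real.pi * n * p)) * cexp (-(2 * Real.pi * Complex.I * n * z)) := by
    rw [← Complex.exp_conj, ← Complex.exp_add]
    congr 1
    simp only [map_mul, map_add, Complex.conj_conj, Complex.conj_I, Complex.conj_ofReal,
      map_ofNat, map_intCast]
    linear_combination (2 * Real.pi * n * p) * Complex.I_sq
  rw [map_mul, e, eichlerTermDeriv, periodIntegrand]
  ring

/-- Convergence is known at `p = 2y` from the decomposition of `g`. It spreads over a connected open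
set on which the differentiated series is dominated uniformly. -/
lemma summable_hasDerivAt_eichler (hG : ContDiffOn ℝ ∞ (ext g) {z : ℂ | 0 < z.im})
    (hdec : IsMaassDecomposition ε (1 - s) g gp gm ap am) (hs : s ≠ 0) (z : ℍ) {p : ℂ}
    (hp : z.im < p.re) :
    Summable (eichlerTerm ε s am z p) ∧
    HasDerivAt (eichler ε s am z) (∑' n, eichlerTermDeriv ε s am z p n) p := by
  have hz := z.im_pos
  -- The convex set `{α < Re p} ∩ ball 0 R` must contain both `p` and `2y`, and `α > Im z` keeps the
  -- dominating exponentials summable against the coefficients.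
  obtain ⟨α, hα1, hα2⟩ := exists_between (lt_min hp (by linarith : z.im < 2 * z.im))
  have hα0 : 0 < α := hz.trans hα1
  obtain ⟨R, hR⟩ := exists_gt (max ‖p‖ (2 * z.im))
  have hR1 : ‖p‖ < R := (le_max_left _ _).trans_lt hR
  have hR2 : 2 * z.im < R := (le_max_right _ _).trans_lt hR
  have ht : IsOpen ({p : ℂ | α < p.re} ∩ Metric.ball 0 R) := (isOpen_re_gt α).inter Metric.isOpen_ball
  have htc : IsPreconnected ({p : ℂ | α < p.re} ∩ Metric.ball 0 R) :=
    ((convex_halfSpace_re_gt α).inter (convex_ball 0 R)).isPreconnected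
  have hpt : p ∈ ({p : ℂ | α < p.re} ∩ Metric.ball 0 R) :=
    ⟨lt_of_lt_of_le hα2 (min_le_left _ _), by simpa using hR1⟩
  have hyt : ((2 * z.im : ℝ) : ℂ) ∈ ({p : ℂ | α < p.re} ∩ Metric.ball 0 R) := by
    refine ⟨?_, ?_⟩
    · simpa using lt_of_lt_of_le hα2 (min_le_right _ _)
    · rw [mem_ball_zero_iff, Complex.norm_real, Real.norm_of_nonneg (by linarith)]
      exact hR2
  have h1 : 0 < α - (z : ℂ).im := by rw [UpperHalfPlane.coe_im]; linarith
  have h2 : 0 < R - (z : ℂ).im := by rw [UpperHalfPlane.coe_im]; linarith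
  have hsum := (summable_shadowCoeff_two hG hdec hs
    (mul_pos Real.two_pi_pos h1) (mul_pos Real.two_pi_pos h2)).mul_left
    (2 ^ (-s) * (α ^ (s - 1) + R ^ (s - 1)))
  have hbound : ∀ (n : ℤ) (q : ℂ), q ∈ ({p : ℂ | α < p.re} ∩ Metric.ball 0 R) →
      ‖eichlerTermDeriv ε s am z q n‖ ≤ 2 ^ (-s) * (α ^ (s - 1) + R ^ (s - 1)) *
      (‖shadowCoeff ε s am n‖ * (Real.exp (-(n * (2 * Real.pi * (α - (z : ℂ).im)))) +
        Real.exp (-(n * (2 * Real.pi * (R - (z : ℂ).im)))))) :=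
    fun n q hq => norm_eichlerTermDeriv_le (ε := ε) (s := s) (am := am) (z : ℂ) n hα0
      (le_of_lt hq.1) (mem_ball_zero_iff.mp hq.2).le
  have hderiv : ∀ (n : ℤ) (q : ℂ), q ∈ ({p : ℂ | α < p.re} ∩ Metric.ball 0 R) →
      HasDerivAt (fun p => eichlerTerm ε s am z p n) (eichlerTermDeriv ε s am z q n) q :=
    fun n q hq => hasDerivAt_eichlerTerm _ n (hα0.trans hq.1)
  have hs0 := (hasSum_eichlerTerm hdec hs z).summable
  have A := summable_of_summable_hasDerivAt_of_isPreconnected hsum ht htc hderiv hbound hyt hs0 hpt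
  have B := hasDerivAt_tsum_of_isPreconnected hsum ht htc hderiv hbound hyt hs0 hpt
  exact ⟨A, B⟩

lemma hasDerivAt_eichler (hG : ContDiffOn ℝ ∞ (ext g) {z : ℂ | 0 < z.im})
    (hdec : IsMaassDecomposition ε (1 - s) g gp gm ap am) (hs : s ≠ 0) (z : ℍ) {p : ℂ}
    (hp : z.im < p.re) :
    HasDerivAt (eichler ε s am z) ((2 : ℂ) ^ (-s : ℂ) * p ^ (s - 1 : ℂ) *
      conj (xi (1 - s) g (ofComplex (conj (z : ℂ) + Complex.I * conj p)))) p := by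
  rw [← tsum_eichlerTermDeriv hG hdec hs z p hp]
  exact (summable_hasDerivAt_eichler hG hdec hs z hp).2

lemma eichler_two_im (hdec : IsMaassDecomposition ε (1 - s) g gp gm ap am) (hs : s ≠ 0) (z : ℍ) :
    eichler ε s am z ((2 * z.im : ℝ) : ℂ) = gm z :=
  (hasSum_eichlerTerm hdec hs z).tsum_eq

end Eichler

/-! ### Modular transformations -/

lemma autFactor_im_pos {γ : SL(2, ℤ)} (hc : 0 < γ 1 0) (z : ℍ) : 0 < (autFactor γ z).im := by
  have : (autFactor γ z).im = γ 1 0 * z.im := by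
    simp [autFactor]
  rw [this]
  have := z.im_pos
  have : (0 : ℝ) < γ 1 0 := by exact_mod_cast hc
  positivity

/-- The Möbius transformation as a function on `ℂ`. -/
def mob (γ : SL(2, ℤ)) (z : ℂ) : ℂ := ((γ 0 0 : ℂ) * z + γ 0 1) / ((γ 1 0 : ℂ) * z + γ 1 1)

lemma mob_coe (γ : SL(2, ℤ)) (z : ℍ) : mob γ z = ((γ • z : ℍ) : ℂ) := by
  rw [coe_smul_eq]; rfl

lemma hasDerivAt_mob (γ : SL(2, ℤ)) (z : ℍ) : HasDerivAt (mob γ) ((autFactor γ z ^ 2)⁻¹) (z : ℂ) := by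
  have h0 := autFactor_ne_zero γ z
  have h1 : HasDerivAt (fun z : ℂ => (γ 0 0 : ℂ) * z + γ 0 1) (γ 0 0) (z : ℂ) := by
    simpa using ((hasDerivAt_id (z : ℂ)).const_mul (γ 0 0 : ℂ)).add_const (γ 0 1 : ℂ)
  have h2 : HasDerivAt (fun z : ℂ => (γ 1 0 : ℂ) * z + γ 1 1) (γ 1 0) (z : ℂ) := by
    simpa using ((hasDerivAt_id (z : ℂ)).const_mul (γ 1 0 : ℂ)).add_const (γ 1 1 : ℂ)
  refine (h1.div h2 h0).congr_deriv ?_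
  have hdet := det_eq_one' γ
  change _ / autFactor γ z ^ 2 = _
  rw [div_eq_mul_inv]
  nth_rewrite 2 [← one_mul ((autFactor γ z ^ 2)⁻¹)]
  congr 1
  linear_combination hdet

lemma coe_smul_sub_conj (γ : SL(2, ℤ)) (z w : ℍ) :
    ((γ • z : ℍ) : ℂ) - conj ((γ • w : ℍ) : ℂ)
      = ((z : ℂ) - conj (w : ℂ)) / (autFactor γ z * conj (autFactor γ w)) := by
  have h1 := autFactor_ne_zero γ z
  have h2 := (map_ne_zero (starRingEnd ℂ)).mpr (autFactor_ne_zero γ w)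
  have hdet := det_eq_one' γ
  rw [coe_smul_eq, coe_smul_eq, map_div₀, div_sub_div _ _ h1 h2]
  congr 1
  simp only [autFactor, map_add, map_mul, map_intCast]
  linear_combination ((z : ℂ) - conj (w : ℂ)) * hdet

lemma norm_lt_two_pi {n : ℤ} (h : |2 * Real.pi * n| < 2 * Real.pi) : n = 0 := by
  rw [abs_mul, abs_of_pos Real.two_pi_pos] at h
  have h1 : |(n : ℝ)| < 1 := by
    have := Real.two_pi_pos
    nlinarith
  exact Int.abs_lt_one_iff.mp (by exact_mod_cast h1)

/-- Complex powers are multiplicative if the arguments add up without a jump. -/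
lemma cpow_mul_of_arg_lt {a b : ℂ} (ha : a ≠ 0) (hb : b ≠ 0)
    (h : |a.arg + b.arg - (a * b).arg| < 2 * Real.pi) (t : ℂ) : (a * b) ^ t = a ^ t * b ^ t := by
  have hab := mul_ne_zero ha hb
  have hlog : Complex.log (a * b) = Complex.log a + Complex.log b := by
    have h1 : cexp (Complex.log a + Complex.log b) = cexp (Complex.log (a * b)) := by
      rw [Complex.exp_add, Complex.exp_log ha, Complex.exp_log hb, Complex.exp_log hab]
    obtain ⟨n, hn⟩ := Complex.exp_eq_exp_iff_exists_int.mp h1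
    have h2 := congrArg Complex.im hn
    simp only [Complex.add_im, Complex.log_im] at h2
    have h3 : ((n : ℂ) * (2 * Real.pi * Complex.I)).im = 2 * Real.pi * n := by
      simp; ring
    rw [h3] at h2
    have h4 : n = 0 := by
      apply norm_lt_two_pi
      rwa [show 2 * Real.pi * n = a.arg + b.arg - (a * b).arg by linarith]
    rw [h4] at hn
    simpa using hn.symm
  rw [Complex.cpow_def_of_ne_zero hab, Complex.cpow_def_of_ne_zero ha,
    Complex.cpow_def_of_ne_zero hb, hlog, add_mul, Complex.exp_add]

lemma arg_conj_of_im_pos {a : ℂ} (ha : 0 < a.im) : (conj a).arg = -a.arg := by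
  rw [Complex.arg_conj, if_neg]
  intro h
  have := Complex.arg_eq_pi_iff.mp h
  linarith [this.2]

lemma arg_mem_of_im_pos {a : ℂ} (ha : 0 < a.im) : 0 < a.arg ∧ a.arg < Real.pi := by
  have h0 : a.arg ≠ 0 := by
    intro h
    have := Complex.arg_eq_zero_iff.mp h
    linarith [this.2]
  have h1 := Complex.arg_nonneg_iff.mpr ha.le
  refine ⟨lt_of_le_of_ne h1 (Ne.symm h0), lt_of_le_of_ne (Complex.arg_le_pi a) ?_⟩
  intro h
  have := Complex.arg_eq_pi_iff.mp h
  linarith [this.2]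

lemma conj_cpow_of_im_pos {a : ℂ} (ha : 0 < a.im) (t : ℝ) :
    conj (a ^ (t : ℂ)) = conj a ^ (t : ℂ) := by
  have := Complex.conj_cpow a (t : ℂ) (arg_mem_of_im_pos ha).2.ne
  rw [this, Complex.conj_ofReal]

lemma mul_conj_cpow {a : ℂ} (ha : 0 < a.im) (t : ℂ) :
    (a * conj a) ^ t = a ^ t * conj a ^ t := by
  have h0 : a ≠ 0 := by rintro rfl; simp at ha
  refine cpow_mul_of_arg_lt h0 ((map_ne_zero _).mpr h0) ?_ t
  have : (a * conj a).arg = 0 := by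
    rw [Complex.mul_conj]
    exact Complex.arg_ofReal_of_nonneg (Complex.normSq_nonneg a)
  rw [arg_conj_of_im_pos ha, this]
  simp [Real.pi_pos]

/-- The comparison of powers in the transformation of the kernel. -/
lemma kernel_cpow {p' a b : ℂ} (hp' : 0 < p'.re) (ha : 0 < a.im) (hb : 0 < b.im)
    (hp : 0 < (p' * (a * conj b)).re) (t : ℂ) :
    (p' * (a * conj b)) ^ t = p' ^ t * a ^ t * conj b ^ t := by
  have ha0 : a ≠ 0 := by rintro rfl; simp at ha
  have hb0 : conj b ≠ 0 := by
    rw [map_ne_zero]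
    rintro rfl; simp at hb
  have hpi := Real.pi_pos
  have e1 := arg_mem_of_im_pos ha
  have e2 := arg_mem_of_im_pos hb
  have e3 := abs_lt.mp (Complex.abs_arg_lt_pi_div_two_iff.mpr (Or.inl hp'))
  have e4 := abs_lt.mp (Complex.abs_arg_lt_pi_div_two_iff.mpr (Or.inl hp))
  have hab : (a * conj b).arg = a.arg + (conj b).arg := by
    apply Complex.arg_mul ha0 hb0
    rw [arg_conj_of_im_pos hb]
    constructor <;> linarith
  have hab' : (a * conj b) ^ t = a ^ t * conj b ^ t := by
    refine cpow_mul_of_arg_lt ha0 hb0 ?_ t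
    rw [hab, sub_self, abs_zero]
    linarith
  rw [cpow_mul_of_arg_lt (ne_zero_of_re_pos hp') (mul_ne_zero ha0 hb0) ?_ t, hab', mul_assoc]
  -- The arguments of `p'`, `a b̄` and the whole product are less than `π/2`, `π` and `π/2` in
  -- absolute value, so they cannot differ by a full turn.
  rw [hab, arg_conj_of_im_pos hb, abs_lt]
  constructor <;> linarith

/-! ### Transformation of `∂/∂z̄` and of `ξ` under the group -/

section

variable {s : ℝ} {g : ℍ → ℂ} {γ : SL(2, ℤ)} {u : ℂ}

lemma autFactor_ofComplex (γ : SL(2, ℤ)) {w : ℂ} (hw : 0 < w.im) :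
    autFactor γ (ofComplex w) = (γ 1 0 : ℂ) * w + γ 1 1 := by
  rw [autFactor, coe_ofComplex hw]

lemma fderiv_apply_eq (L : ℂ →L[ℝ] ℂ) (v : ℂ) : L v = v.re * L 1 + v.im * L Complex.I := by
  conv_lhs => rw [← Complex.re_add_im v]
  rw [map_add]
  have h1 : L (v.re : ℂ) = v.re * L 1 := by
    have := L.map_smul v.re 1
    simpa using this
  have h2 : L (v.im * Complex.I) = v.im * L Complex.I := by
    have := L.map_smul v.im Complex.I
    simpa using this
  rw [h1, h2]

/-- Apply `∂/∂z̄` to `g(γz) = u j^{1-s} g(z)`. The factor `j^{1-s}` is holomorphic and passes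
through, while the chain rule on the left produces the conjugate of the derivative `j^{-2}` of `γ`.
-/
lemma dBar_smul (hG : ContDiffOn ℝ ∞ (ext g) {z : ℂ | 0 < z.im}) (hc : 0 < γ 1 0)
    (hg : ∀ z, g (γ • z) = u * autFactor γ z ^ (1 - s : ℂ) * g z) (z : ℍ) :
    dBar g (γ • z) = u * autFactor γ z ^ (1 - s : ℂ) * conj (autFactor γ z) ^ 2 * dBar g z := by
  set ζ := autFactor γ z with hζ
  have hζ0 : ζ ≠ 0 := autFactor_ne_zero γ z
  have hζim : 0 < ζ.im := autFactor_im_pos hc z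
  set L := fderiv ℝ (ext g) ((γ • z : ℍ) : ℂ)
  set M := fderiv ℝ (ext g) (z : ℂ)
  have hL : HasFDerivAt (ext g) L (mob γ z) := by
    rw [mob_coe]
    exact (differentiableAt_of_smooth hG (γ • z).im_pos).hasFDerivAt
  have hM : HasFDerivAt (ext g) M (z : ℂ) := (differentiableAt_of_smooth hG z.im_pos).hasFDerivAt
  have h1 : HasFDerivAt (fun w => ext g (mob γ w)) _ (z : ℂ) :=
    hL.comp (z : ℂ) ((hasDerivAt_mob γ z).hasFDerivAt.restrictScalars ℝ)
  have hlin : HasDerivAt (fun w : ℂ => (γ 1 0 : ℂ) * w + γ 1 1) (γ 1 0) (z : ℂ) := by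
    simpa using ((hasDerivAt_id (z : ℂ)).const_mul (γ 1 0 : ℂ)).add_const (γ 1 1 : ℂ)
  have hJ := (hlin.cpow_const (c := (1 - s : ℂ)) (Or.inr hζim.ne')).const_mul u
  have h2 := (hJ.hasFDerivAt.restrictScalars ℝ).mul hM
  have heq : (fun w => ext g (mob γ w)) =ᶠ[𝓝 (z : ℂ)]
      (fun w : ℂ => u * ((γ 1 0 : ℂ) * w + γ 1 1) ^ (1 - s : ℂ)) * ext g := by
    filter_upwards [isOpen_im_pos.mem_nhds z.im_pos] with w hw
    have h := hg (ofComplex w)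
    rw [autFactor_ofComplex γ hw] at h
    rw [Pi.mul_apply, ext, ext, ← h]
    congr 1
    rw [← ofComplex_apply (γ • ofComplex w), ← mob_coe, coe_ofComplex hw]
  have h3 := (h2.congr_of_eventuallyEq heq).unique h1
  have e1 := congrArg (fun T : ℂ →L[ℝ] ℂ => T 1) h3
  have e2 := congrArg (fun T : ℂ →L[ℝ] ℂ => T Complex.I) h3
  simp at e1 e2
  rw [← hζ] at e1 e2
  set v : ℂ := (ζ ^ 2)⁻¹ with hv
  have hzeta : (γ 1 0 : ℂ) * z + γ 1 1 = ζ := rfl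
  rw [hzeta, fderiv_apply_eq L v] at e1
  rw [hzeta, fderiv_apply_eq L (Complex.I * v)] at e2
  have hre : (Complex.I * v).re = -v.im := by simp
  have him : (Complex.I * v).im = v.re := by simp
  rw [hre, him] at e2
  have hcv : (v.re : ℂ) - v.im * Complex.I = conj v := by
    apply Complex.ext <;> simp
  have hcv2 : conj v * conj ζ ^ 2 = 1 := by
    rw [hv, map_inv₀, map_pow, inv_mul_cancel₀]
    exact pow_ne_zero 2 ((map_ne_zero _).mpr hζ0)
  -- In `e1 + i e2` the two terms with the derivative of `j^{1-s}` cancel because `i² = -1`: these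
  -- are the Cauchy-Riemann equations for the automorphy factor.
  have key : (L 1 + Complex.I * L Complex.I) * conj v
      = u * ζ ^ (1 - s : ℂ) * (M 1 + Complex.I * M Complex.I) := by
    rw [← hcv]
    push_cast at e1 e2
    linear_combination -e1 - Complex.I * e2 + (ext g z * (u * ((1 - s) * ζ ^ (-s : ℂ) * γ 1 0))
      - v.im * L Complex.I) * Complex.I_sq
  rw [dBar_eq, dBar_eq]
  change (L 1 + Complex.I * L Complex.I) / 2
    = u * ζ ^ (1 - s : ℂ) * conj ζ ^ 2 * ((M 1 + Complex.I * M Complex.I) / 2)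
  linear_combination (conj ζ ^ 2 / 2) * key - (L 1 + Complex.I * L Complex.I) / 2 * hcv2

lemma im_smul_cpow (hc : 0 < γ 1 0) (z : ℍ) (t : ℂ) :
    ((γ • z).im : ℂ) ^ t * (autFactor γ z ^ t * conj (autFactor γ z) ^ t) = (z.im : ℂ) ^ t := by
  have him := autFactor_im_pos hc z
  have h1 : (z.im : ℂ) = (((γ • z).im : ℝ) : ℂ) * ((Complex.normSq (autFactor γ z) : ℝ) : ℂ) := by
    rw [ModularGroup.im_smul_eq_div_normSq, ModularGroup.denom_apply]
    have h0 : Complex.normSq (autFactor γ z) ≠ 0 := by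
      rw [Ne, Complex.normSq_eq_zero]; exact autFactor_ne_zero γ z
    have h2 : ((γ 1 0 : ℂ) * z + γ 1 1) = autFactor γ z := rfl
    rw [h2, ← Complex.ofReal_mul, div_mul_cancel₀ _ h0]
  rw [h1, Complex.mul_cpow_ofReal_nonneg (γ • z).im_pos.le (Complex.normSq_nonneg _),
    ← mul_conj_cpow him, Complex.mul_conj]

/-- From `Im γz = y / (j j̄)` the power `y^{1-s}` loses `(j j̄)^{1-s}`, and the conjugated `∂g/∂z̄`
gains `j̄^{1-s} j²`. The powers of `j̄` cancel and `j^{s+1}` remains. -/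
lemma xi_smul (hG : ContDiffOn ℝ ∞ (ext g) {z : ℂ | 0 < z.im}) (hc : 0 < γ 1 0)
    (hg : ∀ z, g (γ • z) = u * autFactor γ z ^ (1 - s : ℂ) * g z) (z : ℍ) :
    xi (1 - s) g (γ • z) = conj u * autFactor γ z ^ (s + 1 : ℂ) * xi (1 - s) g z := by
  have him := autFactor_im_pos hc z
  have h1 := im_smul_cpow hc z (1 - s : ℂ)
  set ζ := autFactor γ z with hζ
  have hζ0 : ζ ≠ 0 := autFactor_ne_zero γ z
  have hconj : conj (ζ ^ (1 - s : ℂ)) = conj ζ ^ (1 - s : ℂ) := by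
    have := conj_cpow_of_im_pos him (1 - s)
    push_cast at this
    exact this
  have hpow : ζ ^ (s + 1 : ℂ) * ζ ^ (1 - s : ℂ) = ζ ^ 2 := by
    rw [← Complex.cpow_add _ _ hζ0, ← Complex.cpow_natCast]
    congr 1
    push_cast; ring
  rw [xi, xi, dBar_smul hG hc hg, ← hζ, map_mul, map_mul, map_mul, hconj, map_pow,
    Complex.conj_conj, ← h1]
  linear_combination (-(2 * Complex.I * ((γ • z).im : ℂ) ^ (1 - s : ℂ) * conj u
    * conj ζ ^ (1 - s : ℂ) * conj (dBar g z))) * hpow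

end

/-! ### The invariance of the period function -/

/-- The kernel variable `-i (z - w̄)`. -/
def kvar (z w : ℂ) : ℂ := -Complex.I * (z - conj w)

lemma kvar_re (z w : ℂ) : (kvar z w).re = z.im + w.im := by
  simp [kvar]

lemma kvar_self (z : ℍ) : kvar z z = ((2 * z.im : ℝ) : ℂ) := by
  rw [kvar, Complex.sub_conj]
  push_cast
  rw [UpperHalfPlane.coe_im]
  linear_combination (-(2 * z.im : ℂ)) * Complex.I_sq

lemma conj_add_kvar (z w : ℂ) : conj z + Complex.I * conj (kvar z w) = w := by
  simp only [kvar, map_mul, map_neg, Complex.conj_I, map_sub, Complex.conj_conj]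
  linear_combination (w - conj z) * (-Complex.I_sq)

section Period

variable {ε : ℤˣ} {s : ℝ} {g gp gm : ℍ → ℂ} {ap am : ℤ → ℂ} {γ : SL(2, ℤ)} {u : ℂ}

lemma kvar_smul (γ : SL(2, ℤ)) (z w : ℍ) :
    kvar ((γ • z : ℍ) : ℂ) ((γ • w : ℍ) : ℂ) * (autFactor γ z * conj (autFactor γ w)) = kvar z w := by
  have h1 := autFactor_ne_zero γ z
  have h2 := (map_ne_zero (starRingEnd ℂ)).mpr (autFactor_ne_zero γ w)
  rw [kvar, kvar, coe_smul_sub_conj]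
  field_simp

lemma hasDerivAt_eichler_comp (hG : ContDiffOn ℝ ∞ (ext g) {z : ℂ | 0 < z.im})
    (hdec : IsMaassDecomposition ε (1 - s) g gp gm ap am) (hs : s ≠ 0) (z : ℍ) {w : ℝ → ℂ} {w' : ℂ}
    {t : ℝ} (hw : 0 < (w t).im) (hd : HasDerivAt w w' t) :
    HasDerivAt (fun t => eichler ε s am z (kvar z (w t)))
      ((2 : ℂ) ^ (-s : ℂ) * kvar z (w t) ^ (s - 1 : ℂ) * conj (xi (1 - s) g (ofComplex (w t))) *
        (Complex.I * conj w')) t := by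
  have hp : z.im < (kvar z (w t)).re := by
    rw [kvar_re, UpperHalfPlane.coe_im]
    linarith
  have h1 := hasDerivAt_eichler hG hdec hs z hp
  rw [conj_add_kvar] at h1
  have h2 : HasDerivAt (fun t => kvar z (w t)) (Complex.I * conj w') t := by
    have h3 : HasDerivAt (fun t => conj (w t)) (conj w') t :=
      Complex.conjCLE.hasFDerivAt.comp_hasDerivAt t hd
    simpa [kvar] using (h3.const_sub (z : ℂ)).const_mul (-Complex.I)
  exact h1.comp t h2

/-- The period function does not depend on the base point of the Eichler integrals. -/
lemma period_eq (hG : ContDiffOn ℝ ∞ (ext g) {z : ℂ | 0 < z.im})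
    (hdec : IsMaassDecomposition ε (1 - s) g gp gm ap am) (hs : s ≠ 0) (hc : 0 < γ 1 0)
    (hg : ∀ z, g (γ • z) = u * autFactor γ z ^ (1 - s : ℂ) * g z) (z w : ℍ) :
    u * autFactor γ z ^ (1 - s : ℂ) * eichler ε s am z (kvar z w)
        - eichler ε s am (γ • z : ℍ) (kvar (γ • z : ℍ) (γ • w : ℍ))
      = u * autFactor γ z ^ (1 - s : ℂ) * gm z - gm (γ • z) := by
  -- The end point moves along the segment from `z` to `w`, and the difference `U` of the two
  -- integrals turns out to be constant. At the start both have `p` equal to twice the imaginary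
  -- part, where they are the nonholomorphic parts.
  set W : ℝ → ℂ := fun t => z + t * ((w : ℂ) - z) with hW
  have hWd : ∀ t, HasDerivAt W ((w : ℂ) - z) t := fun t => by
    have := ((Complex.ofRealCLM.hasDerivAt (x := t)).mul_const ((w : ℂ) - z)).const_add (z : ℂ)
    simpa [hW] using this
  have hWim : ∀ t ∈ Set.Icc (0 : ℝ) 1, 0 < (W t).im := by
    intro t ht
    have : (W t).im = (1 - t) * z.im + t * w.im := by
      simp [hW]; ring
    rw [this]
    have h1 := z.im_pos
    have h2 := w.im_pos
    rcases eq_or_lt_of_le ht.1 with h | h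
    · rw [← h]; simpa using h1
    · have := mul_nonneg (sub_nonneg.mpr ht.2) h1.le
      have := mul_pos h h2
      linarith
  set U : ℝ → ℂ := fun t => u * autFactor γ z ^ (1 - s : ℂ) * eichler ε s am z (kvar z (W t))
        - eichler ε s am (γ • z : ℍ) (kvar (γ • z : ℍ) (mob γ (W t))) with hU
  have hderiv : ∀ t ∈ Set.Icc (0 : ℝ) 1, HasDerivAt U 0 t := by
    intro t ht
    have him := hWim t ht
    set v : ℍ := ofComplex (W t) with hv
    have hvc : (v : ℂ) = W t := coe_ofComplex him
    have hmobd : HasDerivAt (fun t => mob γ (W t)) ((autFactor γ v ^ 2)⁻¹ * ((w : ℂ) - z)) t := by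
      have := hasDerivAt_mob γ v
      rw [hvc] at this
      exact this.comp t (hWd t)
    have hmob : mob γ (W t) = ((γ • v : ℍ) : ℂ) := by rw [← mob_coe, hvc]
    have h1 := (hasDerivAt_eichler_comp hG hdec hs z him (hWd t)).const_mul
      (u * autFactor γ z ^ (1 - s : ℂ))
    have h2 := hasDerivAt_eichler_comp hG hdec hs (γ • z)
      (by rw [hmob]; exact (γ • v).im_pos) hmobd
    refine (h1.sub h2).congr_deriv ?_
    rw [hmob, ofComplex_apply, ← hv, ← hvc, xi_smul hG hc hg]
    have hz := autFactor_im_pos hc z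
    have hvim := autFactor_im_pos hc v
    have hk := kvar_smul γ z v
    have hre1 : 0 < (kvar ((γ • z : ℍ) : ℂ) ((γ • v : ℍ) : ℂ)).re := by
      rw [kvar_re]; exact add_pos (γ • z).im_pos (γ • v).im_pos
    have hre2 : 0 < (kvar z v).re := by
      rw [kvar_re]; exact add_pos z.im_pos v.im_pos
    have hpow := kernel_cpow hre1 hz hvim (by rw [hk]; exact hre2) (s - 1 : ℂ)
    rw [hk] at hpow
    have hz0 := autFactor_ne_zero γ z
    have hv0 := (map_ne_zero (starRingEnd ℂ)).mpr (autFactor_ne_zero γ v)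
    have hzp : autFactor γ z ^ (1 - s : ℂ) * autFactor γ z ^ (s - 1 : ℂ) = 1 := by
      rw [← Complex.cpow_add _ _ hz0]; ring_nf; simp
    -- The conjugated `ξ g` gives `j̄^{s+1}` and the derivative of `γ` gives `j̄^{-2}`; together
    -- they match `j̄^{s-1}` from the kernel.
    have hvp : conj (autFactor γ v) ^ (s + 1 : ℂ) * (conj (autFactor γ v) ^ 2)⁻¹
        = conj (autFactor γ v) ^ (s - 1 : ℂ) := by
      have : (s + 1 : ℂ) = (s - 1) + (2 : ℕ) := by push_cast; ring
      rw [this, Complex.cpow_add _ _ hv0, Complex.cpow_natCast, mul_assoc,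
        mul_inv_cancel₀ (pow_ne_zero 2 hv0), mul_one]
    have hconj : conj (autFactor γ v ^ (s + 1 : ℂ)) = conj (autFactor γ v) ^ (s + 1 : ℂ) := by
      have := conj_cpow_of_im_pos hvim (s + 1)
      push_cast at this
      exact this
    simp only [map_mul, map_inv₀, map_pow, Complex.conj_conj, hconj]
    rw [hpow]
    linear_combination (u * (2 : ℂ) ^ (-s : ℂ) *
      kvar ((γ • z : ℍ) : ℂ) ((γ • v : ℍ) : ℂ) ^ (s - 1 : ℂ) * conj (xi (1 - s) g v) * Complex.I *
      conj ((w : ℂ) - z)) * (conj (autFactor γ v) ^ (s - 1 : ℂ) * hzp - hvp)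
  have hconst := constant_of_has_deriv_right_zero (f := U) (a := 0) (b := 1)
    (fun t ht => (hderiv t ht).continuousAt.continuousWithinAt)
    (fun t ht => (hderiv t ⟨ht.1, ht.2.le⟩).hasDerivWithinAt) 1 ⟨zero_le_one, le_rfl⟩
  have h0 : W 0 = z := by simp [hW]
  have h1 : W 1 = w := by simp [hW]
  simp only [hU, h0, h1, mob_coe, kvar_self, eichler_two_im hdec hs] at hconst
  exact hconst

/-- The transformation behaviour of the holomorphic part. -/
lemma holomorphicPart_smul (hG : ContDiffOn ℝ ∞ (ext g) {z : ℂ | 0 < z.im})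
    (hdec : IsMaassDecomposition ε (1 - s) g gp gm ap am) (hs : s ≠ 0) (hc : 0 < γ 1 0)
    (hg : ∀ z, g (γ • z) = u * autFactor γ z ^ (1 - s : ℂ) * g z) (z w : ℍ) :
    gp (γ • z) = u * autFactor γ z ^ (1 - s : ℂ) * gp z
      + u * autFactor γ z ^ (1 - s : ℂ) * eichler ε s am z (kvar z w)
      - eichler ε s am (γ • z : ℍ) (kvar (γ • z : ℍ) (γ • w : ℍ)) := by
  have h1 := period_eq hG hdec hs hc hg z w
  have h2 := hg z
  rw [hdec.add_eq, hdec.add_eq] at h2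
  linear_combination h2 - h1

end Period

/-! ### Asymptotics of the incomplete gamma function on the right half plane -/

/-- Integrating the bound gives `M (1 - e^{-T}) ≤ M`. The point is uniformity in `T`, which allows
remainders to be followed along arbitrarily long segments. -/
lemma norm_sub_le_of_norm_deriv_le_exp {f f' : ℝ → ℂ} {M T : ℝ} (hT : 0 ≤ T)
    (hf : ∀ t ∈ Set.Icc 0 T, HasDerivAt f (f' t) t)
    (hb : ∀ t ∈ Set.Icc 0 T, ‖f' t‖ ≤ M * Real.exp (-t)) : ‖f T - f 0‖ ≤ M := by
  have hM : 0 ≤ M := by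
    have := (norm_nonneg _).trans (hb 0 ⟨le_rfl, hT⟩)
    simpa using this
  have hB : ∀ t : ℝ, HasDerivAt (fun t : ℝ => M * (1 - Real.exp (-t))) (M * Real.exp (-t)) t := by
    intro t
    have h := (((hasDerivAt_id t).fun_neg.exp).const_sub 1).const_mul M
    refine h.congr_deriv ?_
    simp
  have h := image_norm_le_of_norm_deriv_right_le_deriv_boundary (f := fun t => f t - f 0)
    (f' := f') (a := 0) (b := T) (B := fun t : ℝ => M * (1 - Real.exp (-t)))
    (B' := fun t => M * Real.exp (-t))
    (fun t ht => ((hf t ht).sub_const _).continuousAt.continuousWithinAt)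
    (fun t ht => ((hf t ⟨ht.1, ht.2.le⟩).sub_const _).hasDerivWithinAt)
    (by simp) hB (fun t ht => hb t ⟨ht.1, ht.2.le⟩) (x := T) ⟨hT, le_rfl⟩
  refine h.trans ?_
  have := Real.exp_pos (-T)
  nlinarith

/-- The leading term of `gammaExt`. -/
def gammaLead (s : ℝ) (n : ℤ) (p : ℂ) : ℂ :=
  (2 : ℂ) ^ (-s : ℂ) * cexp (-(2 * Real.pi * n * p)) * p ^ (s - 1 : ℂ) / (2 * Real.pi * n)

/-- The remainder term of `gammaExt`. -/
def gammaRem (ε : ℤˣ) (s : ℝ) (n : ℤ) (p : ℂ) : ℂ := gammaExt ε s n p - gammaLead s n p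

lemma norm_two_cpow (s : ℝ) : ‖(2 : ℂ) ^ (-s : ℂ)‖ = 2 ^ (-s) := by
  have := two_cpow_eq (-s)
  push_cast at this
  rw [this, Complex.norm_real, Real.norm_of_nonneg (by positivity)]

lemma norm_cexp_two_pi_mul (n : ℤ) (p : ℂ) :
    ‖cexp (-(2 * Real.pi * n * p))‖ = Real.exp (-(2 * Real.pi * n * p.re)) := by
  rw [Complex.norm_exp]
  congr 1
  have : -(2 * Real.pi * n * p) = ((-(2 * Real.pi * n) : ℝ) : ℂ) * p := by push_cast; ring
  rw [this, Complex.re_ofReal_mul]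
  ring

lemma one_le_abs_cast {n : ℤ} (hn : n ≠ 0) : (1 : ℝ) ≤ |(n : ℝ)| := by
  exact_mod_cast Int.one_le_abs hn

lemma norm_two_pi_mul (n : ℤ) : ‖(2 * Real.pi * n : ℂ)‖ = 2 * Real.pi * |(n : ℝ)| := by
  have : (2 * Real.pi * n : ℂ) = ((2 * Real.pi * n : ℝ) : ℂ) := by push_cast; ring
  rw [this, Complex.norm_real, Real.norm_eq_abs, abs_mul, abs_of_pos Real.two_pi_pos]

lemma one_le_norm_two_pi_mul {n : ℤ} (hn : n ≠ 0) : 1 ≤ ‖(2 * Real.pi * n : ℂ)‖ := by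
  rw [norm_two_pi_mul]
  have := one_le_abs_cast hn
  have := Real.pi_gt_three
  nlinarith

lemma norm_gammaLead_le {s : ℝ} {n : ℤ} (hn : n ≠ 0) {p : ℂ} (hp : 0 < p.re) :
    ‖gammaLead s n p‖ ≤ 2 ^ (-s) * Real.exp (-(2 * Real.pi * n * p.re)) * ‖p‖ ^ (s - 1) := by
  have h2 := norm_cpow_of_re_pos hp (s - 1)
  push_cast at h2
  rw [gammaLead, norm_div, norm_mul, norm_mul, norm_two_cpow, norm_cexp_two_pi_mul, h2]
  exact div_le_self (by positivity) (one_le_norm_two_pi_mul hn)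

/-- Subtracting one step of integration by parts cancels the main term of the derivative. The
exponent drops from `s - 1` to `s - 2`, and this gains the factor `1/‖p‖` in the asymptotics. -/
lemma hasDerivAt_gammaRem (ε : ℤˣ) (s : ℝ) {n : ℤ} (hn : n ≠ 0) {p : ℂ} (hp : 0 < p.re) :
    HasDerivAt (gammaRem ε s n) (-((2 : ℂ) ^ (-s : ℂ) * (s - 1) *
      cexp (-(2 * Real.pi * n * p)) * p ^ (s - 2 : ℂ) / (2 * Real.pi * n))) p := by
  have hn0 : (2 * Real.pi * n : ℂ) ≠ 0 := by simp [Real.pi_ne_zero, hn]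
  have h1 : HasDerivAt (fun p : ℂ => p ^ (s - 1 : ℂ)) ((s - 1) * p ^ (s - 2 : ℂ)) p := by
    have := (hasDerivAt_id p).cpow_const (c := (s - 1 : ℂ)) (mem_slitPlane_of_re_pos hp)
    refine this.congr_deriv ?_
    simp only [id, mul_one]
    ring_nf
  have h2 : HasDerivAt (fun p : ℂ => cexp (-(2 * Real.pi * n * p)))
      (cexp (-(2 * Real.pi * n * p)) * (-(2 * Real.pi * n))) p := by
    have : HasDerivAt (fun p : ℂ => -(2 * Real.pi * n * p)) (-(2 * Real.pi * n)) p := by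
      simpa using ((hasDerivAt_id p).const_mul (2 * Real.pi * n : ℂ)).fun_neg
    exact this.cexp
  have h3 := (hasDerivAt_gammaExt ε s n hp).sub
    (((h2.const_mul ((2 : ℂ) ^ (-s : ℂ))).mul h1).div_const (2 * Real.pi * n : ℂ))
  refine h3.congr_deriv ?_
  rw [periodIntegrand]
  field_simp
  ring

lemma norm_deriv_gammaRem_le {s : ℝ} {n : ℤ} (hn : n ≠ 0) {p : ℂ} (hp : 0 < p.re) :
    ‖-((2 : ℂ) ^ (-s : ℂ) * (s - 1) * cexp (-(2 * Real.pi * n * p)) * p ^ (s - 2 : ℂ)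
      / (2 * Real.pi * n))‖ ≤
      2 ^ (-s) * |s - 1| * Real.exp (-(2 * Real.pi * n * p.re)) * ‖p‖ ^ (s - 2) := by
  have h2 := norm_cpow_of_re_pos hp (s - 2)
  push_cast at h2
  have h3 : ‖(s - 1 : ℂ)‖ = |s - 1| := by
    rw [← Real.norm_eq_abs, ← Complex.norm_real]; push_cast; rfl
  rw [norm_neg, norm_div, norm_mul, norm_mul, norm_mul, norm_two_cpow, norm_cexp_two_pi_mul, h2, h3]
  exact div_le_self (by positivity) (one_le_norm_two_pi_mul hn)

/-- Both ratios of the norms are at most `1 + t`, so for either sign of `e` the change of the power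
is at most polynomial in `t` and is absorbed by `e^t`. -/
lemma exists_rpow_le_mul_exp (e : ℝ) : ∃ K : ℝ, 0 < K ∧ ∀ {p q : ℂ} {t : ℝ}, 0 ≤ t →
    1 ≤ ‖p‖ → 1 ≤ ‖q‖ → ‖q - p‖ ≤ t → ‖q‖ ^ e ≤ K * ‖p‖ ^ e * Real.exp t := by
  obtain ⟨C, hC, hCle⟩ := exists_rpow_le_exp |e|
  refine ⟨C * Real.exp 1, by positivity, fun {p q t} ht hp hq hpq => ?_⟩
  have hp0 : 0 < ‖p‖ := by linarith
  have hq0 : 0 < ‖q‖ := by linarith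
  have h1 : (‖q‖ / ‖p‖) ^ e ≤ (1 + t) ^ |e| := by
    have hqp : ‖q‖ / ‖p‖ ≤ 1 + t := by
      rw [div_le_iff₀ hp0]
      have := norm_le_norm_add_norm_sub' q p
      nlinarith
    have hpq' : (‖q‖ / ‖p‖)⁻¹ ≤ 1 + t := by
      rw [inv_div, div_le_iff₀ hq0]
      have := norm_le_norm_add_norm_sub' p q
      rw [norm_sub_rev] at this
      nlinarith
    have hpos : 0 < ‖q‖ / ‖p‖ := by positivity
    rcases le_total 0 e with he | he
    · rw [abs_of_nonneg he]
      exact Real.rpow_le_rpow hpos.le hqp he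
    · rw [abs_of_nonpos he, ← inv_inv (‖q‖ / ‖p‖), Real.inv_rpow (by positivity),
        ← Real.rpow_neg (by positivity)]
      exact Real.rpow_le_rpow (by positivity) hpq' (by linarith)
  rw [Real.div_rpow hq0.le hp0.le, div_le_iff₀ (by positivity)] at h1
  have h2 := hCle (1 + t) (by linarith)
  rw [Real.exp_add] at h2
  calc ‖q‖ ^ e ≤ (1 + t) ^ |e| * ‖p‖ ^ e := h1
    _ ≤ C * (Real.exp 1 * Real.exp t) * ‖p‖ ^ e := by gcongr
    _ = _ := by ring

/-- The remainder term along a horizontal segment. -/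
lemma exists_gammaRem_sub_le (ε : ℤˣ) (s : ℝ) : ∃ K : ℝ, 0 < K ∧ ∀ (n : ℤ), n ≠ 0 →
    ∀ (p : ℂ) (T : ℝ), 0 ≤ T → 1 ≤ p.re → 1 ≤ p.re + n.sign * T →
    ‖gammaRem ε s n (p + (n.sign : ℂ) * T) - gammaRem ε s n p‖
      ≤ K * Real.exp (-(2 * Real.pi * n * p.re)) * ‖p‖ ^ (s - 2) := by
  obtain ⟨K₁, hK₁, hK⟩ := exists_rpow_le_mul_exp (s - 2)
  refine ⟨2 ^ (-s) * (|s - 1| + 1) * K₁, by positivity, fun n hn p T hT hp hpT => ?_⟩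
  have hre : ∀ t : ℝ, (p + (n.sign : ℂ) * t).re = p.re + n.sign * t := fun t => by
    simp
  have hge : ∀ t ∈ Set.Icc 0 T, 1 ≤ (p + (n.sign : ℂ) * t).re := by
    intro t ht
    rw [hre]
    rcases lt_or_gt_of_ne hn with h | h
    · rw [Int.sign_eq_neg_one_of_neg h] at hpT ⊢
      push_cast at hpT ⊢
      linarith [ht.2]
    · rw [Int.sign_eq_one_of_pos h]
      push_cast
      linarith [ht.1]
  have hlin : ∀ t : ℝ, HasDerivAt (fun t : ℝ => p + (n.sign : ℂ) * t) (n.sign : ℂ) t := fun t => by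
    have := ((Complex.ofRealCLM.hasDerivAt (x := t)).const_mul (n.sign : ℂ)).const_add p
    simpa using this
  have hsign : ‖(n.sign : ℂ)‖ = 1 := by
    rcases lt_or_gt_of_ne hn with h | h
    · rw [Int.sign_eq_neg_one_of_neg h]; simp
    · rw [Int.sign_eq_one_of_pos h]; simp
  have h := norm_sub_le_of_norm_deriv_le_exp
    (f := fun t : ℝ => gammaRem ε s n (p + (n.sign : ℂ) * t))
    (M := 2 ^ (-s) * (|s - 1| + 1) * K₁ * Real.exp (-(2 * Real.pi * n * p.re)) * ‖p‖ ^ (s - 2)) hT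
    (fun t ht => (hasDerivAt_gammaRem ε s hn (by linarith [hge t ht])).comp t (hlin t))
    (fun t ht => ?_)
  · simpa using h
  · have hq := hge t ht
    rw [norm_mul, hsign, mul_one]
    refine (norm_deriv_gammaRem_le hn (by linarith)).trans ?_
    have h1 : ‖p + (n.sign : ℂ) * t‖ ^ (s - 2) ≤ K₁ * ‖p‖ ^ (s - 2) * Real.exp t := by
      refine hK ht.1 (hp.trans (Complex.re_le_norm p)) (hq.trans (Complex.re_le_norm _)) ?_
      rw [add_sub_cancel_left, norm_mul, hsign, one_mul, Complex.norm_real,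
        Real.norm_of_nonneg ht.1]
    have h2 : Real.exp (-(2 * Real.pi * n * (p + (n.sign : ℂ) * t).re))
        ≤ Real.exp (-(2 * Real.pi * n * p.re)) * Real.exp (-(2 * t)) := by
      rw [← Real.exp_add]
      apply Real.exp_le_exp.mpr
      rw [hre]
      have h3 : (n : ℝ) * n.sign = |(n : ℝ)| := by
        exact_mod_cast Int.mul_sign_self n
      have h4 := one_le_abs_cast hn
      have h5 : 2 * Real.pi * n * (p.re + n.sign * t)
          = 2 * Real.pi * n * p.re + 2 * Real.pi * (n * n.sign) * t := by ring
      rw [h5, h3]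
      -- The segment runs in the direction in which `e^{-2πnp}` decays. Of the rate `2π|n| ≥ 2`, one
      -- unit pays for the growth of the power and the other leaves `e^{-t}`.
      have h6 : 2 * t ≤ 2 * Real.pi * |(n : ℝ)| * t := by
        apply mul_le_mul_of_nonneg_right _ ht.1
        have := Real.pi_gt_three
        nlinarith
      linarith
    have h7 : Real.exp (-(2 * t)) * Real.exp t = Real.exp (-t) := by
      rw [← Real.exp_add]; ring_nf
    calc _ ≤ 2 ^ (-s) * (|s - 1| + 1) *
          (Real.exp (-(2 * Real.pi * n * p.re)) * Real.exp (-(2 * t))) *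
          (K₁ * ‖p‖ ^ (s - 2) * Real.exp t) := by
          gcongr
          linarith
      _ = 2 ^ (-s) * (|s - 1| + 1) * K₁ * Real.exp (-(2 * Real.pi * n * p.re)) * ‖p‖ ^ (s - 2) *
          (Real.exp (-(2 * t)) * Real.exp t) := by ring
      _ = _ := by rw [h7]

/-- The variation of `gammaExt` along a vertical segment. -/
lemma norm_gammaExt_sub_le (ε : ℤˣ) (s : ℝ) (n : ℤ) {p : ℂ} (hp : 0 < p.re) :
    ‖gammaExt ε s n p - gammaExt ε s n (p.re : ℂ)‖ ≤
      2 ^ (-s) * (p.re ^ (s - 1) + (p.re + |p.im|) ^ (s - 1)) *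
        (2 * Real.exp (-(n * (2 * Real.pi * p.re)))) * |p.im| := by
  have hconv : Convex ℝ {q : ℂ | q.re = p.re ∧ ‖q‖ ≤ p.re + |p.im|} := by
    have h1 : Convex ℝ {q : ℂ | q.re = p.re} :=
      (convex_halfSpace_re_le p.re).inter (convex_halfSpace_re_ge p.re) |> fun h => by
        convert h using 1
        ext q
        simp [le_antisymm_iff]
    have h2 : {q : ℂ | ‖q‖ ≤ p.re + |p.im|} = Metric.closedBall 0 (p.re + |p.im|) := by
      ext q
      simp
    have h3 := convex_closedBall (0 : ℂ) (p.re + |p.im|)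
    rw [← h2] at h3
    exact h1.inter h3
  have h := hconv.norm_image_sub_le_of_norm_hasDerivWithin_le (f := gammaExt ε s n)
    (f' := periodIntegrand s n)
    (C := 2 ^ (-s) * (p.re ^ (s - 1) + (p.re + |p.im|) ^ (s - 1)) *
        (2 * Real.exp (-(n * (2 * Real.pi * p.re)))))
    (x := (p.re : ℂ)) (y := p)
    (fun q hq => (hasDerivAt_gammaExt ε s n (by rw [hq.1]; exact hp)).hasDerivWithinAt)
    (fun q hq => ?_) ?_ ?_
  · refine h.trans (le_of_eq ?_)
    congr 1
    have : p - (p.re : ℂ) = p.im * Complex.I := by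
      nth_rewrite 1 [← Complex.re_add_im p]
      ring
    rw [this, norm_mul, Complex.norm_I, mul_one, Complex.norm_real, Real.norm_eq_abs]
  · have := norm_periodIntegrand_le s n hp (p := q) hq.1.ge hq.1.le hq.2
    rwa [← two_mul] at this
  · refine ⟨by simp, ?_⟩
    rw [Complex.norm_real, Real.norm_of_nonneg hp.le]
    linarith [abs_nonneg p.im]
  · refine ⟨rfl, ?_⟩
    have := Complex.norm_le_abs_re_add_abs_im p
    rwa [abs_of_pos hp] at this

lemma norm_bounds {p : ℂ} (hp : 0 < p.re) : p.re ≤ ‖p‖ ∧ ‖p‖ ≤ p.re + |p.im| := by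
  refine ⟨Complex.re_le_norm p, ?_⟩
  have := Complex.norm_le_abs_re_add_abs_im p
  rwa [abs_of_pos hp] at this

/-- On the real axis `Γ(s, ·)` tends to zero. The vertical shift by `Im p` and the leading term are
both exponentially small, because the decay of `e^{-2πnp}` beats the powers. This fixes the
remainder at infinity for `n > 0`. -/
lemma tendsto_gammaRem (ε : ℤˣ) (s : ℝ) {n : ℤ} (hn : 0 < n) {p : ℂ} (hp : 1 ≤ p.re) :
    Tendsto (fun T : ℝ => gammaRem ε s n (p + T)) atTop (𝓝 0) := by
  obtain ⟨C, hC, hCle⟩ := exists_rpow_le_exp (s - 1)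
  have hn1 : (1 : ℝ) ≤ n := by exact_mod_cast hn
  set L := 2 ^ (-s) * (C * (1 + Real.exp |p.im|))
  have h0 : Tendsto (fun T : ℝ => p.re + T) atTop atTop := tendsto_atTop_add_const_left _ _ tendsto_id
  have h1 : Tendsto (fun T : ℝ => gammaExt ε s n ((p.re + T : ℝ) : ℂ)) atTop (𝓝 0) := by
    have h2 := ((tendsto_incGamma_atTop ε s).comp
      (h0.const_mul_atTop (by positivity : 0 < 2 * Real.pi * n))).const_mul
      (brPow ε (4 * Real.pi * n) (-s))
    rw [mul_zero] at h2
    refine h2.congr' ?_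
    filter_upwards [eventually_ge_atTop 0] with T hT
    rw [gammaExt_ofReal ε s hn.ne' (by linarith)]
    rfl
  have h2 : Tendsto (fun T : ℝ => Real.exp (-(p.re + T))) atTop (𝓝 0) :=
    Real.tendsto_exp_neg_atTop_nhds_zero.comp h0
  have h3 := h1.norm.add ((h2.const_mul (L * (2 * |p.im| + 1))))
  rw [norm_zero, mul_zero, add_zero] at h3
  refine squeeze_zero_norm' ?_ h3
  filter_upwards [eventually_ge_atTop 0] with T hT
  have hre : (p + (T : ℂ)).re = p.re + T := by simp
  have him : (p + (T : ℂ)).im = p.im := by simp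
  have hα : 1 ≤ p.re + T := by linarith
  have hpos : 0 < (p + (T : ℂ)).re := by rw [hre]; linarith
  have e1 := norm_gammaExt_sub_le ε s n hpos
  have e2 := norm_gammaLead_le (s := s) hn.ne' hpos
  have e3 := norm_bounds hpos
  rw [hre, him] at e1 e3
  rw [hre] at e2
  have e4 := rpow_le_rpow_add_rpow (by linarith) e3.1 e3.2 (s - 1)
  have e5 : (p.re + T) ^ (s - 1) + (p.re + T + |p.im|) ^ (s - 1)
      ≤ C * (1 + Real.exp |p.im|) * Real.exp (p.re + T) := by
    have f1 := hCle (p.re + T) hα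
    have f2 := hCle (p.re + T + |p.im|) (by linarith [abs_nonneg p.im])
    rw [Real.exp_add (p.re + T)] at f2
    linarith
  have e6 : Real.exp (-(2 * Real.pi * n * (p.re + T))) ≤ Real.exp (-(2 * (p.re + T))) := by
    apply Real.exp_le_exp.mpr
    apply neg_le_neg
    apply mul_le_mul_of_nonneg_right _ (by linarith)
    have := Real.pi_gt_three
    nlinarith
  have e7 : Real.exp (p.re + T) * Real.exp (-(2 * (p.re + T))) = Real.exp (-(p.re + T)) := by
    rw [← Real.exp_add]; ring_nf
  have e8 : n * (2 * Real.pi * (p.re + T)) = 2 * Real.pi * n * (p.re + T) := by ring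
  rw [e8] at e1
  set Z := (p.re + T) ^ (s - 1) + (p.re + T + |p.im|) ^ (s - 1) with hZ
  have hZ0 : 0 ≤ Z := le_trans (by positivity) e4
  have key : 2 ^ (-s) * Z * Real.exp (-(2 * Real.pi * n * (p.re + T)))
      ≤ L * Real.exp (-(p.re + T)) := by
    calc _ ≤ 2 ^ (-s) * (C * (1 + Real.exp |p.im|) * Real.exp (p.re + T))
          * Real.exp (-(2 * (p.re + T))) := by gcongr
      _ = L * (Real.exp (p.re + T) * Real.exp (-(2 * (p.re + T)))) := by ring
      _ = _ := by rw [e7]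
  have e9 : ‖gammaLead s n (p + T)‖ ≤ L * Real.exp (-(p.re + T)) := by
    refine e2.trans (le_trans ?_ key)
    calc _ ≤ 2 ^ (-s) * Real.exp (-(2 * Real.pi * n * (p.re + T))) * Z := by gcongr
      _ = _ := by ring
  have e10 : ‖gammaExt ε s n (p + T) - gammaExt ε s n ((p.re + T : ℝ) : ℂ)‖
      ≤ L * Real.exp (-(p.re + T)) * (2 * |p.im|) := by
    refine e1.trans ?_
    calc _ = 2 ^ (-s) * Z * Real.exp (-(2 * Real.pi * n * (p.re + T))) * (2 * |p.im|) := by ring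
      _ ≤ _ := by gcongr
  rw [gammaRem]
  calc ‖gammaExt ε s n (p + T) - gammaLead s n (p + T)‖
      = ‖gammaExt ε s n ((p.re + T : ℝ) : ℂ) + (gammaExt ε s n (p + T)
        - gammaExt ε s n ((p.re + T : ℝ) : ℂ)) - gammaLead s n (p + T)‖ := by congr 1; ring
    _ ≤ ‖gammaExt ε s n ((p.re + T : ℝ) : ℂ)‖ + ‖gammaExt ε s n (p + T)
        - gammaExt ε s n ((p.re + T : ℝ) : ℂ)‖ + ‖gammaLead s n (p + T)‖ :=
      (norm_sub_le _ _).trans (add_le_add_left (norm_add_le _ _) _)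
    _ ≤ _ := by linarith

/-- The rate `8π` has no significance: `4π` comes from the power `(4π|n|)^{-s}` and `4π` from the
factor `e^{2X}` with `X = 2π|n|`. -/
lemma exists_gammaExtOne_le (ε : ℤˣ) (s : ℝ) : ∃ K : ℝ, 0 < K ∧ ∀ n : ℤ, n < 0 →
    ‖gammaExtOne ε s n‖ ≤ K * Real.exp (-(n * (8 * Real.pi))) := by
  obtain ⟨C₁, hC₁, h₁⟩ := exists_rpow_le_exp (-s)
  obtain ⟨C₂, hC₂, h₂⟩ := exists_norm_incGamma_neg_le ε s
  refine ⟨C₁ * C₂, by positivity, fun n hn => ?_⟩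
  have hn1 : (1 : ℝ) ≤ -n := by
    have : 1 ≤ -n := by omega
    exact_mod_cast this
  have hpi := Real.pi_gt_three
  have hX : 1 ≤ 2 * Real.pi * (-n) := by nlinarith
  have e1 := h₁ (4 * Real.pi * (-n)) (by nlinarith)
  have e2 := h₂ (2 * Real.pi * (-n)) hX
  have habs : |4 * Real.pi * n| = 4 * Real.pi * (-n) := by
    rw [abs_of_neg (by nlinarith)]; ring
  have hnorm := norm_brPow ε (four_pi_mul_ne_zero hn.ne) (-s)
  rw [habs] at hnorm
  push_cast at hnorm
  have e3 : -(2 * Real.pi * -(n : ℝ)) = 2 * Real.pi * n := by ring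
  rw [e3] at e2
  rw [gammaExtOne, if_neg hn.ne, norm_mul, hnorm]
  calc _ ≤ C₁ * Real.exp (4 * Real.pi * (-n)) * (C₂ * Real.exp (2 * (2 * Real.pi * (-n)))) := by
        gcongr
    _ = C₁ * C₂ * (Real.exp (4 * Real.pi * (-n)) * Real.exp (2 * (2 * Real.pi * (-n)))) := by ring
    _ = _ := by rw [← Real.exp_add]; ring_nf

/-- For `n < 0` the function grows to the right, so the remainder is controlled from the left end
`Re p = 1` of the line; this bounds its value there. -/
lemma exists_gammaRem_line_le (ε : ℤˣ) (s η : ℝ) : ∃ K : ℝ, 0 < K ∧ ∀ n : ℤ, n < 0 →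
    ‖gammaRem ε s n (pt 1 η)‖ ≤ K * Real.exp (-(n * (8 * Real.pi))) := by
  obtain ⟨K, hK, hKle⟩ := exists_gammaExtOne_le ε s
  set Z := (1 : ℝ) ^ (s - 1) + (1 + |η|) ^ (s - 1) with hZ
  have hZ0 : 0 < Z := by positivity
  refine ⟨K + 2 ^ (-s) * Z * (2 * |η| + 1), by positivity, fun n hn => ?_⟩
  have hpos : 0 < (pt 1 η).re := by simp
  have e1 := norm_gammaExt_sub_le ε s n hpos
  have e2 := norm_gammaLead_le (s := s) hn.ne hpos
  have e3 := norm_bounds hpos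
  rw [pt_re, pt_im, ← hZ, Complex.ofReal_one, gammaExt_one] at e1
  rw [pt_re, pt_im] at e3
  rw [pt_re] at e2
  have e4 := rpow_le_rpow_add_rpow one_pos e3.1 e3.2 (s - 1)
  rw [← hZ] at e4
  have hn0 : (n : ℝ) < 0 := by exact_mod_cast hn
  have e5 : Real.exp (-(n * (2 * Real.pi * 1))) ≤ Real.exp (-(n * (8 * Real.pi))) := by
    apply Real.exp_le_exp.mpr
    nlinarith [Real.pi_pos, mul_pos (neg_pos.mpr hn0) Real.pi_pos]
  have e6 : -(2 * Real.pi * n * 1) = -(n * (2 * Real.pi * 1)) := by ring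
  rw [e6] at e2
  have e7 := hKle n hn
  rw [gammaRem]
  calc ‖gammaExt ε s n (pt 1 η) - gammaLead s n (pt 1 η)‖
      = ‖gammaExtOne ε s n + (gammaExt ε s n (pt 1 η) - gammaExtOne ε s n)
        - gammaLead s n (pt 1 η)‖ := by congr 1; ring
    _ ≤ ‖gammaExtOne ε s n‖ + ‖gammaExt ε s n (pt 1 η) - gammaExtOne ε s n‖
        + ‖gammaLead s n (pt 1 η)‖ :=
      (norm_sub_le _ _).trans (add_le_add_left (norm_add_le _ _) _)
    _ ≤ K * Real.exp (-(n * (8 * Real.pi)))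
        + 2 ^ (-s) * Z * (2 * Real.exp (-(n * (8 * Real.pi)))) * |η|
        + 2 ^ (-s) * Real.exp (-(n * (8 * Real.pi))) * Z := by
      refine add_le_add (add_le_add e7 (e1.trans ?_)) (e2.trans ?_)
      · gcongr
      · gcongr
    _ = _ := by ring

/-- The asymptotic expansion of `gammaExt` along a horizontal line, uniformly in `n`. -/
lemma exists_gammaExt_asymptotic (ε : ℤˣ) (s η : ℝ) : ∃ K : ℝ, 0 < K ∧ ∀ n : ℤ, n ≠ 0 →
    ∀ p : ℂ, 1 ≤ p.re → p.im = η →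
    ‖cexp (2 * Real.pi * n * p) * p ^ (1 - s : ℂ) * gammaExt ε s n p
      - (2 : ℂ) ^ (-s : ℂ) / (2 * Real.pi * n)‖
      ≤ K / ‖p‖ * (1 + Real.exp (-(n * (8 * Real.pi)))) := by
  obtain ⟨K₁, hK₁, h₁⟩ := exists_gammaRem_sub_le ε s
  obtain ⟨K₂, hK₂, h₂⟩ := exists_gammaRem_line_le ε s η
  obtain ⟨C, hC, hCle⟩ := exists_rpow_le_exp (2 - s)
  refine ⟨K₁ + C * Real.exp |η| * K₂, by positivity, fun n hn p hp him => ?_⟩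
  have hp0 : 0 < p.re := by linarith
  have hpne := ne_zero_of_re_pos hp0
  have hnorm0 : 0 < ‖p‖ := norm_pos_iff.mpr hpne
  have hid : cexp (2 * Real.pi * n * p) * p ^ (1 - s : ℂ) * gammaExt ε s n p
      - (2 : ℂ) ^ (-s : ℂ) / (2 * Real.pi * n)
      = cexp (2 * Real.pi * n * p) * p ^ (1 - s : ℂ) * gammaRem ε s n p := by
    have f1 : cexp (2 * Real.pi * n * p) * cexp (-(2 * Real.pi * n * p)) = 1 := by
      rw [← Complex.exp_add]; simp
    have f2 : p ^ (1 - s : ℂ) * p ^ (s - 1 : ℂ) = 1 := by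
      rw [← Complex.cpow_add _ _ hpne]; ring_nf; simp
    rw [gammaRem, gammaLead]
    have f3 : cexp (2 * Real.pi * n * p) * p ^ (1 - s : ℂ) *
        ((2 : ℂ) ^ (-s : ℂ) * cexp (-(2 * Real.pi * n * p)) * p ^ (s - 1 : ℂ) / (2 * Real.pi * n))
        = (cexp (2 * Real.pi * n * p) * cexp (-(2 * Real.pi * n * p))) *
          (p ^ (1 - s : ℂ) * p ^ (s - 1 : ℂ)) * ((2 : ℂ) ^ (-s : ℂ) / (2 * Real.pi * n)) := by ring
    rw [mul_sub, f3, f1, f2]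
    ring
  have hn2 : ‖cexp (2 * Real.pi * n * p)‖ = Real.exp (2 * Real.pi * n * p.re) := by
    have := norm_cexp_two_pi_mul (-n) p
    push_cast at this
    convert this using 2
    · ring_nf
    · ring
  have hn3 : ‖p ^ (1 - s : ℂ)‖ = ‖p‖ ^ (1 - s) := by
    have := norm_cpow_of_re_pos hp0 (1 - s)
    push_cast at this
    exact this
  have hmain : Real.exp (2 * Real.pi * n * p.re) * ‖p‖ ^ (1 - s) *
      (K₁ * Real.exp (-(2 * Real.pi * n * p.re)) * ‖p‖ ^ (s - 2)) = K₁ / ‖p‖ := by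
    have f1 : Real.exp (2 * Real.pi * n * p.re) * Real.exp (-(2 * Real.pi * n * p.re)) = 1 := by
      rw [← Real.exp_add]; simp
    have f2 : ‖p‖ ^ (1 - s) * ‖p‖ ^ (s - 2) = ‖p‖⁻¹ := by
      rw [← Real.rpow_add hnorm0, ← Real.rpow_neg_one]; ring_nf
    calc _ = K₁ * (Real.exp (2 * Real.pi * n * p.re) * Real.exp (-(2 * Real.pi * n * p.re))) *
          (‖p‖ ^ (1 - s) * ‖p‖ ^ (s - 2)) := by ring
      _ = _ := by rw [f1, f2]; ring
  rw [hid, norm_mul, norm_mul, hn2, hn3]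
  have hE := Real.exp_pos (-(n * (8 * Real.pi)))
  rcases lt_or_gt_of_ne hn with hneg | hpos
  -- Negative `n`: slide left to `Re p = 1`. The value found there is a constant of integration,
  -- made harmless by `e^{2πn Re p} ≤ e^{-Re p}`.
  · have hT : 0 ≤ p.re - 1 := by linarith
    have h3 := h₁ n hn p (p.re - 1) hT hp (by
      rw [Int.sign_eq_neg_one_of_neg hneg]; push_cast; linarith)
    have hpt : p + (n.sign : ℂ) * ((p.re - 1 : ℝ) : ℂ) = pt 1 η := by
      rw [Int.sign_eq_neg_one_of_neg hneg, pt, ← him]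
      nth_rewrite 1 [← Complex.re_add_im p]
      push_cast
      ring
    rw [hpt] at h3
    have h4 := h₂ n hneg
    have h5 : ‖gammaRem ε s n p‖ ≤ K₁ * Real.exp (-(2 * Real.pi * n * p.re)) * ‖p‖ ^ (s - 2)
        + K₂ * Real.exp (-(n * (8 * Real.pi))) := by
      have := norm_sub_norm_le (gammaRem ε s n p) (gammaRem ε s n (pt 1 η))
      rw [norm_sub_rev] at this
      linarith
    have h6 : Real.exp (2 * Real.pi * n * p.re) * ‖p‖ ^ (1 - s) ≤ C * Real.exp |η| / ‖p‖ := by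
      rw [le_div_iff₀ hnorm0]
      have f1 : ‖p‖ ^ (1 - s) * ‖p‖ = ‖p‖ ^ (2 - s) := by
        nth_rewrite 2 [← Real.rpow_one ‖p‖]
        rw [← Real.rpow_add hnorm0]; ring_nf
      have f2 := hCle ‖p‖ (hp.trans (Complex.re_le_norm p))
      have f3 : Real.exp ‖p‖ ≤ Real.exp p.re * Real.exp |η| := by
        rw [← Real.exp_add, ← him]
        exact Real.exp_le_exp.mpr (norm_bounds hp0).2
      have f4 : Real.exp (2 * Real.pi * n * p.re) ≤ Real.exp (-p.re) := by
        apply Real.exp_le_exp.mpr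
        have hn1 : (n : ℝ) ≤ -1 := by
          have : n ≤ -1 := by omega
          exact_mod_cast this
        have := Real.pi_gt_three
        have : 2 * Real.pi * n ≤ -1 := by nlinarith
        nlinarith
      have f5 : Real.exp (-p.re) * Real.exp p.re = 1 := by
        rw [← Real.exp_add]; simp
      calc _ = Real.exp (2 * Real.pi * n * p.re) * (‖p‖ ^ (1 - s) * ‖p‖) := by ring
        _ ≤ Real.exp (-p.re) * (C * (Real.exp p.re * Real.exp |η|)) := by
          rw [f1]
          gcongr
          exact f2.trans (by gcongr)
        _ = C * Real.exp |η| * (Real.exp (-p.re) * Real.exp p.re) := by ring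
        _ = _ := by rw [f5, mul_one]
    calc _ ≤ Real.exp (2 * Real.pi * n * p.re) * ‖p‖ ^ (1 - s) *
          (K₁ * Real.exp (-(2 * Real.pi * n * p.re)) * ‖p‖ ^ (s - 2)
          + K₂ * Real.exp (-(n * (8 * Real.pi)))) := by gcongr
      _ = K₁ / ‖p‖ + Real.exp (2 * Real.pi * n * p.re) * ‖p‖ ^ (1 - s) *
          (K₂ * Real.exp (-(n * (8 * Real.pi)))) := by rw [mul_add, hmain]
      _ ≤ K₁ / ‖p‖ + C * Real.exp |η| / ‖p‖ * (K₂ * Real.exp (-(n * (8 * Real.pi)))) := by gcongr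
      _ ≤ K₁ / ‖p‖ + C * Real.exp |η| / ‖p‖ * (K₂ * Real.exp (-(n * (8 * Real.pi))))
          + (K₁ / ‖p‖ * Real.exp (-(n * (8 * Real.pi))) + C * Real.exp |η| * K₂ / ‖p‖) :=
        le_add_of_nonneg_right (by positivity)
      _ = _ := by ring
  -- Positive `n`: slide right to infinity, where the remainder vanishes.
  · have h3 : ∀ T : ℝ, 0 ≤ T → ‖gammaRem ε s n p‖ ≤
        ‖gammaRem ε s n (p + T)‖ + K₁ * Real.exp (-(2 * Real.pi * n * p.re)) * ‖p‖ ^ (s - 2) := by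
      intro T hT
      have h4 := h₁ n hn p T hT hp (by
        rw [Int.sign_eq_one_of_pos hpos]; push_cast; linarith)
      rw [Int.sign_eq_one_of_pos hpos, Int.cast_one, one_mul] at h4
      have := norm_sub_norm_le (gammaRem ε s n p) (gammaRem ε s n (p + T))
      rw [norm_sub_rev] at this
      linarith
    have h4 := ((tendsto_gammaRem ε s hpos hp).norm).add_const
      (K₁ * Real.exp (-(2 * Real.pi * n * p.re)) * ‖p‖ ^ (s - 2))
    rw [norm_zero, zero_add] at h4
    have h5 : ‖gammaRem ε s n p‖ ≤ K₁ * Real.exp (-(2 * Real.pi * n * p.re)) * ‖p‖ ^ (s - 2) := by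
      refine ge_of_tendsto h4 ?_
      filter_upwards [eventually_ge_atTop 0] with T hT using h3 T hT
    calc _ ≤ Real.exp (2 * Real.pi * n * p.re) * ‖p‖ ^ (1 - s) *
          (K₁ * Real.exp (-(2 * Real.pi * n * p.re)) * ‖p‖ ^ (s - 2)) := by gcongr
      _ = K₁ / ‖p‖ := hmain
      _ ≤ K₁ / ‖p‖ + (K₁ / ‖p‖ * Real.exp (-(n * (8 * Real.pi)))
          + C * Real.exp |η| * K₂ / ‖p‖ * (1 + Real.exp (-(n * (8 * Real.pi))))) :=
        le_add_of_nonneg_right (by positivity)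
      _ = _ := by ring

section EichlerLimits

variable {ε : ℤˣ} {s : ℝ} {g gp gm : ℍ → ℂ} {ap am : ℤ → ℂ}

/-! ### The limit of the Eichler integral at a rational number -/

lemma norm_eichlerTerm (z p : ℂ) (n : ℤ) : ‖eichlerTerm ε s am z p n‖ =
    ‖shadowCoeff ε s am n‖ * ‖gammaExt ε s n p‖ * Real.exp (n * (2 * Real.pi * z.im)) := by
  rw [eichlerTerm, norm_neg, norm_mul, norm_mul, RCLike.norm_conj, norm_cexp_neg_two_pi]

/-- At `z = i/2` the series for the nonholomorphic part has `p = 2y = 1`, and its absolute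
convergence gives the case `n ≥ 0` with the factor `e^{πn}` to spare. For `n < 0` the decay of the
coefficients wins. The factor `e^{πn/2}` corresponds to heights up to `1/4`. -/
lemma summable_shadowCoeff_mul_gammaExtOne (hG : ContDiffOn ℝ ∞ (ext g) {z : ℂ | 0 < z.im})
    (hdec : IsMaassDecomposition ε (1 - s) g gp gm ap am) (hs : s ≠ 0) :
    Summable fun n : ℤ => ‖shadowCoeff ε s am n‖ * ‖gammaExtOne ε s n‖ *
      (1 + Real.exp (n * (Real.pi / 2))) := by
  obtain ⟨K, hK, hKle⟩ := exists_gammaExtOne_le ε s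
  have hpi := Real.pi_pos
  have him : 0 < (pt 0 (1 / 2)).im := by simp
  have h1 := (hasSum_eichlerTerm hdec hs (ofComplex (pt 0 (1 / 2)))).summable.norm
  have e1 : (2 * (ofComplex (pt 0 (1 / 2))).im : ℝ) = 1 := by
    rw [← UpperHalfPlane.coe_im, coe_ofComplex him, pt_im]; norm_num
  simp_rw [norm_eichlerTerm, e1, Complex.ofReal_one, gammaExt_one, coe_ofComplex him, pt_im] at h1
  have h2 := summable_shadowCoeff hG hdec hs (y := 8 * Real.pi) (by positivity)
  refine Summable.of_nonneg_of_le (fun n => by positivity) (fun n => ?_)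
    ((h1.mul_left 2).add (h2.mul_left (2 * K)))
  have hb := norm_nonneg (shadowCoeff ε s am n)
  have hA := norm_nonneg (gammaExtOne ε s n)
  rcases lt_or_ge n 0 with hn | hn
  · have hn' : (n : ℝ) < 0 := by exact_mod_cast hn
    have h3 : Real.exp (n * (Real.pi / 2)) ≤ 1 := Real.exp_le_one_iff.mpr (by nlinarith)
    calc _ ≤ ‖shadowCoeff ε s am n‖ * (K * Real.exp (-(n * (8 * Real.pi)))) * (1 + 1) := by
          gcongr
          exact hKle n hn
      _ = 2 * K * (‖shadowCoeff ε s am n‖ * Real.exp (-(n * (8 * Real.pi)))) := by ring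
      _ ≤ _ := le_add_of_nonneg_left (by positivity)
  · have hn' : (0 : ℝ) ≤ n := by exact_mod_cast hn
    have h3 : Real.exp (n * (Real.pi / 2)) ≤ Real.exp (n * (2 * Real.pi * (1 / 2))) :=
      Real.exp_le_exp.mpr (by nlinarith [mul_nonneg hn' hpi.le])
    have h4 : 1 ≤ Real.exp (n * (2 * Real.pi * (1 / 2))) := Real.one_le_exp (by positivity)
    calc _ ≤ ‖shadowCoeff ε s am n‖ * ‖gammaExtOne ε s n‖ *
          (Real.exp (n * (2 * Real.pi * (1 / 2))) + Real.exp (n * (2 * Real.pi * (1 / 2)))) := by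
          gcongr
      _ = 2 * (‖shadowCoeff ε s am n‖ * ‖gammaExtOne ε s n‖ *
          Real.exp (n * (2 * Real.pi * (1 / 2)))) := by ring
      _ ≤ _ := le_add_of_nonneg_right (by positivity)

lemma norm_gammaExt_sub_one_le (ε : ℤˣ) (s : ℝ) (n : ℤ) {q : ℂ} (hq : ‖q - 1‖ < 1 / 4) :
    ‖gammaExt ε s n q - gammaExtOne ε s n‖ ≤ 2 ^ (-s) * ((3 / 4) ^ (s - 1) + 2 ^ (s - 1)) *
      (Real.exp (-(n * (2 * Real.pi * (3 / 4)))) + Real.exp (-(n * (2 * Real.pi * 2)))) := by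
  have hre : ∀ p ∈ Metric.ball (1 : ℂ) (1 / 4), 3 / 4 ≤ p.re ∧ p.re ≤ 2 ∧ ‖p‖ ≤ 2 := by
    intro p hp
    rw [mem_ball_iff_norm] at hp
    have h1 := (Complex.abs_re_le_norm (p - 1)).trans hp.le
    rw [abs_le, Complex.sub_re, Complex.one_re] at h1
    have h2 := norm_le_norm_add_norm_sub' p 1
    rw [norm_one] at h2
    exact ⟨by linarith, by linarith, by linarith⟩
  rw [← gammaExt_one]
  refine ((convex_ball (1 : ℂ) (1 / 4)).norm_image_sub_le_of_norm_hasDerivWithin_le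
    (fun p hp => (hasDerivAt_gammaExt ε s n (by linarith [(hre p hp).1])).hasDerivWithinAt)
    (fun p hp => norm_periodIntegrand_le s n (by norm_num) (hre p hp).1 (hre p hp).2.1
      (hre p hp).2.2) (Metric.mem_ball_self (by norm_num)) (mem_ball_iff_norm.mpr hq)).trans ?_
  exact mul_le_of_le_one_right (by positivity) (by linarith)

/-- With end point `r + i` the variable `p` tends to `1`. For `|z - r| < 1/4` the exponential factor
is at most `1 + e^{πn/2}`, while for `n ≥ 0` the change of `gammaExt` near `1` is `O(e^{-3πn/2})`,
so dominated convergence applies. -/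
lemma tendsto_eichler_at_real (hG : ContDiffOn ℝ ∞ (ext g) {z : ℂ | 0 < z.im})
    (hdec : IsMaassDecomposition ε (1 - s) g gp gm ap am) (hs : s ≠ 0) (r : ℝ) :
    Tendsto (fun z : ℂ => eichler ε s am z (kvar z (pt r 1))) (𝓝[{z : ℂ | 0 < z.im}] (r : ℂ))
      (𝓝 (eichler ε s am r 1)) := by
  set C : ℝ := 2 ^ (-s) * ((3 / 4) ^ (s - 1) + 2 ^ (s - 1)) with hC
  have hC0 : 0 ≤ C := by positivity
  have hpi := Real.pi_pos
  have hk : kvar r (pt r 1) = 1 := by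
    simp only [kvar, pt, map_add, map_mul, Complex.conj_ofReal, Complex.conj_I, Complex.ofReal_one, map_one]
    linear_combination -Complex.I_sq
  have hkc : Continuous fun z : ℂ => kvar z (pt r 1) := by unfold kvar; fun_prop
  refine tendsto_tsum_of_dominated_convergence
    (bound := fun n : ℤ => ‖shadowCoeff ε s am n‖ * ‖gammaExtOne ε s n‖ *
      (1 + Real.exp (n * (Real.pi / 2))) + C * (‖shadowCoeff ε s am n‖ *
      ((Real.exp (-(n * (2 * Real.pi * (3 / 4)))) + Real.exp (-(n * (2 * Real.pi * 2)))) +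
        (Real.exp (-(n * Real.pi)) + Real.exp (-(n * (7 / 2 * Real.pi))))))) ?_ ?_ ?_
  · refine (summable_shadowCoeff_mul_gammaExtOne hG hdec hs).add (Summable.mul_left _ ?_)
    have h1 := summable_shadowCoeff_two hG hdec hs (a := 2 * Real.pi * (3 / 4))
      (b := 2 * Real.pi * 2) (by positivity) (by positivity)
    have h2 := summable_shadowCoeff_two hG hdec hs (a := Real.pi)
      (b := 7 / 2 * Real.pi) (by positivity) (by positivity)
    exact (h1.add h2).congr fun n => by ring
  · intro n
    have h1 : ContinuousAt (fun z : ℂ => gammaExt ε s n (kvar z (pt r 1))) r := by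
      refine ContinuousAt.comp (f := fun z : ℂ => kvar z (pt r 1)) ?_ hkc.continuousAt
      rw [hk]
      exact (hasDerivAt_gammaExt ε s n (by simp)).continuousAt
    have h2 : ContinuousAt (fun z : ℂ => eichlerTerm ε s am z (kvar z (pt r 1)) n) r := by
      unfold eichlerTerm
      exact ((continuousAt_const.mul h1).mul (by fun_prop)).neg
    have := h2.tendsto.mono_left (nhdsWithin_le_nhds (s := {z : ℂ | 0 < z.im}))
    rwa [hk] at this
  · have hball : ∀ᶠ z in 𝓝[{z : ℂ | 0 < z.im}] (r : ℂ), z ∈ Metric.ball (r : ℂ) (1 / 4) :=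
      nhdsWithin_le_nhds (Metric.ball_mem_nhds _ (by norm_num))
    filter_upwards [hball, self_mem_nhdsWithin] with z hz hzim n
    rw [mem_ball_iff_norm] at hz
    have hzim' : z.im ≤ 1 / 4 := by
      have := (Complex.abs_im_le_norm (z - r)).trans hz.le
      rw [abs_le, Complex.sub_im, Complex.ofReal_im] at this
      linarith [this.2]
    have hq : ‖kvar z (pt r 1) - 1‖ < 1 / 4 := by
      have : kvar z (pt r 1) - 1 = -Complex.I * (z - r) := by
        rw [← hk, kvar, kvar]; ring
      rw [this, norm_mul, norm_neg, Complex.norm_I, one_mul]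
      exact hz
    have h1 := norm_gammaExt_sub_one_le ε s n hq
    have h2 := norm_le_norm_add_norm_sub' (gammaExt ε s n (kvar z (pt r 1))) (gammaExtOne ε s n)
    have h3 : Real.exp (n * (2 * Real.pi * z.im)) ≤ 1 + Real.exp (n * (Real.pi / 2)) := by
      have hz0 : 0 < z.im := hzim
      rcases le_total 0 (n : ℝ) with hn | hn
      · have : Real.exp (n * (2 * Real.pi * z.im)) ≤ Real.exp (n * (Real.pi / 2)) := by
          refine Real.exp_le_exp.mpr (mul_le_mul_of_nonneg_left ?_ hn)
          nlinarith
        linarith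
      · have : Real.exp (n * (2 * Real.pi * z.im)) ≤ 1 :=
          Real.exp_le_one_iff.mpr (mul_nonpos_of_nonpos_of_nonneg hn (by positivity))
        linarith [Real.exp_pos (n * (Real.pi / 2))]
    have e1 : Real.exp (-(n * (2 * Real.pi * (3 / 4)))) * Real.exp (n * (Real.pi / 2))
        = Real.exp (-(n * Real.pi)) := by
      rw [← Real.exp_add]; congr 1; ring
    have e2 : Real.exp (-(n * (2 * Real.pi * 2))) * Real.exp (n * (Real.pi / 2))
        = Real.exp (-(n * (7 / 2 * Real.pi))) := by
      rw [← Real.exp_add]; congr 1; ring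
    rw [norm_eichlerTerm, ← e1, ← e2]
    calc _ ≤ ‖shadowCoeff ε s am n‖ * (‖gammaExtOne ε s n‖ + C *
          (Real.exp (-(n * (2 * Real.pi * (3 / 4)))) + Real.exp (-(n * (2 * Real.pi * 2))))) *
          (1 + Real.exp (n * (Real.pi / 2))) := by
          gcongr
          linarith
      _ = _ := by ring

/-! ### The limit of the Eichler integral at infinity -/

/-- The terms of the limit of `eichler` at infinity. -/
def cuspTerm (ε : ℤˣ) (s : ℝ) (am : ℤ → ℂ) (w : ℂ) (n : ℤ) : ℂ :=
  if n = 0 then 0 else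
    -(conj (shadowCoeff ε s am n) * cexp (-(2 * Real.pi * Complex.I * n * conj w)) *
      ((2 : ℂ) ^ (-s : ℂ) / (2 * Real.pi * n)))

lemma cexp_kvar (z w : ℂ) (n : ℤ) : cexp (-(2 * Real.pi * Complex.I * n * z)) =
    cexp (-(2 * Real.pi * Complex.I * n * conj w)) * cexp (2 * Real.pi * n * kvar z w) := by
  rw [← Complex.exp_add, kvar]
  congr 1
  ring

lemma norm_cexp_conj (w : ℂ) (n : ℤ) : ‖cexp (-(2 * Real.pi * Complex.I * n * conj w))‖
    = Real.exp (-(n * (2 * Real.pi * w.im))) := by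
  rw [norm_cexp_neg_two_pi, Complex.conj_im]
  congr 1
  ring

lemma tendsto_norm_kvar (x : ℝ) (w : ℂ) :
    Tendsto (fun Y : ℝ => ‖kvar (pt x Y) w‖) atTop atTop := by
  refine tendsto_atTop_mono (fun Y => ?_) (tendsto_atTop_add_const_right _ w.im tendsto_id)
  have := Complex.re_le_norm (kvar (pt x Y) w)
  rwa [kvar_re, pt_im] at this

lemma norm_cuspTerm_le (w : ℂ) (n : ℤ) : ‖cuspTerm ε s am w n‖ ≤
    2 ^ (-s) * (‖shadowCoeff ε s am n‖ * Real.exp (-(n * (2 * Real.pi * w.im)))) := by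
  rw [cuspTerm]
  split_ifs with hn
  · rw [norm_zero]; positivity
  · rw [norm_neg, norm_mul, norm_mul, RCLike.norm_conj, norm_cexp_conj, norm_div, norm_two_cpow]
    have := div_le_self (by positivity : (0 : ℝ) ≤ 2 ^ (-s)) (one_le_norm_two_pi_mul hn)
    calc _ ≤ ‖shadowCoeff ε s am n‖ * Real.exp (-(n * (2 * Real.pi * w.im))) * 2 ^ (-s) := by
          gcongr
      _ = _ := by ring

lemma summable_cuspTerm (hG : ContDiffOn ℝ ∞ (ext g) {z : ℂ | 0 < z.im})
    (hdec : IsMaassDecomposition ε (1 - s) g gp gm ap am) (hs : s ≠ 0) {w : ℂ} (hw : 0 < w.im) :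
    Summable fun n => ‖cuspTerm ε s am w n‖ := by
  have hpi := Real.pi_pos
  exact Summable.of_nonneg_of_le (fun n => norm_nonneg _) (fun n => norm_cuspTerm_le w n)
    ((summable_shadowCoeff hG hdec hs (by positivity)).mul_left _)

/-- Since `e^{-2πinz} = e^{-2πin w̄} e^{2πnp}`, the exponential growth cancels the exponential in
`gammaExt`, and `exists_gammaExt_asymptotic` gives an error of order `1/‖p‖` uniformly in `n`. The
term `n = 0` is left out because after scaling it grows like `p`. -/
lemma tendsto_eichler_at_infty (hG : ContDiffOn ℝ ∞ (ext g) {z : ℂ | 0 < z.im})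
    (hdec : IsMaassDecomposition ε (1 - s) g gp gm ap am) (hs : s ≠ 0) (x : ℝ) {w : ℂ}
    (hw : 0 < w.im) :
    Tendsto (fun Y : ℝ => ∑' n : ℤ, if n = 0 then 0 else
      kvar (pt x Y) w ^ (1 - s : ℂ) * eichlerTerm ε s am (pt x Y) (kvar (pt x Y) w) n) atTop
      (𝓝 (∑' n, cuspTerm ε s am w n)) := by
  have hpi := Real.pi_pos
  obtain ⟨K, hK, hKle⟩ := exists_gammaExt_asymptotic ε s (kvar (pt x 0) w).im
  have him : ∀ Y, (kvar (pt x Y) w).im = (kvar (pt x 0) w).im := fun Y => by simp [kvar]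
  have hdiff : ∀ n : ℤ, ∀ Y : ℝ, 1 ≤ Y →
      ‖(if n = 0 then 0 else
      kvar (pt x Y) w ^ (1 - s : ℂ) * eichlerTerm ε s am (pt x Y) (kvar (pt x Y) w) n)
        - cuspTerm ε s am w n‖ ≤ K / ‖kvar (pt x Y) w‖ * (‖shadowCoeff ε s am n‖ *
        (Real.exp (-(n * (2 * Real.pi * w.im))) +
          Real.exp (-(n * (2 * Real.pi * w.im + 8 * Real.pi))))) := by
    intro n Y hY
    rw [cuspTerm]
    split_ifs with hn
    · rw [sub_zero, norm_zero]; positivity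
    · have h1 := hKle n hn (kvar (pt x Y) w) (by rw [kvar_re, pt_im]; linarith) (him Y)
      have e1 : Real.exp (-(n * (2 * Real.pi * w.im + 8 * Real.pi))) =
          Real.exp (-(n * (2 * Real.pi * w.im))) * Real.exp (-(n * (8 * Real.pi))) := by
        rw [← Real.exp_add]; congr 1; ring
      have e2 : ∀ P A E X b G : ℂ, P * -(b * G * (E * X)) - -(b * E * A)
          = -(b * E * (X * P * G - A)) := fun P A E X b G => by ring
      rw [eichlerTerm, cexp_kvar _ w, e2, norm_neg, norm_mul, norm_mul, RCLike.norm_conj,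
        norm_cexp_conj, e1]
      calc _ ≤ ‖shadowCoeff ε s am n‖ * Real.exp (-(n * (2 * Real.pi * w.im))) *
            (K / ‖kvar (pt x Y) w‖ * (1 + Real.exp (-(n * (8 * Real.pi))))) := by gcongr
        _ = _ := by ring
  have hsum2 := summable_shadowCoeff_two hG hdec hs (a := 2 * Real.pi * w.im)
    (b := 2 * Real.pi * w.im + 8 * Real.pi) (by positivity) (by positivity)
  refine tendsto_tsum_of_dominated_convergence (bound := fun n =>
    ‖cuspTerm ε s am w n‖ + K * (‖shadowCoeff ε s am n‖ *
        (Real.exp (-(n * (2 * Real.pi * w.im))) +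
          Real.exp (-(n * (2 * Real.pi * w.im + 8 * Real.pi))))))
    ((summable_cuspTerm hG hdec hs hw).add (hsum2.mul_left K)) (fun n => ?_) ?_
  · rw [tendsto_iff_norm_sub_tendsto_zero]
    refine squeeze_zero' (Eventually.of_forall fun _ => norm_nonneg _)
      ((eventually_ge_atTop 1).mono fun Y hY => hdiff n Y hY) ?_
    have := ((tendsto_norm_kvar x w).const_div_atTop K).mul_const (‖shadowCoeff ε s am n‖ *
        (Real.exp (-(n * (2 * Real.pi * w.im))) +
          Real.exp (-(n * (2 * Real.pi * w.im + 8 * Real.pi)))))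
    rwa [zero_mul] at this
  · filter_upwards [eventually_ge_atTop 1] with Y hY n
    have h1 := hdiff n Y hY
    have h2 := norm_le_norm_add_norm_sub' (if n = 0 then 0 else
      kvar (pt x Y) w ^ (1 - s : ℂ) * eichlerTerm ε s am (pt x Y) (kvar (pt x Y) w) n)
      (cuspTerm ε s am w n)
    have h3 : 1 ≤ ‖kvar (pt x Y) w‖ := by
      have := Complex.re_le_norm (kvar (pt x Y) w)
      rw [kvar_re, pt_im] at this
      linarith
    have h4 : K / ‖kvar (pt x Y) w‖ ≤ K := div_le_self hK.le h3
    refine h2.trans (add_le_add_right (h1.trans ?_) _)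
    gcongr

end EichlerLimits

/-! ### Powers and the holomorphic part along vertical lines -/

section RadialLimits

variable {ε : ℤˣ} {s : ℝ} {g gp gm : ℍ → ℂ} {ap am : ℤ → ℂ} {γ : SL(2, ℤ)} {u : ℂ}

lemma abs_arg_lt_of_re_pos {p : ℂ} (hp : 0 < p.re) : |p.arg| < Real.pi / 2 :=
  Complex.abs_arg_lt_pi_div_two_iff.mpr (Or.inl hp)

lemma div_cpow_of_re_pos {p q : ℂ} (hp : 0 < p.re) (hq : 0 < q.re) (t : ℂ) :
    q ^ t = p ^ t * (q / p) ^ t := by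
  have hp0 := ne_zero_of_re_pos hp
  have hq0 := ne_zero_of_re_pos hq
  have h := cpow_mul_of_arg_lt hp0 (div_ne_zero hq0 hp0) ?_ t
  · rwa [mul_div_cancel₀ _ hp0] at h
  · rw [mul_div_cancel₀ _ hp0]
    have h1 := abs_lt.mp (abs_arg_lt_of_re_pos hp)
    have h2 := abs_lt.mp (abs_arg_lt_of_re_pos hq)
    have h3 := Complex.arg_le_pi (q / p)
    have h4 := Complex.neg_pi_lt_arg (q / p)
    rw [abs_lt]
    constructor <;> linarith

lemma I_mul_cpow {c : ℝ} (hc : 0 < c) {q : ℂ} (hq : 0 < q.re) (t : ℂ) :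
    (Complex.I * c * q) ^ t = Complex.I ^ t * (c : ℂ) ^ t * q ^ t := by
  have hq0 := ne_zero_of_re_pos hq
  have hcq : 0 < (c * q).re := by
    rw [Complex.re_ofReal_mul]; positivity
  have h1 : ((c : ℂ) * q) ^ t = (c : ℂ) ^ t * q ^ t := by
    refine cpow_mul_of_arg_lt (by exact_mod_cast hc.ne') hq0 ?_ t
    rw [Complex.arg_real_mul _ hc, Complex.arg_ofReal_of_nonneg hc.le]
    simp [Real.pi_pos]
  rw [mul_assoc, mul_assoc, ← h1]
  refine cpow_mul_of_arg_lt Complex.I_ne_zero (ne_zero_of_re_pos hcq) ?_ t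
  have h2 := abs_lt.mp (abs_arg_lt_of_re_pos hcq)
  have h3 := Complex.arg_le_pi (Complex.I * (c * q))
  have h4 := Complex.neg_pi_lt_arg (Complex.I * (c * q))
  rw [Complex.arg_I, abs_lt]
  constructor <;> linarith

lemma tendsto_norm_pt (η : ℝ) : Tendsto (fun Y : ℝ => ‖pt Y η‖) atTop atTop := by
  refine tendsto_atTop_mono (fun Y => ?_) tendsto_id
  have := Complex.re_le_norm (pt Y η)
  rwa [pt_re] at this

lemma tendsto_div_pt (a : ℂ) (η : ℝ) : Tendsto (fun Y : ℝ => a / pt Y η) atTop (𝓝 0) := by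
  rw [tendsto_zero_iff_norm_tendsto_zero]
  simp_rw [norm_div]
  exact (tendsto_norm_pt η).const_div_atTop _

lemma tendsto_one_add_div_pt (δ η : ℝ) :
    Tendsto (fun Y : ℝ => 1 + (δ : ℂ) / pt Y η) atTop (𝓝 1) := by
  simpa using (tendsto_div_pt (δ : ℂ) η).const_add 1

/-- The function `q^{1-s} ((q+δ)^s - q^s)` tends to `sδ` as `q` tends to infinity on a horizontal
ray. -/
lemma tendsto_cpow_mul_sub (s δ η : ℝ) (hδ : 0 ≤ δ) :
    Tendsto (fun Y : ℝ => pt Y η ^ (1 - s : ℂ) * ((pt Y η + δ) ^ (s : ℂ) - pt Y η ^ (s : ℂ))) atTop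
      (𝓝 (s * δ)) := by
  rcases hδ.eq_or_lt with rfl | hδ
  · simp
  have hδ0 : (δ : ℂ) ≠ 0 := by exact_mod_cast hδ.ne'
  have hd : HasDerivAt (fun h : ℂ => (1 + h) ^ (s : ℂ)) s 0 := by
    have := (((hasDerivAt_id (0 : ℂ)).const_add 1).cpow_const (c := (s : ℂ)) (by simp))
    simpa using this
  have ht : Tendsto (fun Y : ℝ => (δ : ℂ) / pt Y η) atTop (𝓝[≠] 0) := by
    refine tendsto_nhdsWithin_iff.mpr ⟨tendsto_div_pt _ _, ?_⟩
    filter_upwards [eventually_gt_atTop 0] with Y hY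
    exact div_ne_zero hδ0 (ne_zero_of_re_pos (by simpa using hY))
  -- The expression is `δ` times the difference quotient of `(1 + h)^s` at `0` with increment `h =
  -- δ/q`.
  have h1 := ((hasDerivAt_iff_tendsto_slope_zero.mp hd).comp ht).mul_const (δ : ℂ)
  refine h1.congr' ?_
  filter_upwards [eventually_gt_atTop 0] with Y hY
  have hq : 0 < (pt Y η).re := by simpa using hY
  have hq0 := ne_zero_of_re_pos hq
  have hqd : 0 < (pt Y η + δ).re := by
    rw [Complex.add_re, Complex.ofReal_re]; linarith
  have e1 := div_cpow_of_re_pos hq hqd s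
  have e2 : (pt Y η + δ) / pt Y η = 1 + δ / pt Y η := by field_simp
  have e3 : pt Y η ^ (1 - s : ℂ) * pt Y η ^ (s : ℂ) = pt Y η := by
    rw [← Complex.cpow_add _ _ hq0]; simp
  rw [e2] at e1
  simp only [Function.comp_apply, zero_add, add_zero, Complex.one_cpow, smul_eq_mul]
  rw [e1, inv_div, div_mul_eq_mul_div, div_mul_cancel₀ _ hδ0]
  linear_combination (-((1 + (δ : ℂ) / pt Y η) ^ (s : ℂ) - 1)) * e3

/-- This passes between the scaling by `q^{1-s}` that comes from `j(z)` and the scaling by `(q +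
1/c²)^{1-s}` natural for the Eichler integral. -/
lemma tendsto_cpow_div (t δ η : ℝ) (hδ : 0 ≤ δ) :
    Tendsto (fun Y : ℝ => pt Y η ^ (t : ℂ) / (pt Y η + δ) ^ (t : ℂ)) atTop (𝓝 1) := by
  have h1 : Tendsto (fun Y : ℝ => ((1 + (δ : ℂ) / pt Y η) ^ (t : ℂ))⁻¹) atTop (𝓝 1) := by
    have hc : ContinuousAt (fun p : ℂ => (p ^ (t : ℂ))⁻¹) 1 :=
      (continuousAt_cpow_const (by simp)).inv₀ (by simp)
    have := hc.tendsto.comp (tendsto_one_add_div_pt δ η)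
    simpa [Function.comp_def] using this
  refine h1.congr' ?_
  filter_upwards [eventually_gt_atTop 0] with Y hY
  have hq : 0 < (pt Y η).re := by simpa using hY
  have hq0 := ne_zero_of_re_pos hq
  have hqd : 0 < (pt Y η + δ).re := by
    rw [Complex.add_re, Complex.ofReal_re]; linarith
  have e1 := div_cpow_of_re_pos hq hqd t
  have e2 : (pt Y η + δ) / pt Y η = 1 + δ / pt Y η := by field_simp
  have e3 : pt Y η ^ (t : ℂ) ≠ 0 := by simp [Complex.cpow_eq_zero_iff, hq0]
  rw [e1, e2, div_mul_eq_div_div, div_self e3, one_div]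

/-- A function with a Fourier expansion in positive powers decays exponentially. -/
lemma exists_norm_holomorphicPart_le (hdec : IsMaassDecomposition ε (1 - s) g gp gm ap am)
    (hap : ∀ n : ℤ, n ≤ 0 → ap n = 0) :
    ∃ K : ℝ, ∀ z : ℍ, 1 ≤ z.im → ‖gp z‖ ≤ K * Real.exp (-z.im) := by
  have hpi := Real.pi_gt_three
  -- Comparison with the series at `i`: for `n ≥ 1` each term shrinks by `e^{-2πn(y-1)} ≤ e^{1-y}`.
  have hI := (hdec.hasSum_hol UpperHalfPlane.I).summable.norm
  refine ⟨Real.exp 1 * ∑' n, ‖ap n * cexp (2 * Real.pi * Complex.I * n * (UpperHalfPlane.I : ℍ))‖,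
    fun z hz => ?_⟩
  have hterm : ∀ n : ℤ, ‖ap n * cexp (2 * Real.pi * Complex.I * n * (z : ℂ))‖ ≤
      Real.exp (1 - z.im) *
        ‖ap n * cexp (2 * Real.pi * Complex.I * n * (UpperHalfPlane.I : ℍ))‖ := by
    intro n
    have e : ∀ w : ℂ, ‖cexp (2 * Real.pi * Complex.I * n * w)‖
        = Real.exp (-(n * (2 * Real.pi * w.im))) := fun w => by
      have := norm_cexp_neg_two_pi (-n) w
      simpa using this
    rcases le_or_gt n 0 with hn | hn
    · simp [hap n hn]
    · have hn1 : (1 : ℝ) ≤ n := by exact_mod_cast hn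
      rw [norm_mul, norm_mul, e, e, mul_left_comm (Real.exp (1 - z.im)), ← Real.exp_add]
      refine mul_le_mul_of_nonneg_left (Real.exp_le_exp.mpr ?_) (norm_nonneg _)
      rw [UpperHalfPlane.coe_im, UpperHalfPlane.coe_I, Complex.I_im]
      nlinarith [mul_nonneg (by linarith : (0 : ℝ) ≤ z.im - 1)
        (by nlinarith : (0 : ℝ) ≤ n * (2 * Real.pi) - 1)]
  rw [← (hdec.hasSum_hol z).tsum_eq]
  have h2 := hI.mul_left (Real.exp (1 - z.im))
  have h1 := h2.of_nonneg_of_le (fun n => norm_nonneg _) hterm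
  refine (norm_tsum_le_tsum_norm h1).trans ((h1.tsum_le_tsum hterm h2).trans_eq ?_)
  rw [tsum_mul_left, sub_eq_add_neg, Real.exp_add]
  ring

lemma tendsto_cpow_mul_holomorphicPart (hdec : IsMaassDecomposition ε (1 - s) g gp gm ap am)
    (hap : ∀ n : ℤ, n ≤ 0 → ap n = 0) (x η t : ℝ) :
    Tendsto (fun Y : ℝ => pt Y η ^ (t : ℂ) * gp (ofComplex (pt x Y))) atTop (𝓝 0) := by
  obtain ⟨K, hK⟩ := exists_norm_holomorphicPart_le hdec hap
  obtain ⟨N, hN⟩ := exists_nat_ge t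
  have h1 : Tendsto (fun Y : ℝ => (Y + |η|) ^ N * Real.exp (-(Y + |η|)) * (Real.exp |η| * K))
      atTop (𝓝 0) := by
    have := ((Real.tendsto_pow_mul_exp_neg_atTop_nhds_zero N).comp
      (tendsto_atTop_add_const_right _ |η| tendsto_id)).mul_const (Real.exp |η| * K)
    simpa using this
  refine squeeze_zero_norm' ?_ h1
  filter_upwards [eventually_ge_atTop 1] with Y hY
  have hq : 0 < (pt Y η).re := by simp; linarith
  have him : 0 < (pt x Y).im := by simp; linarith
  have h2 := hK (ofComplex (pt x Y)) (by
    rw [← UpperHalfPlane.coe_im, coe_ofComplex him, pt_im]; exact hY)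
  rw [← UpperHalfPlane.coe_im, coe_ofComplex him, pt_im] at h2
  have h3 := norm_bounds hq
  rw [pt_re, pt_im] at h3
  have h4 : ‖pt Y η‖ ^ t ≤ (Y + |η|) ^ N := by
    calc ‖pt Y η‖ ^ t ≤ ‖pt Y η‖ ^ (N : ℝ) := Real.rpow_le_rpow_of_exponent_le (by linarith) hN
      _ = ‖pt Y η‖ ^ N := Real.rpow_natCast _ _
      _ ≤ _ := by gcongr; exact h3.2
  rw [norm_mul, norm_cpow_of_re_pos hq]
  have e1 : Real.exp (-(Y + |η|)) * (Real.exp |η| * K) = K * Real.exp (-Y) := by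
    rw [neg_add, Real.exp_add, Real.exp_neg |η|]
    field_simp
  rw [mul_assoc, e1]
  gcongr

end RadialLimits

/-! ### The limit of the holomorphic part in terms of Eichler integrals -/

section RadialLimitMain

variable {ε : ℤˣ} {s : ℝ} {g gp gm : ℍ → ℂ} {ap am : ℤ → ℂ} {γ : SL(2, ℤ)} {u : ℂ}

/-- At this point `j = i/c`. The choice makes `p` tend to `1` for the integral at `γz`, as in the
first series of `Λ_r`, and puts the factor `e^{-2πn/c²}` into the other integral, as in the second.
-/
lemma smul_basePoint (hc : 0 < γ 1 0) :
    ((γ • ofComplex (pt (-(γ 1 1 / γ 1 0)) (1 / (γ 1 0 : ℝ) ^ 2)) : ℍ) : ℂ)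
      = pt (γ 0 0 / γ 1 0) 1 := by
  have hc' : (0 : ℝ) < γ 1 0 := by exact_mod_cast hc
  have hc0 : (γ 1 0 : ℂ) ≠ 0 := by exact_mod_cast hc.ne'
  have him : 0 < (pt (-(γ 1 1 / γ 1 0)) (1 / (γ 1 0 : ℝ) ^ 2)).im := by rw [pt_im]; positivity
  have h1 : autFactor γ (ofComplex (pt (-(γ 1 1 / γ 1 0)) (1 / (γ 1 0 : ℝ) ^ 2)))
      = Complex.I / γ 1 0 := by
    rw [autFactor_ofComplex γ him, pt]
    push_cast
    field_simp
    ring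
  have hdet := det_eq_one' γ
  rw [coe_smul_eq, h1, coe_ofComplex him, pt, pt]
  push_cast
  have hI := Complex.I_ne_zero
  field_simp
  linear_combination (-(γ 1 0 : ℂ)) * hdet + (-(γ 1 0 : ℂ)) * Complex.I_sq

lemma coe_smul_eq_sub (hc : 0 < γ 1 0) (z : ℍ) :
    ((γ • z : ℍ) : ℂ) = γ 0 0 / γ 1 0 - 1 / (γ 1 0 * autFactor γ z) := by
  have hc0 : (γ 1 0 : ℂ) ≠ 0 := by exact_mod_cast hc.ne'
  have hdet := det_eq_one' γ
  have h0 := autFactor_ne_zero γ z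
  rw [coe_smul_eq]
  field_simp
  rw [autFactor]
  linear_combination -hdet

/-- Writing `j = i c q` with `Re q > 0` splits the power `j^{1-s}` without a jump of the argument
(`I_mul_cpow`) and exposes the variable `q` of the subtracted term. -/
lemma autFactor_eq_I_mul (hc : 0 < γ 1 0) (x Y : ℝ) : (γ 1 0 : ℂ) * pt x Y + γ 1 1
    = Complex.I * (γ 1 0 : ℝ) * pt Y (-(x + γ 1 1 / γ 1 0)) := by
  have hc0 : (γ 1 0 : ℂ) ≠ 0 := by exact_mod_cast hc.ne'
  simp only [pt]
  push_cast
  field_simp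
  linear_combination ((γ 1 0 : ℂ) * x + γ 1 1) * Complex.I_sq

lemma kvar_basePoint (x Y : ℝ) : kvar (pt x Y) (pt (-(γ 1 1 / γ 1 0)) (1 / (γ 1 0 : ℝ) ^ 2))
    = pt Y (-(x + γ 1 1 / γ 1 0)) + ((1 / (γ 1 0 : ℝ) ^ 2 : ℝ) : ℂ) := by
  simp only [kvar, pt, map_add, map_mul, Complex.conj_ofReal, Complex.conj_I]
  push_cast
  linear_combination (-(Y : ℂ) - 1 / (γ 1 0 : ℂ) ^ 2) * Complex.I_sq

lemma tendsto_smul_atTop (hc : 0 < γ 1 0) (x : ℝ) :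
    Tendsto (fun Y : ℝ => ((γ • ofComplex (pt x Y) : ℍ) : ℂ)) atTop
      (𝓝[{z : ℂ | 0 < z.im}] ((γ 0 0 / γ 1 0 : ℝ) : ℂ)) := by
  have hc0 : (γ 1 0 : ℂ) ≠ 0 := by exact_mod_cast hc.ne'
  refine tendsto_nhdsWithin_iff.mpr ⟨?_, Eventually.of_forall fun Y => (γ • ofComplex (pt x Y)).im_pos⟩
  have h1 := (tendsto_div_pt (1 / (Complex.I * (γ 1 0) ^ 2)) (-(x + γ 1 1 / γ 1 0))).const_sub
    ((γ 0 0 / γ 1 0 : ℝ) : ℂ)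
  rw [sub_zero] at h1
  refine h1.congr' ?_
  filter_upwards [eventually_gt_atTop 0] with Y hY
  have him : 0 < (pt x Y).im := by simpa using hY
  have hq0 := ne_zero_of_re_pos (p := pt Y (-(x + γ 1 1 / γ 1 0))) (by simpa using hY)
  rw [coe_smul_eq_sub hc, autFactor_ofComplex γ him, autFactor_eq_I_mul hc]
  push_cast
  have hI := Complex.I_ne_zero
  field_simp

/-- The limit of the holomorphic part along the image of a vertical line, in terms of the
Eichler integrals. -/
theorem tendsto_holomorphicPart_smul (hG : ContDiffOn ℝ ∞ (ext g) {z : ℂ | 0 < z.im})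
    (hdec : IsMaassDecomposition ε (1 - s) g gp gm ap am) (hs : s ≠ 0) (hc : 0 < γ 1 0)
    (hg : ∀ z, g (γ • z) = u * autFactor γ z ^ (1 - s : ℂ) * g z)
    (hap : ∀ n : ℤ, n ≤ 0 → ap n = 0) (x : ℝ) :
    Tendsto (fun Y : ℝ => gp (γ • ofComplex (pt x Y)) -
      u * conj (shadowCoeff ε s am 0) / ((2 : ℂ) ^ (s : ℂ) * s) *
        ((γ 1 0 : ℂ) * pt x Y + γ 1 1) ^ (1 - s : ℂ) *
        (pt Y (-(x + γ 1 1 / γ 1 0)) + ((1 / (γ 1 0 : ℝ) : ℝ) : ℂ)) ^ (s : ℂ)) atTop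
      (𝓝 (u * (Complex.I ^ (1 - s : ℂ) * (γ 1 0 : ℂ) ^ (1 - s : ℂ)) *
        ((∑' n, cuspTerm ε s am (pt (-(γ 1 1 / γ 1 0)) (1 / (γ 1 0 : ℝ) ^ 2)) n) +
          conj (shadowCoeff ε s am 0) * (2 : ℂ) ^ (-s : ℂ) * (1 / (γ 1 0 : ℂ) ^ 2 - 1 / γ 1 0))
        - eichler ε s am ((γ 0 0 / γ 1 0 : ℝ) : ℂ) 1)) := by
  have hc' : (0 : ℝ) < γ 1 0 := by exact_mod_cast hc
  have hs' : (s : ℂ) ≠ 0 := by exact_mod_cast hs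
  set η : ℝ := -(x + γ 1 1 / γ 1 0) with hη
  set w : ℂ := pt (-(γ 1 1 / γ 1 0)) (1 / (γ 1 0 : ℝ) ^ 2) with hw
  have hwim : 0 < w.im := by rw [hw, pt_im]; positivity
  set δ₁ : ℝ := 1 / (γ 1 0 : ℝ) ^ 2 with hδ₁
  set δ₂ : ℝ := 1 / (γ 1 0 : ℝ) with hδ₂
  have hδ₁0 : 0 ≤ δ₁ := by positivity
  have hδ₂0 : 0 ≤ δ₂ := by positivity
  set b₀ := shadowCoeff ε s am 0
  -- The four contributions: `g⁺` at `z`, the integral at `z` without its term `n = 0`, that term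
  -- against the subtracted power, and the integral at `γz`.
  have l1 := tendsto_cpow_mul_holomorphicPart hdec hap x η (1 - s)
  have l2 := (tendsto_cpow_div (1 - s) δ₁ η hδ₁0).mul (tendsto_eichler_at_infty hG hdec hs x hwim)
  have l3 := (tendsto_cpow_mul_sub s δ₁ η hδ₁0).sub (tendsto_cpow_mul_sub s δ₂ η hδ₂0)
  have l4 := (tendsto_eichler_at_real hG hdec hs (γ 0 0 / γ 1 0)).comp (tendsto_smul_atTop hc x)
  have l5 := (((l1.add l2).add (l3.const_mul (conj b₀ * (2 : ℂ) ^ (-s : ℂ) / s))).const_mul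
    (u * (Complex.I ^ (1 - s : ℂ) * (γ 1 0 : ℂ) ^ (1 - s : ℂ)))).sub l4
  have e0 : 0 + 1 * ∑' n, cuspTerm ε s am w n +
      conj b₀ * (2 : ℂ) ^ (-s : ℂ) / s * (s * δ₁ - s * δ₂) =
      (∑' n, cuspTerm ε s am w n) +
        conj b₀ * (2 : ℂ) ^ (-s : ℂ) * (1 / (γ 1 0 : ℂ) ^ 2 - 1 / γ 1 0) := by
    rw [hδ₁, hδ₂]
    push_cast
    field_simp
    ring
  rw [e0] at l5
  refine l5.congr' ?_
  filter_upwards [eventually_gt_atTop 0] with Y hY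
  have him : 0 < (pt x Y).im := by simpa using hY
  have hq : 0 < (pt Y η).re := by simpa using hY
  have hp : 0 < (pt Y η + (δ₁ : ℂ)).re := by
    rw [Complex.add_re, Complex.ofReal_re]; linarith
  have hpc : (pt Y η + (δ₁ : ℂ)) ^ (1 - s : ℂ) ≠ 0 := by
    simp [Complex.cpow_eq_zero_iff, ne_zero_of_re_pos hp]
  have k1 := holomorphicPart_smul hG hdec hs hc hg (ofComplex (pt x Y)) (ofComplex w)
  have k2 : ((γ • ofComplex w : ℍ) : ℂ) = pt (γ 0 0 / γ 1 0) 1 := smul_basePoint hc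
  rw [k2, autFactor_ofComplex γ him, coe_ofComplex hwim, coe_ofComplex him, kvar_basePoint] at k1
  have k3 : ((γ 1 0 : ℂ) * pt x Y + γ 1 1) ^ (1 - s : ℂ) =
      Complex.I ^ (1 - s : ℂ) * (γ 1 0 : ℂ) ^ (1 - s : ℂ) * pt Y η ^ (1 - s : ℂ) := by
    rw [autFactor_eq_I_mul hc, I_mul_cpow hc' hq]
    norm_cast
  have k4 : Summable (eichlerTerm ε s am (pt x Y) (pt Y η + (δ₁ : ℂ))) := by
    have := (summable_hasDerivAt_eichler hG hdec hs (ofComplex (pt x Y))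
      (p := pt Y η + (δ₁ : ℂ)) ?_).1
    · rwa [coe_ofComplex him] at this
    · rw [← UpperHalfPlane.coe_im, coe_ofComplex him, Complex.add_re, pt_im, pt_re,
        Complex.ofReal_re]
      have : 0 < δ₁ := by positivity
      linarith
  -- Only the term `n = 0` is unbounded after scaling; it is a multiple of `(q + 1/c²)^s` and has to
  -- be compared with `(q + 1/c)^s`.
  have k5 : eichler ε s am (pt x Y) (pt Y η + (δ₁ : ℂ)) =
      conj b₀ * (2 : ℂ) ^ (-s : ℂ) / s * (pt Y η + (δ₁ : ℂ)) ^ (s : ℂ) +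
      ∑' n : ℤ, if n = 0 then 0 else eichlerTerm ε s am (pt x Y) (pt Y η + (δ₁ : ℂ)) n := by
    rw [eichler, k4.tsum_eq_add_tsum_ite 0]
    congr 1
    rw [eichlerTerm, gammaExt_zero ε hs hp]
    simp only [Int.cast_zero, mul_zero, zero_mul, neg_zero, Complex.exp_zero]
    ring
  have k6 : (∑' n : ℤ, if n = 0 then 0 else (pt Y η + (δ₁ : ℂ)) ^ (1 - s : ℂ) *
      eichlerTerm ε s am (pt x Y) (pt Y η + (δ₁ : ℂ)) n) = (pt Y η + (δ₁ : ℂ)) ^ (1 - s : ℂ) *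
      ∑' n : ℤ, if n = 0 then 0 else eichlerTerm ε s am (pt x Y) (pt Y η + (δ₁ : ℂ)) n := by
    rw [← tsum_mul_left]
    refine tsum_congr fun n => ?_
    split_ifs <;> simp
  have k7 : pt Y η ^ (1 - s : ℂ) / (pt Y η + (δ₁ : ℂ)) ^ (1 - s : ℂ) *
      (pt Y η + (δ₁ : ℂ)) ^ (1 - s : ℂ) = pt Y η ^ (1 - s : ℂ) := div_mul_cancel₀ _ hpc
  simp only [Function.comp_apply, Complex.ofReal_sub, Complex.ofReal_one]
  rw [k1, k3, k5, kvar_basePoint, k6, ← mul_assoc (_ / _), k7, Complex.cpow_neg]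
  field_simp
  ring

end RadialLimitMain

/-! ### The expansion at an equivalent cusp -/

lemma isCoprime_column (γ : SL(2, ℤ)) : IsCoprime (γ 0 0) (γ 1 0) := by
  have h := det_eq_one γ
  exact ⟨γ 1 1, -γ 0 1, by linear_combination h⟩

/-- Two matrices that send `∞` to the same rational number differ by a sign and a translation. -/
lemma exists_eq_translate {σ γ : SL(2, ℤ)} (hσ : σ 1 0 ≠ 0) (hγ : γ 1 0 ≠ 0)
    (h : (σ 0 0 : ℚ) / (σ 1 0 : ℚ) = (γ 0 0 : ℚ) / (γ 1 0 : ℚ)) :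
    ∃ e j : ℤ, (e = 1 ∨ e = -1) ∧ σ 0 0 = e * γ 0 0 ∧ σ 1 0 = e * γ 1 0 ∧
      σ 0 1 = e * (γ 0 1 + j * γ 0 0) ∧ σ 1 1 = e * (γ 1 1 + j * γ 1 0) := by
  have h1 : σ 0 0 * γ 1 0 = γ 0 0 * σ 1 0 := by
    rw [div_eq_div_iff (by exact_mod_cast hσ) (by exact_mod_cast hγ)] at h
    exact_mod_cast h
  have h2 : σ 1 0 ∣ γ 1 0 :=
    (isCoprime_column σ).symm.dvd_of_dvd_mul_left ⟨γ 0 0, by linear_combination h1⟩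
  have h3 : γ 1 0 ∣ σ 1 0 :=
    (isCoprime_column γ).symm.dvd_of_dvd_mul_left ⟨σ 0 0, by linear_combination -h1⟩
  have h4 : σ 1 0 = γ 1 0 ∨ σ 1 0 = -γ 1 0 :=
    Int.natAbs_eq_natAbs_iff.mp (Nat.dvd_antisymm (Int.natAbs_dvd_natAbs.mpr h2)
      (Int.natAbs_dvd_natAbs.mpr h3))
  obtain ⟨e, he, he1⟩ : ∃ e : ℤ, (e = 1 ∨ e = -1) ∧ σ 1 0 = e * γ 1 0 := by
    rcases h4 with h4 | h4
    · exact ⟨1, Or.inl rfl, by rw [h4]; ring⟩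
    · exact ⟨-1, Or.inr rfl, by rw [h4]; ring⟩
  have hee : e * e = 1 := by rcases he with rfl | rfl <;> norm_num
  have h5 : σ 0 0 = e * γ 0 0 := by
    apply mul_right_cancel₀ hγ
    rw [h1, he1]; ring
  have d1 := det_eq_one σ
  have d2 := det_eq_one γ
  rw [he1, h5] at d1
  have h6 : γ 0 0 * (e * σ 1 1 - γ 1 1) = γ 1 0 * (e * σ 0 1 - γ 0 1) := by
    linear_combination d1 - d2
  obtain ⟨j, hj⟩ : γ 1 0 ∣ e * σ 1 1 - γ 1 1 :=
    (isCoprime_column γ).symm.dvd_of_dvd_mul_left ⟨_, h6⟩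
  have h7 : e * σ 0 1 - γ 0 1 = j * γ 0 0 := by
    apply mul_left_cancel₀ hγ
    rw [← h6, hj]; ring
  refine ⟨e, j, he, h5, he1, ?_, ?_⟩
  · linear_combination e * h7 - σ 0 1 * hee
  · linear_combination e * hj - σ 1 1 * hee

/-- For `σ = -γT^j` the sign changes the principal power of the automorphy factor by `e^{πik}`. By
`neg_intCast_cpow` the power `c'^k` changes by the same phase, so the `L`-function does not notice.
-/
lemma neg_cpow_neg_mul {ζ : ℂ} (hζ : 0 < ζ.im) (k : ℂ) :
    (-ζ) ^ (-k) * ζ ^ k = cexp (Real.pi * Complex.I * k) := by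
  have h0 : ζ ≠ 0 := by rintro rfl; simp at hζ
  have hlog : Complex.log (-ζ) = Complex.log ζ - Real.pi * Complex.I := by
    rw [Complex.log, Complex.log, norm_neg, Complex.arg_neg_eq_arg_sub_pi_of_im_pos hζ]
    push_cast
    ring
  rw [Complex.cpow_def_of_ne_zero (neg_ne_zero.mpr h0), Complex.cpow_def_of_ne_zero h0,
    ← Complex.exp_add, hlog]
  congr 1
  ring

lemma neg_intCast_cpow {c : ℤ} (hc : 0 < c) (k : ℂ) :
    (-(c : ℂ)) ^ k = cexp (Real.pi * Complex.I * k) * (c : ℂ) ^ k := by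
  have h0 : (c : ℂ) ≠ 0 := by exact_mod_cast hc.ne'
  have hc' : (0 : ℝ) < c := by exact_mod_cast hc
  have hlog : Complex.log (-(c : ℂ)) = Complex.log c + Real.pi * Complex.I := by
    have e : (-(c : ℂ)) = ((-(c : ℝ) : ℝ) : ℂ) := by push_cast; rfl
    have e' : (c : ℂ) = ((c : ℝ) : ℂ) := by push_cast; rfl
    rw [e, e', Complex.log, Complex.log, Complex.arg_ofReal_of_neg (by linarith),
      Complex.arg_ofReal_of_nonneg hc'.le, Complex.ofReal_neg, norm_neg]
    simp
  rw [Complex.cpow_def_of_ne_zero (neg_ne_zero.mpr h0), Complex.cpow_def_of_ne_zero h0,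
    ← Complex.exp_add, hlog]
  congr 1
  ring

section Cusp

variable {k v : ℂ} {h : ℍ → ℂ} {r : ℚ} {γ : SL(2, ℤ)} {b : ℤ → ℂ}

lemma hasSum_vadd (hb : ∀ z : ℍ, HasSum (fun n : ℤ => b n * cexp (2 * Real.pi * Complex.I * n * z))
    (h z)) (j : ℤ) (z : ℍ) : h ((j : ℝ) +ᵥ z) = h z := by
  refine (hb _).unique ((hb z).congr_fun fun n => ?_)
  rw [UpperHalfPlane.coe_vadd, mul_add, Complex.exp_add]
  have := fexp_int n j
  rw [fexp] at this
  rw [show cexp (2 * Real.pi * Complex.I * n * ((j : ℝ) : ℂ)) = 1 by exact_mod_cast this, one_mul]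

/-- Since `σ = ±γT^j`, modularity under `γ` and periodicity under `T` reduce the expansion at `r` to
`h` itself. The phase `E` from the sign also appears in `c'^k`, and the shift `j` only changes
`d'/c'` by an integer. -/
lemma CuspExpansion.exists_atCusp_eq (D : CuspExpansion k h r) (hc : 0 < γ 1 0)
    (hr : r = (γ 0 0 : ℚ) / (γ 1 0 : ℚ))
    (hv : ∀ z, h (γ • z) = v * autFactor γ z ^ k * h z)
    (hb : ∀ z : ℍ, HasSum (fun n : ℤ => b n * cexp (2 * Real.pi * Complex.I * n * z)) (h z)) :
    ∃ (E : ℂ) (j : ℤ), E ≠ 0 ∧ (D.σ 1 0 : ℂ) ^ k = E * (γ 1 0 : ℂ) ^ k ∧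
      (D.σ 1 0) ^ 2 = (γ 1 0) ^ 2 ∧
      (D.σ 1 1 : ℂ) / (D.σ 1 0 : ℂ) = γ 1 1 / γ 1 0 + j ∧
      ∀ z, atCusp k h D.σ z = E * v * h z := by
  obtain ⟨e, j, he, h00, h10, h01, h11⟩ := exists_eq_translate D.c_ne_zero hc.ne'
    (D.cusp_eq.symm.trans hr)
  have hc0 : (γ 1 0 : ℂ) ≠ 0 := by exact_mod_cast hc.ne'
  have hee : e * e = 1 := by rcases he with rfl | rfl <;> norm_num
  have he0 : (e : ℂ) ≠ 0 := by rcases he with rfl | rfl <;> norm_num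
  have hfac : ∀ z : ℍ, autFactor D.σ z = e * autFactor γ ((j : ℝ) +ᵥ z) := by
    intro z
    rw [autFactor, autFactor, h10, h11, UpperHalfPlane.coe_vadd]
    push_cast
    ring
  have hsmul : ∀ z : ℍ, D.σ • z = γ • ((j : ℝ) +ᵥ z) := by
    intro z
    apply UpperHalfPlane.ext
    have h0 := autFactor_ne_zero γ ((j : ℝ) +ᵥ z)
    rw [coe_smul_eq, coe_smul_eq, hfac, h00, h01, UpperHalfPlane.coe_vadd]
    push_cast
    field_simp
    ring
  have hat : ∀ (E : ℂ), (∀ ζ : ℂ, 0 < ζ.im → (e * ζ) ^ (-k) * ζ ^ k = E) →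
      ∀ z, atCusp k h D.σ z = E * v * h z := by
    intro E hE z
    rw [atCusp, hfac, hsmul, hv, hasSum_vadd hb, ← hE _ (autFactor_im_pos hc ((j : ℝ) +ᵥ z))]
    ring
  have hq : (D.σ 1 1 : ℂ) / (D.σ 1 0 : ℂ) = γ 1 1 / γ 1 0 + j := by
    rw [h10, h11]
    push_cast
    field_simp
  have hsq : (D.σ 1 0) ^ 2 = (γ 1 0) ^ 2 := by
    rw [h10]; linear_combination (γ 1 0) ^ 2 * hee
  rcases he with rfl | rfl
  · refine ⟨1, j, one_ne_zero, by rw [h10]; simp, hsq, hq, hat 1 fun ζ hζ => ?_⟩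
    have h0 : ζ ≠ 0 := by rintro rfl; simp at hζ
    rw [Int.cast_one, one_mul, ← Complex.cpow_add _ _ h0]
    simp
  · refine ⟨cexp (Real.pi * Complex.I * k), j, Complex.exp_ne_zero _, ?_, hsq, hq,
      hat _ fun ζ hζ => ?_⟩
    · rw [h10, ← neg_intCast_cpow hc]
      push_cast
      congr 1
      ring
    · rw [← neg_cpow_neg_mul hζ]
      push_cast
      congr 2
      ring

/-- A nonzero function with integer period cannot acquire a nontrivial phase `e^{2πiκ}` under a
translation by the integer width. -/
lemma CuspExpansion.kappa_eq_zero (D : CuspExpansion k h r) {E : ℂ} (hE : E ≠ 0)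
    (hat : ∀ z, atCusp k h D.σ z = E * h z)
    (hb : ∀ z : ℍ, HasSum (fun n : ℤ => b n * cexp (2 * Real.pi * Complex.I * n * z)) (h z))
    (hh : h ≠ 0) : D.κ = 0 := by
  obtain ⟨z, hz⟩ := Function.ne_iff.mp hh
  have h1 := D.quasiperiodic z
  rw [hat, hat] at h1
  have h2 := hasSum_vadd hb D.width z
  rw [Int.cast_natCast] at h2
  rw [h2] at h1
  have h3 : cexp (2 * Real.pi * Complex.I * D.κ) = 1 :=
    (mul_eq_right₀ (mul_ne_zero hE hz)).mp h1.symm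
  obtain ⟨n, hn⟩ := Complex.exp_eq_one_iff.mp h3
  have h4 : D.κ = n := by
    have : (2 * Real.pi * Complex.I : ℂ) ≠ 0 := Complex.two_pi_I_ne_zero
    have h5 : (D.κ : ℂ) = n := by
      apply mul_left_cancel₀ this
      rw [hn]; ring
    exact_mod_cast h5
  have h6 := D.κ_nonneg
  have h7 := D.κ_lt_one
  rw [h4] at h6 h7 ⊢
  have h8 : n < 1 := by exact_mod_cast h7
  have h9 : 0 ≤ n := by exact_mod_cast h6
  have : n = 0 := by omega
  simp [this]

/-- The coefficients of the expansion at an equivalent cusp are those at infinity. -/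
lemma CuspExpansion.coeff_eq (D : CuspExpansion k h r) {E : ℂ} (hκ : D.κ = 0)
    (hat : ∀ z, atCusp k h D.σ z = E * h z)
    (hb : ∀ z : ℍ, HasSum (fun n : ℤ => b n * cexp (2 * Real.pi * Complex.I * n * z)) (h z)) :
    (∀ n : ℤ, D.coeff (D.width * n) = E * b n) ∧
      ∀ n : ℤ, n ∉ Set.range (fun m : ℤ => D.width * m) → D.coeff n = 0 := by
  have hl : (0 : ℝ) < D.width := by exact_mod_cast D.width_pos
  have hl0 : (D.width : ℂ) ≠ 0 := by exact_mod_cast D.width_pos.ne'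
  have hlz : (D.width : ℤ) ≠ 0 := by exact_mod_cast D.width_pos.ne'
  have hinj : Function.Injective (fun m : ℤ => D.width * m) := mul_right_injective₀ hlz
  -- A function of period one, expanded with period `width`, has only frequencies that are multiples
  -- of `width`. The factor `e^{-2πm}` appears because coefficients are read off at height one.
  set c : ℤ → ℂ := Function.extend (fun m : ℤ => D.width * m)
    (fun m => E * b m * cexp (-(2 * Real.pi * m))) 0 with hcdef
  have hc1 : ∀ m : ℤ, c (D.width * m) = E * b m * cexp (-(2 * Real.pi * m)) := fun m =>
    hinj.extend_apply _ _ m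
  have hc2 : ∀ n : ℤ, n ∉ Set.range (fun m : ℤ => D.width * m) → c n = 0 := fun n hn =>
    Function.extend_apply' _ _ _ (by simpa using hn)
  have hsum : ∀ x : ℝ, HasSum (fun n => c n * fexp n (x / D.width))
      (atCusp k h D.σ (ofComplex ((x : ℂ) + Complex.I))) := by
    intro x
    have him : 0 < ((x : ℂ) + Complex.I).im := by simp
    rw [hat]
    rw [← hinj.hasSum_iff]
    · refine ((hb (ofComplex ((x : ℂ) + Complex.I))).mul_left E).congr_fun fun m => ?_
      rw [Function.comp_apply, hc1, coe_ofComplex him, fexp, mul_assoc, mul_assoc, ← Complex.exp_add]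
      congr 3
      push_cast
      field_simp
      linear_combination (-(m : ℂ)) * Complex.I_sq
    · intro n hn
      rw [hc2 n hn, zero_mul]
  have hcoeff : ∀ n, D.coeff n = cexp (2 * Real.pi * n / D.width) * c n := by
    intro n
    rw [← integral_of_hasSum_fexp hl hsum n, CuspExpansion.coeff, fourierCoeff, hκ, mul_left_comm,
      ← intervalIntegral.integral_const_mul (cexp _), Complex.ofReal_natCast]
    congr 1
    refine intervalIntegral.integral_congr fun x _ => ?_
    rw [mul_left_comm, fexp, ← Complex.exp_add]
    congr 2
    push_cast
    field_simp
    linear_combination (-(n : ℂ)) * Complex.I_sq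
  refine ⟨fun n => ?_, fun n hn => by rw [hcoeff, hc2 n hn, mul_zero]⟩
  rw [hcoeff, hc1, mul_left_comm, ← Complex.exp_add]
  have : (2 * Real.pi * ((D.width * n : ℤ) : ℂ) / D.width + -(2 * Real.pi * n) : ℂ) = 0 := by
    push_cast
    field_simp
    ring
  rw [this, Complex.exp_zero, mul_one]

lemma CuspExpansion.coeff_eq_zero (D : CuspExpansion k h r) {E : ℂ}
    (hat : ∀ z, atCusp k h D.σ z = E * h z) (hh : h = 0) (n : ℤ) : D.coeff n = 0 := by
  have h0 : ∀ z, atCusp k h D.σ z = 0 := fun z => by rw [hat, hh, Pi.zero_apply, mul_zero]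
  rw [CuspExpansion.coeff, fourierCoeff]
  simp [h0]

/-- The terms of the series over the coefficients at the cusp, for `s = k - 1`. -/
def cuspSeriesTerm (b : ℤ → ℂ) (γ : SL(2, ℤ)) (n : ℤ) : ℂ :=
  if n = 0 then 0 else
    b n * cexp (-(2 * Real.pi * Complex.I * n * (γ 1 1 / γ 1 0))) / n *
      cexp (-(2 * Real.pi * n / (γ 1 0) ^ 2))

/-- At `s = k - 1` the exponent `k - s` is `1`: the power is `n` itself and the gamma factor is an
exponential, both independent of the branch. The integer shift `j` disappears in `e^{2πinj} = 1`. -/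
lemma termCusp_width_mul (ε : ℤˣ) (D : CuspExpansion k h r) {E : ℂ} {j : ℤ} (hκ : D.κ = 0)
    (hγ : γ 1 0 ≠ 0) (hsq : (D.σ 1 0) ^ 2 = (γ 1 0) ^ 2)
    (hq : (D.σ 1 1 : ℂ) / (D.σ 1 0 : ℂ) = γ 1 1 / γ 1 0 + j)
    (hcoeff : ∀ n : ℤ, D.coeff (D.width * n) = E * b n) (n : ℤ) :
    termCusp ε D (k - 1) (D.width * n) = E * cuspSeriesTerm b γ n := by
  have hl : (0 : ℝ) < D.width := by exact_mod_cast D.width_pos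
  have hl0 : (D.width : ℂ) ≠ 0 := by exact_mod_cast D.width_pos.ne'
  have hlr : (D.width : ℝ) ≠ 0 := hl.ne'
  have hc0 : (γ 1 0 : ℂ) ≠ 0 := by exact_mod_cast hγ
  have hcr : (γ 1 0 : ℝ) ≠ 0 := by exact_mod_cast hγ
  rw [termCusp, cuspSeriesTerm, hκ]
  by_cases hn : n = 0
  · simp [hn]
  have hnr : (n : ℝ) ≠ 0 := by exact_mod_cast hn
  have hsq' : (D.σ 1 0 : ℝ) ^ 2 = (γ 1 0 : ℝ) ^ 2 := by exact_mod_cast hsq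
  have e1 : (((D.width * n : ℤ) : ℝ) + 0) / D.width = n := by
    push_cast; field_simp; ring
  have e2 : 2 * Real.pi * (((D.width * n : ℤ) : ℝ) + 0) / ((D.σ 1 0 : ℝ) ^ 2 * D.width)
      = 2 * Real.pi * n / (γ 1 0 : ℝ) ^ 2 := by
    rw [hsq']; push_cast; field_simp; ring
  have e3 : k - (k - 1) = 1 := by ring
  have e4 : cexp (2 * Real.pi * Complex.I * (((D.width * n : ℤ) : ℂ) + ((0 : ℝ) : ℂ)) *
      (-((D.σ 1 1 : ℂ) / (D.σ 1 0 : ℂ))) / D.width)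
      = cexp (-(2 * Real.pi * Complex.I * n * (γ 1 1 / γ 1 0))) := by
    have h1 := fexp_int (-n) j
    rw [fexp] at h1
    rw [← mul_one (cexp (-(2 * Real.pi * Complex.I * n * (γ 1 1 / γ 1 0)))), ← h1,
      ← Complex.exp_add, hq]
    congr 1
    push_cast
    field_simp
    ring
  have e5 : ((D.width * n : ℤ) : ℝ) + 0 ≠ 0 := by
    push_cast
    rw [add_zero]
    positivity
  rw [if_neg e5, if_neg hn, e1, e2, e3, e4, hcoeff, brPow_one, incGamma_one _ (by positivity)]
  push_cast
  ring

theorem CuspExpansion.tsum_termCusp (ε : ℤˣ) (D : CuspExpansion k h r) (hc : 0 < γ 1 0)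
    (hr : r = (γ 0 0 : ℚ) / (γ 1 0 : ℚ)) (hv0 : v ≠ 0)
    (hv : ∀ z, h (γ • z) = v * autFactor γ z ^ k * h z)
    (hb : ∀ z : ℍ, HasSum (fun n : ℤ => b n * cexp (2 * Real.pi * Complex.I * n * z)) (h z))
    (hb0 : h = 0 → b = 0) (hsum : Summable fun n => ‖cuspSeriesTerm b γ n‖) :
    ∃ E : ℂ, E ≠ 0 ∧ (D.σ 1 0 : ℂ) ^ k = E * (γ 1 0 : ℂ) ^ k ∧
      (D.σ 1 0 : ℂ) ^ 2 = (γ 1 0 : ℂ) ^ 2 ∧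
      Summable (fun n => ‖termCusp ε D (k - 1) n‖) ∧
      ∑' n, termCusp ε D (k - 1) n = E * v * ∑' n, cuspSeriesTerm b γ n ∧
      D.coeff 0 = E * v * b 0 ∧ (D.κ ≠ 0 → b 0 = 0) := by
  obtain ⟨E, j, hE, hpow, hsq, hq, hat⟩ := D.exists_atCusp_eq hc hr hv hb
  have hsq' : (D.σ 1 0 : ℂ) ^ 2 = (γ 1 0 : ℂ) ^ 2 := by exact_mod_cast hsq
  refine ⟨E, hE, hpow, hsq', ?_⟩
  -- If `h = 0`, any `κ` is admissible, but all coefficients vanish. Otherwise `κ = 0`.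
  by_cases hh : h = 0
  · have h0 := D.coeff_eq_zero hat hh
    have hb' := hb0 hh
    have ht : ∀ n, termCusp ε D (k - 1) n = 0 := fun n => by
      rw [termCusp, h0]; simp
    simp only [ht, h0, hb', cuspSeriesTerm]
    simp [summable_zero]
  · have hκ := D.kappa_eq_zero (mul_ne_zero hE hv0) hat hb hh
    obtain ⟨hc1, hc2⟩ := D.coeff_eq hκ hat hb
    have hlz : (D.width : ℤ) ≠ 0 := by exact_mod_cast D.width_pos.ne'
    have hinj : Function.Injective (fun m : ℤ => D.width * m) := mul_right_injective₀ hlz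
    have ht1 := termCusp_width_mul ε D hκ hc.ne' hsq hq hc1
    have ht2 : ∀ n : ℤ, n ∉ Set.range (fun m : ℤ => D.width * m) → termCusp ε D (k - 1) n = 0 := by
      intro n hn
      rw [termCusp, hc2 n hn]
      simp
    refine ⟨?_, ?_, ?_, fun h => absurd hκ h⟩
    · rw [← hinj.summable_iff (fun n hn => by rw [ht2 n hn, norm_zero])]
      refine (hsum.mul_left ‖E * v‖).congr fun n => ?_
      rw [Function.comp_apply, ht1]
      exact (norm_mul _ _).symm
    · rw [← tsum_mul_left, ← hinj.tsum_eq]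
      · exact tsum_congr ht1
      · intro n hn
        by_contra h
        exact hn (ht2 n h)
    · have := hc1 0
      rwa [mul_zero] at this

end Cusp

section LFunction

variable {ε : ℤˣ} {s : ℝ} {g gp gm : ℍ → ℂ} {ap am : ℤ → ℂ} {γ : SL(2, ℤ)} {u : ℂ} {r : ℚ}

/-! ### The regularized `L`-function at `k - 1` -/

lemma xi_eq_zero_imp (hG : ContDiffOn ℝ ∞ (ext g) {z : ℂ | 0 < z.im})
    (hdec : IsMaassDecomposition ε (1 - s) g gp gm ap am) (hs : s ≠ 0)
    (h : xi (1 - s) g = 0) : shadowCoeff ε s am = 0 := by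
  funext n
  rw [← coeffInfty_xi hG hdec hs, h, coeffInfty, fourierCoeff]
  simp

lemma conj_ofReal_mul_cpow {c : ℝ} (hc : 0 < c) (t : ℝ) :
    conj ((c : ℂ) ^ (t : ℂ)) = (c : ℂ) ^ (t : ℂ) := by
  rw [conj_ofReal_cpow hc, Complex.conj_ofReal]

lemma conj_I_cpow (t : ℝ) : conj (Complex.I ^ (t : ℂ)) = (-Complex.I) ^ (t : ℂ) := by
  rw [conj_cpow_of_im_pos (by simp), Complex.conj_I]

/-- This links the conjugate of `i^k` in `Λ_r` with the power `i^{2-k}` coming from `j(z)^{2-k}`. -/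
lemma neg_I_cpow (s : ℂ) : (-Complex.I) ^ (s + 1) = -Complex.I ^ (1 - s) := by
  rw [Complex.cpow_def_of_ne_zero (neg_ne_zero.mpr Complex.I_ne_zero),
    Complex.cpow_def_of_ne_zero Complex.I_ne_zero, Complex.log_neg_I, Complex.log_I,
    neg_eq_neg_one_mul (cexp _), ← Complex.exp_neg_pi_mul_I, ← Complex.exp_add]
  congr 1
  ring

lemma four_pi_cpow_mul_gammaExtOne (ε : ℤˣ) (s : ℝ) {n : ℤ} (hn : n ≠ 0) :
    (4 * Real.pi : ℂ) ^ (s : ℂ) * gammaExtOne ε s n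
      = incGamma ε s (2 * Real.pi * n) / brPow ε n s := by
  have hn' : (n : ℝ) ≠ 0 := by exact_mod_cast hn
  have hpi := Real.pi_pos
  have h1 := brPow_neg_mul ε hn' s
  have h2 : ((4 * Real.pi : ℝ) : ℂ) ^ (s : ℂ) * ((4 * Real.pi : ℝ) : ℂ) ^ (-s : ℂ) = 1 := by
    rw [← Complex.cpow_add _ _ (by exact_mod_cast (by positivity : 4 * Real.pi ≠ 0))]
    simp
  rw [gammaExtOne, if_neg hn, brPow_mul_left ε (by positivity) hn', eq_div_iff (brPow_ne_zero ε hn' _)]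
  push_cast at h2 ⊢
  linear_combination incGamma ε s (2 * Real.pi * n) * h2 + (incGamma ε s (2 * Real.pi * n) *
    ((4 * Real.pi : ℂ) ^ (s : ℂ) * (4 * Real.pi : ℂ) ^ (-s : ℂ))) * h1

/-- Conjugation turns the branch `-ε` into `ε`, the branch of the nonholomorphic part, and so
identifies the first series with the terms of the Eichler integral at `p = 1`. -/
lemma conj_termInfty {h : ℍ → ℂ} (hh : ∀ n, coeffInfty h n = shadowCoeff ε s am n) {n : ℤ}
    (hn : n ≠ 0) : conj (termInfty (-ε) h r s n)
      = -((4 * Real.pi : ℂ) ^ (s : ℂ) * eichlerTerm ε s am (r : ℂ) 1 n) := by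
  have hn' : (n : ℝ) ≠ 0 := by exact_mod_cast hn
  have h1 := four_pi_cpow_mul_gammaExtOne ε s hn
  have h2 : conj (cexp (2 * Real.pi * Complex.I * n * (r : ℂ)))
      = cexp (-(2 * Real.pi * Complex.I * n * (r : ℂ))) := by
    rw [← Complex.exp_conj]
    congr 1
    simp only [map_mul, Complex.conj_I, Complex.conj_ofReal, map_ofNat, map_intCast, map_ratCast]
    ring
  rw [termInfty, if_neg hn, map_mul, map_div₀, map_mul, conj_brPow _ hn',
    conj_incGamma _ _ (two_pi_mul_ne_zero hn), neg_neg, Complex.conj_ofReal, hh, h2, eichlerTerm,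
    gammaExt_one]
  linear_combination (-(conj (shadowCoeff ε s am n) *
    cexp (-(2 * Real.pi * Complex.I * n * (r : ℂ))))) * h1

lemma summable_eichlerTerm_one (hG : ContDiffOn ℝ ∞ (ext g) {z : ℂ | 0 < z.im})
    (hdec : IsMaassDecomposition ε (1 - s) g gp gm ap am) (hs : s ≠ 0) (r : ℚ) :
    Summable fun n => ‖eichlerTerm ε s am (r : ℂ) 1 n‖ := by
  refine Summable.of_nonneg_of_le (fun n => norm_nonneg _) (fun n => ?_)
    (summable_shadowCoeff_mul_gammaExtOne hG hdec hs)
  rw [norm_eichlerTerm, gammaExt_one, Complex.ratCast_im, mul_zero, mul_zero, Real.exp_zero]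
  exact mul_le_mul_of_nonneg_left (by linarith [Real.exp_pos (n * (Real.pi / 2))]) (by positivity)

lemma norm_four_pi_cpow (s : ℝ) : ‖(4 * Real.pi : ℂ) ^ (s : ℂ)‖ = (4 * Real.pi) ^ s := by
  have := norm_cpow_of_re_pos (p := ((4 * Real.pi : ℝ) : ℂ))
    (by rw [Complex.ofReal_re]; positivity) s
  rw [Complex.norm_real, Real.norm_of_nonneg (by positivity)] at this
  rw [← this]
  push_cast
  rfl

lemma summable_termInfty (hG : ContDiffOn ℝ ∞ (ext g) {z : ℂ | 0 < z.im})
    (hdec : IsMaassDecomposition ε (1 - s) g gp gm ap am) (hs : s ≠ 0) (r : ℚ) :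
    Summable fun n => ‖termInfty (-ε) (xi (1 - s) g) r s n‖ := by
  refine Summable.of_nonneg_of_le (fun n => norm_nonneg _) (fun n => ?_)
    ((summable_eichlerTerm_one hG hdec hs r).mul_left ((4 * Real.pi) ^ s))
  by_cases hn : n = 0
  · rw [termInfty, if_pos hn, norm_zero]
    positivity
  · rw [← RCLike.norm_conj, conj_termInfty (coeffInfty_xi hG hdec hs) hn, norm_neg, norm_mul,
      norm_four_pi_cpow]

/-- The Eichler integral also has a term `n = 0`. It accounts for the summand `-(2π)^s b(0)/s` of
`Λ_r`, as `(4π)^s 2^{-s} = (2π)^s`. -/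
lemma conj_tsum_termInfty (hG : ContDiffOn ℝ ∞ (ext g) {z : ℂ | 0 < z.im})
    (hdec : IsMaassDecomposition ε (1 - s) g gp gm ap am) (hs : s ≠ 0) (r : ℚ) :
    conj (∑' n, termInfty (-ε) (xi (1 - s) g) r s n) = (4 * Real.pi : ℂ) ^ (s : ℂ) *
      (conj (shadowCoeff ε s am 0) * (2 : ℂ) ^ (-s : ℂ) / s - eichler ε s am (r : ℂ) 1) := by
  have h1 := (summable_eichlerTerm_one hG hdec hs r).of_norm
  have h2 : eichlerTerm ε s am (r : ℂ) 1 0 = conj (shadowCoeff ε s am 0) * (2 : ℂ) ^ (-s : ℂ) / s := by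
    rw [eichlerTerm, gammaExt_one, gammaExtOne, if_pos rfl]
    simp
    ring
  rw [Complex.conj_tsum, eichler, h1.tsum_eq_add_tsum_ite 0, h2, sub_add_cancel_left, ← tsum_neg,
    ← tsum_mul_left]
  refine tsum_congr fun n => ?_
  split_ifs with hn
  · rw [termInfty, if_pos hn]; simp
  · rw [conj_termInfty (coeffInfty_xi hG hdec hs) hn]
    ring

lemma cuspTerm_eq (n : ℤ) :
    cuspTerm ε s am (pt (-(γ 1 1 / γ 1 0)) (1 / (γ 1 0 : ℝ) ^ 2)) n =
      -((2 : ℂ) ^ (-s : ℂ) / (2 * Real.pi)) * conj (cuspSeriesTerm (shadowCoeff ε s am) γ n) := by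
  rw [cuspTerm, cuspSeriesTerm]
  split_ifs with hn
  · simp
  have h1 : cexp (-(2 * Real.pi * Complex.I * n *
      conj (pt (-(γ 1 1 / γ 1 0)) (1 / (γ 1 0 : ℝ) ^ 2)))) =
      conj (cexp (-(2 * Real.pi * Complex.I * n * (γ 1 1 / γ 1 0)))) *
        conj (cexp (-(2 * Real.pi * n / (γ 1 0) ^ 2))) := by
    rw [← Complex.exp_conj, ← Complex.exp_conj, ← Complex.exp_add]
    congr 1
    simp only [pt, map_add, map_mul, map_neg, map_div₀, map_pow, Complex.conj_ofReal,
      Complex.conj_I, map_ofNat, map_intCast]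
    push_cast
    linear_combination (2 * Real.pi * n / (γ 1 0 : ℂ) ^ 2) * Complex.I_sq
  rw [h1, map_mul, map_div₀, map_mul, map_intCast]
  have hn0 : (n : ℂ) ≠ 0 := by exact_mod_cast hn
  have hpi : (Real.pi : ℂ) ≠ 0 := by exact_mod_cast Real.pi_ne_zero
  field_simp

lemma summable_cuspSeriesTerm (hG : ContDiffOn ℝ ∞ (ext g) {z : ℂ | 0 < z.im})
    (hdec : IsMaassDecomposition ε (1 - s) g gp gm ap am) (hs : s ≠ 0) (hc : 0 < γ 1 0) :
    Summable fun n => ‖cuspSeriesTerm (shadowCoeff ε s am) γ n‖ := by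
  have hc' : (0 : ℝ) < γ 1 0 := by exact_mod_cast hc
  have h := summable_cuspTerm hG hdec hs (w := pt (-(γ 1 1 / γ 1 0)) (1 / (γ 1 0 : ℝ) ^ 2))
    (by rw [pt_im]; positivity)
  simp_rw [cuspTerm_eq, norm_mul, RCLike.norm_conj] at h
  refine (summable_mul_left_iff ?_).mp h
  have h2 : (2 : ℂ) ^ (-s : ℂ) ≠ 0 := by simp [Complex.cpow_eq_zero_iff]
  simp [h2, Real.pi_ne_zero]

lemma two_mul_cpow {c : ℝ} (hc : 0 < c) (t : ℂ) : (2 * (c : ℂ)) ^ t = (2 : ℂ) ^ t * (c : ℂ) ^ t := by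
  have := Complex.mul_cpow_ofReal_nonneg two_pos.le hc.le t
  simpa using this

/-- The conjugate of the regularized `L`-function at `k - 1` in terms of the Eichler integrals. -/
theorem conj_completedRegL (hG : ContDiffOn ℝ ∞ (ext g) {z : ℂ | 0 < z.im})
    (hdec : IsMaassDecomposition ε (1 - s) g gp gm ap am) (hs : s ≠ 0) (hc : 0 < γ 1 0)
    (hr : r = (γ 0 0 : ℚ) / (γ 1 0 : ℚ)) (hu : u ≠ 0)
    (hg : ∀ z, g (γ • z) = u * autFactor γ z ^ (1 - s : ℂ) * g z)
    (D : CuspExpansion (s + 1 : ℂ) (xi (1 - s) g) r) :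
    Summable (fun n => ‖termCusp (-ε) D s n‖) ∧
    conj (completedRegL (-ε) D s) / (4 * Real.pi : ℂ) ^ (s : ℂ)
      + (-Complex.I) ^ (s + 1 : ℂ) * u / (2 * γ 1 0 : ℂ) ^ (s : ℂ) * conj (shadowCoeff ε s am 0) =
    u * (Complex.I ^ (1 - s : ℂ) * (γ 1 0 : ℂ) ^ (1 - s : ℂ)) *
        ((∑' n, cuspTerm ε s am (pt (-(γ 1 1 / γ 1 0)) (1 / (γ 1 0 : ℝ) ^ 2)) n) +
          conj (shadowCoeff ε s am 0) * (2 : ℂ) ^ (-s : ℂ) * (1 / (γ 1 0 : ℂ) ^ 2 - 1 / γ 1 0))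
        - eichler ε s am ((γ 0 0 / γ 1 0 : ℝ) : ℂ) 1 := by
  have hc' : (0 : ℝ) < γ 1 0 := by exact_mod_cast hc
  have hc0 : (γ 1 0 : ℂ) ≠ 0 := by exact_mod_cast hc.ne'
  have hs' : (s : ℂ) ≠ 0 := by exact_mod_cast hs
  have hpi := Real.pi_pos
  have hpi0 : (Real.pi : ℂ) ≠ 0 := by exact_mod_cast Real.pi_ne_zero
  obtain ⟨E, hE, hpow, hsq, hsum, htsum, hcoeff, hκ⟩ := D.tsum_termCusp (-ε) hc hr
    ((map_ne_zero (starRingEnd ℂ)).mpr hu) (xi_smul hG hc hg) (hasSum_xi hG hdec hs)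
    (xi_eq_zero_imp hG hdec hs) (summable_cuspSeriesTerm hG hdec hs hc)
  have hk : (s + 1 - 1 : ℂ) = s := by ring
  rw [hk] at hsum htsum
  refine ⟨hsum, ?_⟩
  set T := ∑' n, cuspSeriesTerm (shadowCoeff ε s am) γ n with hT
  set b₀ := shadowCoeff ε s am 0 with hb₀
  set c : ℂ := ((γ 1 0 : ℤ) : ℂ) with hcdef
  have hcr : c = ((γ 1 0 : ℝ) : ℂ) := by rw [hcdef]; push_cast; rfl
  have hT' : (∑' n, cuspTerm ε s am (pt (-(γ 1 1 / γ 1 0)) (1 / (γ 1 0 : ℝ) ^ 2)) n)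
      = -((2 : ℂ) ^ (-s : ℂ) / (2 * Real.pi)) * conj T := by
    rw [hT, Complex.conj_tsum, ← tsum_mul_left]
    exact tsum_congr cuspTerm_eq
  have hrc : ((γ 0 0 / γ 1 0 : ℝ) : ℂ) = (r : ℂ) := by rw [hr]; push_cast; rfl
  have hck : c ^ (s + 1 : ℂ) ≠ 0 := by simp [Complex.cpow_eq_zero_iff, hc0]
  have e1 : completedRegL (-ε) D s = (∑' n, termInfty (-ε) (xi (1 - s) g) r s n)
      + Complex.I ^ (s + 1 : ℂ) / c ^ (s + 1 : ℂ) * (2 * Real.pi : ℂ) ^ (s - 1 : ℂ) * c ^ 2 *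
        (conj u * T) - (2 * Real.pi : ℂ) ^ (s : ℂ) * b₀ / s -
      Complex.I ^ (s + 1 : ℂ) * (2 * Real.pi : ℂ) ^ (s : ℂ) * (conj u * b₀) / c ^ (s + 1 : ℂ) := by
    have k1 : (2 * s - (s + 1) : ℂ) = s - 1 := by ring
    have k2 : (s + 1 - s : ℂ) = 1 := by ring
    -- The case `κ ≠ 0` can occur only for `h = 0`, and then the constant term is zero as well.
    have k3 : (if D.κ = 0 then Complex.I ^ (s + 1 : ℂ) * (2 * Real.pi : ℂ) ^ (s : ℂ) * D.coeff 0 /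
        ((D.σ 1 0 : ℂ) ^ (s + 1 : ℂ) * (s + 1 - s)) else 0) =
        Complex.I ^ (s + 1 : ℂ) * (2 * Real.pi : ℂ) ^ (s : ℂ) * (conj u * b₀) / c ^ (s + 1 : ℂ) := by
      split_ifs with h
      · rw [hcoeff, k2, hpow]
        field_simp
      · rw [hκ h, mul_zero, mul_zero, zero_div]
    rw [completedRegL, k3, k1, k2, htsum, hpow, hsq, coeffInfty_xi hG hdec hs, Complex.cpow_one]
    congr 2
    field_simp
  have hI : conj (Complex.I ^ (s + 1 : ℂ)) = -Complex.I ^ (1 - s : ℂ) := by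
    have := conj_I_cpow (s + 1)
    push_cast at this
    rw [this, neg_I_cpow]
  have hcc : ∀ t : ℝ, conj (c ^ (t : ℂ)) = c ^ (t : ℂ) := fun t => by
    rw [hcr, conj_ofReal_mul_cpow hc']
  have h2p : ∀ t : ℝ, conj ((2 * Real.pi : ℂ) ^ (t : ℂ)) = (2 * Real.pi : ℂ) ^ (t : ℂ) := fun t => by
    have := conj_ofReal_mul_cpow (c := 2 * Real.pi) (by positivity) t
    push_cast at this
    exact this
  have hcc1 := hcc (s + 1)
  have h2p1 := h2p (s - 1)
  push_cast at hcc1 h2p1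
  have hcconj : conj c = c := by rw [hcr, Complex.conj_ofReal]
  have p1 : (4 * Real.pi : ℂ) ^ (s : ℂ) = (2 : ℂ) ^ (s : ℂ) * (2 * Real.pi : ℂ) ^ (s : ℂ) := by
    have := two_mul_cpow (c := 2 * Real.pi) (by positivity) s
    push_cast at this
    rw [← this]; ring_nf
  have p2 : (2 * Real.pi : ℂ) ^ (s - 1 : ℂ) = (2 * Real.pi : ℂ) ^ (s : ℂ) / (2 * Real.pi) := by
    rw [Complex.cpow_sub _ _ (by simp [hpi0]), Complex.cpow_one]
  have p3 : c ^ (s + 1 : ℂ) = c ^ (s : ℂ) * c := by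
    rw [Complex.cpow_add _ _ hc0, Complex.cpow_one]
  have p4 : c ^ (1 - s : ℂ) = c / c ^ (s : ℂ) := by
    rw [Complex.cpow_sub _ _ hc0, Complex.cpow_one]
  have p5 : (2 * c) ^ (s : ℂ) = (2 : ℂ) ^ (s : ℂ) * c ^ (s : ℂ) := by
    rw [hcr, two_mul_cpow hc']
  have n1 : (2 : ℂ) ^ (s : ℂ) ≠ 0 := by simp [Complex.cpow_eq_zero_iff]
  have n2 : (2 * Real.pi : ℂ) ^ (s : ℂ) ≠ 0 := by simp [Complex.cpow_eq_zero_iff, hpi0]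
  have n3 : c ^ (s : ℂ) ≠ 0 := by simp [Complex.cpow_eq_zero_iff, hc0]
  rw [e1, hT', hrc, map_sub, map_sub, map_add, conj_tsum_termInfty hG hdec hs]
  simp only [map_mul, map_div₀, map_pow, hI, hcc1, h2p1, h2p, hcconj, Complex.conj_conj,
    Complex.conj_ofReal]
  -- The constants match in pairs: the last summand of `Λ_r` gives `1/c²`, and the explicit term
  -- with `(2c)^{-s}` gives `-1/c`, in agreement with the shifts of `q`.
  rw [neg_I_cpow, p1, p2, p3, p4, p5, Complex.cpow_neg]
  field_simp
  ring

end LFunction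

end RadialLimit

end

/-! ### The limit theorem -/

theorem theorem4p2
    -- the level, and the weight `k = m / 2`
    (N : ℕ) (hN : 0 < N) (m : ℤ) (k : ℂ) (hk : k = (m : ℂ) / 2) (hk1 : k ≠ 1)
    -- the branch on the negative axis: `ε` in the nonholomorphic part, `-ε` in the `L`-function
    (ε : ℤˣ)
    -- `g` is a harmonic weak Maass form of weight `2 - k = (4 - m) / 2`
    (g gp gm : ℍ → ℂ) (ap am : ℤ → ℂ)
    (hg : RadialLimit.IsHarmonicMaassForm N (4 - m) g)
    (hdec : RadialLimit.IsMaassDecomposition ε (2 - k) g gp gm ap am)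
    -- `g⁺` has neither principal part nor constant term at `i∞`
    (hap : ∀ n : ℤ, n ≤ 0 → ap n = 0)
    (γ : SL(2, ℤ)) (hγ : γ ∈ CongruenceSubgroup.Gamma0 (4 * N)) (a c d : ℤ)
    (ha : γ 0 0 = a) (hc : γ 1 0 = c) (hd : γ 1 1 = d) (hc0 : 0 < c)
    (r : ℚ) (hr : r = (a : ℚ) / (c : ℚ))
    (h : ℍ → ℂ) (hh : h = RadialLimit.xi (2 - k) g)
    (b₀ : ℂ) (hb₀ : b₀ = RadialLimit.coeffInfty h 0)
    (D : RadialLimit.CuspExpansion k h r) :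
    -- the two series in `L_r^reg(h, k - 1)` converge absolutely
    Summable (fun n : ℤ => ‖RadialLimit.termInfty (-ε) h r (k - 1) n‖) ∧
    Summable (fun n : ℤ => ‖RadialLimit.termCusp (-ε) D (k - 1) n‖) ∧
    -- the limit along `γ(x + i / (c² t))`, for every real `x`
    (∀ x : ℝ, Tendsto
      (fun t : ℝ =>
        gp (γ • ofComplex ((x : ℂ) + 1 / ((c : ℂ) ^ 2 * t) * Complex.I))
        - RadialLimit.thetaMult γ ^ (-m) * conj b₀ / ((2 : ℂ) ^ (k - 1) * (k - 1))
          * ((c : ℂ) * ((x : ℂ) + 1 / ((c : ℂ) ^ 2 * t) * Complex.I) + d) ^ (2 - k)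
          * ((1 / ((c : ℂ) ^ 2 * t) + 1 / (c : ℂ)) - Complex.I * ((x : ℂ) + (d : ℂ) / c))
              ^ (k - 1))
      (𝓝[>] 0)
      (𝓝 (conj (RadialLimit.completedRegL (-ε) D (k - 1)) / (4 * Real.pi : ℂ) ^ (k - 1)
        + (-Complex.I) ^ k * RadialLimit.thetaMult γ ^ (-m) / (2 * c : ℂ) ^ (k - 1) * conj b₀))) ∧
    -- the case `x = -d / c`
    Tendsto
      (fun t : ℝ =>
        gp (ofComplex ((r : ℂ) + Complex.I * t))
        - RadialLimit.thetaMult γ ^ (-m) * conj b₀ / ((2 : ℂ) ^ (k - 1) * (k - 1))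
          * (Complex.I / ((c : ℂ) * t)) ^ (2 - k)
          * (1 / ((c : ℂ) ^ 2 * t) + 1 / (c : ℂ)) ^ (k - 1))
      (𝓝[>] 0)
      (𝓝 (conj (RadialLimit.completedRegL (-ε) D (k - 1)) / (4 * Real.pi : ℂ) ^ (k - 1)
        + (-Complex.I) ^ k * RadialLimit.thetaMult γ ^ (-m) / (2 * c : ℂ) ^ (k - 1) * conj b₀)) ∧
    -- the first term of the limit in terms of `L_r^reg(h, k - 1)`, where `Γ(k - 1)` is finite
    ((∀ j : ℕ, k - 1 ≠ -(j : ℂ)) →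
      conj (RadialLimit.completedRegL (-ε) D (k - 1)) / (4 * Real.pi : ℂ) ^ (k - 1)
        = Complex.Gamma (k - 1) / (4 * Real.pi : ℂ) ^ (k - 1)
          * conj (RadialLimit.regL (-ε) D (k - 1))) := by
  obtain ⟨s, hs⟩ : ∃ s : ℝ, k = s + 1 := ⟨m / 2 - 1, by rw [hk]; push_cast; ring⟩
  have hs0 : s ≠ 0 := by
    rintro rfl
    exact hk1 (by rw [hs]; simp)
  have e1 : k - 1 = s := by rw [hs]; ring
  have e2 : 2 - k = 1 - s := by rw [hs]; ring
  have hν : ((4 - m : ℤ) : ℂ) / 2 = 1 - s := by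
    rw [← e2, hk]; push_cast; ring
  have hγ4 := RadialLimit.mem_Gamma0_four hγ
  rw [e2] at hdec hh
  subst hh hs
  rw [e1, e2]
  have hG := hg.smooth
  have hγ10 : 0 < γ 1 0 := hc.symm ▸ hc0
  -- On `Γ₀(4)` the multiplier is a fourth root of unity, so the defining factor `conj χ_θ^{4-m}` is
  -- `χ_θ^m`, and it moves to the other side as `χ_θ^{-m}`.
  have hmod : ∀ z, g (γ • z) = RadialLimit.thetaMult γ ^ (-m) *
      RadialLimit.autFactor γ z ^ (1 - s : ℂ) * g z := by
    intro z
    have h1 := hg.modular γ hγ z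
    rw [hν, RadialLimit.conj_thetaMult_zpow hγ4] at h1
    have h2 : RadialLimit.thetaMult γ ^ m ≠ 0 := zpow_ne_zero _ (RadialLimit.thetaMult_ne_zero hγ4)
    have h3 : RadialLimit.autFactor γ z ^ (1 - s : ℂ) ≠ 0 := by
      simp [Complex.cpow_eq_zero_iff, RadialLimit.autFactor_ne_zero]
    rw [← h1, zpow_neg, Complex.cpow_neg]
    field_simp
  have hu : RadialLimit.thetaMult γ ^ (-m) ≠ 0 := zpow_ne_zero _ (RadialLimit.thetaMult_ne_zero hγ4)
  rw [← ha, ← hc] at hr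
  obtain ⟨hsum, hL⟩ := RadialLimit.conj_completedRegL hG hdec hs0 hγ10 hr hu hmod D
  have hlim := RadialLimit.tendsto_holomorphicPart_smul hG hdec hs0 hγ10 hmod hap
  rw [← hL] at hlim
  rw [RadialLimit.coeffInfty_xi hG hdec hs0] at hb₀
  rw [← hb₀, hc, hd] at hlim
  have hcr : (0 : ℝ) < c := by exact_mod_cast hc0
  have hcc : (c : ℂ) ≠ 0 := by exact_mod_cast hc0.ne'
  -- The height is `Y = 1/(c²t)`.
  have hY : Tendsto (fun t : ℝ => 1 / ((c : ℝ) ^ 2 * t)) (𝓝[>] 0) atTop := by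
    have h1 := tendsto_inv_nhdsGT_zero (𝕜 := ℝ).const_mul_atTop (by positivity : 0 < 1 / (c : ℝ) ^ 2)
    exact h1.congr fun t => by rw [one_div_mul_eq_div, one_div, mul_inv, div_eq_mul_inv, mul_comm]
  have hmain : ∀ x : ℝ, Tendsto
      (fun t : ℝ =>
        gp (γ • ofComplex ((x : ℂ) + 1 / ((c : ℂ) ^ 2 * t) * Complex.I))
        - RadialLimit.thetaMult γ ^ (-m) * conj b₀ / ((2 : ℂ) ^ (s : ℂ) * s)
          * ((c : ℂ) * ((x : ℂ) + 1 / ((c : ℂ) ^ 2 * t) * Complex.I) + d) ^ (1 - s : ℂ)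
          * ((1 / ((c : ℂ) ^ 2 * t) + 1 / (c : ℂ)) - Complex.I * ((x : ℂ) + (d : ℂ) / c))
              ^ (s : ℂ))
      (𝓝[>] 0)
      (𝓝 (conj (RadialLimit.completedRegL (-ε) D s) / (4 * Real.pi : ℂ) ^ (s : ℂ)
        + (-Complex.I) ^ (s + 1 : ℂ) * RadialLimit.thetaMult γ ^ (-m) / (2 * c : ℂ) ^ (s : ℂ)
          * conj b₀)) := by
    intro x
    refine ((hlim x).comp hY).congr fun t => ?_
    have k1 : RadialLimit.pt x (1 / ((c : ℝ) ^ 2 * t)) =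
        (x : ℂ) + 1 / ((c : ℂ) ^ 2 * t) * Complex.I := by
      rw [RadialLimit.pt]; push_cast; rfl
    have k2 : RadialLimit.pt (1 / ((c : ℝ) ^ 2 * t)) (-(x + d / c)) + ((1 / (c : ℝ) : ℝ) : ℂ) =
        (1 / ((c : ℂ) ^ 2 * t) + 1 / (c : ℂ)) - Complex.I * ((x : ℂ) + (d : ℂ) / c) := by
      rw [RadialLimit.pt]; push_cast; ring
    rw [Function.comp_apply, k1, k2]
  refine ⟨RadialLimit.summable_termInfty hG hdec hs0 r, hsum, hmain, ?_, fun hpole => ?_⟩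
  -- For `x = -d/c` one has `j = i/(ct)`, and `γ` maps the vertical line to the vertical line above
  -- `r`.
  · refine (hmain (-(d / c))).congr' ?_
    filter_upwards [self_mem_nhdsWithin] with t ht
    have ht0 : (0 : ℝ) < t := ht
    have htc : (t : ℂ) ≠ 0 := by exact_mod_cast ht0.ne'
    have him : 0 < ((-(d / c) : ℝ) + 1 / ((c : ℂ) ^ 2 * t) * Complex.I : ℂ).im := by
      have : (1 / ((c : ℂ) ^ 2 * t)) = ((1 / ((c : ℝ) ^ 2 * t) : ℝ) : ℂ) := by push_cast; rfl
      rw [this, Complex.add_im, Complex.ofReal_im, Complex.im_ofReal_mul, Complex.I_im]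
      positivity
    have him' : 0 < ((r : ℂ) + Complex.I * t).im := by simpa using ht0
    have k1 : (c : ℂ) * (((-(d / c) : ℝ) : ℂ) + 1 / ((c : ℂ) ^ 2 * t) * Complex.I) + d
        = Complex.I / (c * t) := by
      push_cast
      field_simp
      ring
    have k2 : (1 / ((c : ℂ) ^ 2 * t) + 1 / (c : ℂ)) -
        Complex.I * (((-(d / c) : ℝ) : ℂ) + (d : ℂ) / c) = 1 / ((c : ℂ) ^ 2 * t) + 1 / (c : ℂ) := by
      push_cast
      ring
    have k3 : γ • ofComplex (((-(d / c) : ℝ) : ℂ) + 1 / ((c : ℂ) ^ 2 * t) * Complex.I) =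
        ofComplex ((r : ℂ) + Complex.I * t) := by
      apply UpperHalfPlane.ext
      rw [RadialLimit.coe_smul_eq_sub hγ10, RadialLimit.autFactor_ofComplex γ him,
        RadialLimit.coe_ofComplex him', hc, hd, k1, hr, hc]
      have hI := Complex.I_ne_zero
      push_cast
      field_simp
      linear_combination (-(c : ℂ) * t) * Complex.I_sq
    rw [k1, k2, k3]
  -- Away from its poles `Γ` has no zeros, so the factor `1/Γ(s)` in the `L`-function can be
  -- cleared; it is real because `s` is.
  · have h1 : Complex.Gamma s ≠ 0 := Complex.Gamma_ne_zero hpole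
    have h2 : conj (Complex.Gamma s) = Complex.Gamma s := by
      rw [← Complex.Gamma_conj, Complex.conj_ofReal]
    rw [RadialLimit.regL, map_mul, map_div₀, h2, map_one]
    field_simp
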